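/- **Setting.** Let $\mathcal E$ be a real countably-Hilbert space (complete, with topology given by Hilbertian norms $|\cdot|_p$, $p=0,1,2,\dots$), let $\mathcal E_p$ be the completion of $\mathcal E$ with respect to $|\cdot|_p$, and assume: (a) there is $0<\rho<1$ with $|\cdot|_0\le\rho|\cdot|_1\le\cdots\le\rho^p|\cdot|_p\le\cdots$; (b) for every $p\ge0$ there is $q>p$ such that the inclusion $i_{q,p}:\mathcal E_q\to\mathcal E_p$ is Hilbert–Schmidt with $\|i_{q,p}\|_{HS}<1$ (the maps $i_{q,p}$ are injective, i.e. $\mathcal E\subset\mathcal E_q\subset\mathcal E_p\subset\mathcal E_0$ for $p\le q$). Identify $\mathcal E_0$ with its dual, so that $\mathcal E\subset\mathcal E_p\subset\mathcal E_0\subset\mathcal E_p'\subset\mathcal E'$; let $|\cdot|_{-p}$ be the norm of $\mathcal E_p'$, and let $\mathcal E_c$ be the complexification of $\mathcal E$. Let $\mu$ be the standard Gaussian measure on $\mathcal E'$, $\int e^{i\langle x,\xi\rangle}d\mu(x)=e^{-|\xi|_0^2/2}$, and $(L^2)=L^2(\mathcal E',\mu;\mathbb C)$, with Wiener–Itô decomposition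 $\varphi=\sum_n\langle:\!\cdot^{\otimes n}\!:,f_n\rangle$. Let $(\alpha(n))_{n\ge0}$ satisfy (A1) $\alpha(0)=1$, $\inf_n\alpha(n)>0$ and (A2) $\lim_n(\alpha(n)/n!)^{1/n}=0$. Put $\|\varphi\|_{p,\alpha}^2=\sum_n n!\,\alpha(n)|f_n|_p^2$, $[\mathcal E_p]_\alpha=\{\varphi\in(L^2):\|\varphi\|_{p,\alpha}<\infty\}$, let $[\mathcal E]_\alpha=\bigcap_p[\mathcal E_p]_\alpha$ with the projective limit topology, and let $[\mathcal E]_\alpha^*$ be its dual, which contains $(L^2)$ through the bilinear pairing $\langle\!\langle\varphi,\psi\rangle\!\rangle=\int\varphi\psi\,d\mu$. The $S$-transform of $\Phi\in[\mathcal E]_\alpha^*$ is $S\Phi(\xi)=\langle\!\langle\Phi,:\!e^{\langle\cdot,\xi\rangle}\!:\rangle\!\rangle$, $\xi\in\mathcal E_c$, where $:\!e^{\langle x,\xi\rangle}\!:\,=e^{\langle x,\xi\rangle-\langle\xi,\xi\rangle/2}$. Let $G_{1/\alpha}(r)=\sum_{n\ge0}\frac{r^n}{n!\,\alpha(n)}$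 and $c_n=n!\,\alpha(n)\inf_{r>0}\frac{G_{1/\alpha}(r)}{r^n}$. **Lemma.** Assume $(\widetilde{\mathrm B}1)$: $\limsup_{n\to\infty}c_n^{1/n}<\infty$. Let $F:\mathcal E_c\to\mathbb C$ satisfy: (1) for all $\xi,\eta\in\mathcal E_c$ the function $z\mapsto F(z\xi+\eta)$ is entire on $\mathbb C$; (2) there are constants $K,a\ge0$ and an integer $p\ge0$ with $|F(\xi)|\le K\,G_{1/\alpha}(a|\xi|_{-p}^2)^{1/2}$ for all $\xi\in\mathcal E_c$. Then there is a unique $\varphi\in[\mathcal E]_\alpha^*$ with $F=S\varphi$. Moreover $\varphi\in[\mathcal E_q]_\alpha$ for every integer $q\in[0,p]$ with $$a e^2\|i_{p,q}\|_{HS}^2\,\limsup_{n\to\infty}c_n^{1/n}<1,$$ and for such $q$ the series below converges and $$\|\varphi\|_{q,\alpha}^2\le K^2+\frac{K^2}{2\pi}\sum_{n=1}^\infty c_n\big(ae^2\|i_{p,q}\|_{HS}^2\big)^n .$$ -/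

import Mathlib

open MeasureTheory ProbabilityTheory Filter Topology
open scoped NNReal ENNReal

noncomputable section

namespace WhiteNoise

/-! ### Hilbert–Schmidt norms -/

/-- The square `‖T‖²_HS` of the Hilbert–Schmidt norm of an operator between real Hilbert spaces:
the supremum of `∑ ‖T v‖²` over all finite orthonormal sets. Enlarging an orthonormal set only
increases the sum, so this is the sum over any orthonormal basis; it is `∞` exactly when `T` is not
Hilbert–Schmidt. -/
def hilbertSchmidtSq {H K : Type*} [NormedAddCommGroup H] [InnerProductSpace ℝ H]
    [NormedAddCommGroup K] [InnerProductSpace ℝ K] (T : H →L[ℝ] K) : ℝ≥0∞ :=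
  ⨆ (s : Finset H) (_ : Orthonormal ℝ (fun v : s => (v : H))), ∑ v ∈ s, ‖T v‖ₑ ^ 2

/-- The square of the Hilbert–Schmidt norm of an `n`-linear form `f` on a real vector space `E`
with respect to a bilinear inner product `B` on `E`: the supremum of
`∑_{j₁,…,jₙ} |f(e_{j₁},…,e_{jₙ})|²` over all finite `B`-orthonormal families `e₁,…,eₘ`. -/
def hsFormSq {E : Type*} (B : E → E → ℝ) {n : ℕ} (f : (Fin n → E) → ℂ) : ℝ≥0∞ :=
  ⨆ (m : ℕ) (e : Fin m → E) (_ : ∀ i j, B (e i) (e j) = if i = j then 1 else 0),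
    ∑ j : Fin n → Fin m, ‖f (fun k => e (j k))‖ₑ ^ 2

theorem enorm_add_sq_le (a b : ℂ) : ‖a + b‖ₑ ^ 2 ≤ 2 * ‖a‖ₑ ^ 2 + 2 * ‖b‖ₑ ^ 2 := by
  have h : ‖a + b‖₊ ^ 2 ≤ 2 * ‖a‖₊ ^ 2 + 2 * ‖b‖₊ ^ 2 := by
    rw [← mul_add]
    exact (pow_le_pow_left₀ zero_le (nnnorm_add_le a b) 2).trans add_sq_le
  simp only [enorm_eq_nnnorm]
  exact_mod_cast h

theorem hsFormSq_add_le {E : Type*} (B : E → E → ℝ) {n : ℕ} (f g : (Fin n → E) → ℂ) :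
    hsFormSq B (fun ξ => f ξ + g ξ) ≤ 2 * hsFormSq B f + 2 * hsFormSq B g := by
  refine iSup_le fun m => iSup_le fun e => iSup_le fun he => ?_
  have hf : ∑ j : Fin n → Fin m, ‖f (fun k => e (j k))‖ₑ ^ 2 ≤ hsFormSq B f :=
    le_iSup_of_le m (le_iSup_of_le e (le_iSup_of_le he le_rfl))
  have hg : ∑ j : Fin n → Fin m, ‖g (fun k => e (j k))‖ₑ ^ 2 ≤ hsFormSq B g :=
    le_iSup_of_le m (le_iSup_of_le e (le_iSup_of_le he le_rfl))
  refine le_trans ?_ (add_le_add (mul_le_mul_right hf 2) (mul_le_mul_right hg 2))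
  rw [Finset.mul_sum, Finset.mul_sum, ← Finset.sum_add_distrib]
  refine Finset.sum_le_sum fun j _ => ?_
  exact enorm_add_sq_le _ _

theorem hsFormSq_smul_le {E : Type*} (B : E → E → ℝ) {n : ℕ} (c : ℂ) (f : (Fin n → E) → ℂ) :
    hsFormSq B (fun ξ => c * f ξ) ≤ ‖c‖ₑ ^ 2 * hsFormSq B f := by
  refine iSup_le fun m => iSup_le fun e => iSup_le fun he => ?_
  have hf : ∑ j : Fin n → Fin m, ‖f (fun k => e (j k))‖ₑ ^ 2 ≤ hsFormSq B f :=
    le_iSup_of_le m (le_iSup_of_le e (le_iSup_of_le he le_rfl))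
  refine le_trans (le_of_eq ?_) (mul_le_mul_right hf _)
  rw [Finset.mul_sum]
  exact Finset.sum_congr rfl fun j _ => by rw [enorm_mul, mul_pow]

/-! ### Countably-Hilbert spaces -/

section NormCopy

variable {E : Type*} [AddCommGroup E] [Module ℝ E]

/-- A copy of `E` carrying the norm of the inner product `c`. -/
def NormCopy (_c : InnerProductSpace.Core ℝ E) : Type _ := E

instance (c : InnerProductSpace.Core ℝ E) : NormedAddCommGroup (NormCopy c) :=
  @InnerProductSpace.Core.toNormedAddCommGroup ℝ E _ _ _ c

instance (c : InnerProductSpace.Core ℝ E) : InnerProductSpace ℝ (NormCopy c) :=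
  InnerProductSpace.ofCore c.toCore

end NormCopy

/-- A sequence of Hilbertian norms `|·|_p`, `p = 0, 1, 2, …`, on a real vector space `E`, defining
its topology. With `E` complete this makes `E` a real countably-Hilbert space. -/
structure HilbertNorms (E : Type*) [AddCommGroup E] [Module ℝ E] [TopologicalSpace E] where
  core : ℕ → InnerProductSpace.Core ℝ E
  withSeminorms : WithSeminorms
    (fun p => (normSeminorm ℝ (NormCopy (core p)) : Seminorm ℝ E))

namespace HilbertNorms

variable {E : Type*} [AddCommGroup E] [Module ℝ E] [TopologicalSpace E] (S : HilbertNorms E)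

/-- The Hilbert space `E_p`, the completion of `E` with respect to `|·|_p`. -/
abbrev Ep (p : ℕ) : Type _ := UniformSpace.Completion (NormCopy (S.core p))

/-- The canonical map `E → E_p`. -/
def toEp (p : ℕ) : E →ₗ[ℝ] S.Ep p :=
  ((UniformSpace.Completion.toComplL :
    NormCopy (S.core p) →L[ℝ] S.Ep p) : NormCopy (S.core p) →ₗ[ℝ] S.Ep p)

/-- `i_{q,p} : E_q → E_p` for `p ≤ q`, the continuous extension of the identity of `E`. -/
def incl (q p : ℕ) : S.Ep q →L[ℝ] S.Ep p := (S.toEp p).extendOfNorm (S.toEp q)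

/-- The inner product `⟨ξ, η⟩` of `E_0`, restricted to `E`. -/
def inner0 (ξ η : E) : ℝ := inner ℝ (S.toEp 0 ξ) (S.toEp 0 η)

/-- The functional on `E_p` given by `ξ ∈ E ⊂ E_0 ⊂ E_p'`, namely `v ↦ ⟨ξ, v⟩`. -/
def toDualEp (p : ℕ) (ξ : E) : StrongDual ℝ (S.Ep p) :=
  (innerSL ℝ (S.toEp 0 ξ)).comp (S.incl p 0)

/-- The dual norm `|ξ|_{-p}` of `ξ ∈ E ⊂ E_p'`. -/
def normNeg (p : ℕ) (ξ : E) : ℝ := ‖S.toDualEp p ξ‖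

/-- The inner product of the Hilbert space `E_p'`, restricted to `E`. -/
def innerNeg (p : ℕ) (ξ η : E) : ℝ :=
  inner ℝ ((InnerProductSpace.toDual ℝ (S.Ep p)).symm (S.toDualEp p ξ))
    ((InnerProductSpace.toDual ℝ (S.Ep p)).symm (S.toDualEp p η))

/-- The standing assumptions on the norms. `norm_le` and `nuclear` are the usual conditions
`|·|_0 ≤ ρ|·|_1 ≤ ρ²|·|_2 ≤ ⋯` with `0 < ρ < 1`, and: for every `p` some `i_{q,p}`, `q > p`, is
Hilbert–Schmidt with `‖i_{q,p}‖_HS < 1`. `compatible` says that the maps `i_{q,p}` are indeed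
inclusions, `E ⊂ ⋯ ⊂ E_q ⊂ E_p ⊂ ⋯ ⊂ E_0`. -/
structure IsNuclear : Prop where
  norm_le : ∃ ρ : ℝ, 0 < ρ ∧ ρ < 1 ∧ ∀ (p : ℕ) (ξ : E), ‖S.toEp p ξ‖ ≤ ρ * ‖S.toEp (p + 1) ξ‖
  compatible : ∀ p q : ℕ, p ≤ q → Function.Injective (S.incl q p)
  nuclear : ∀ p : ℕ, ∃ q : ℕ, p < q ∧ hilbertSchmidtSq (S.incl q p) < 1

end HilbertNorms

/-! ### Complexification -/

/-- The complexification `E_c = E + iE`; the pair `(a, b)` is `a + ib`. -/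
def Complexification (E : Type*) : Type _ := E × E

namespace Complexification

variable {E : Type*} [AddCommGroup E] [Module ℝ E]

/-- The real part. -/
def re (ξ : Complexification E) : E := ξ.1

/-- The imaginary part. -/
def im (ξ : Complexification E) : E := ξ.2

instance : AddCommGroup (Complexification E) := inferInstanceAs (AddCommGroup (E × E))

instance : SMul ℂ (Complexification E) :=
  ⟨fun z ξ => (z.re • ξ.re - z.im • ξ.im, z.re • ξ.im + z.im • ξ.re)⟩

theorem smul_def (z : ℂ) (ξ : Complexification E) :
    z • ξ = ((z.re • ξ.re - z.im • ξ.im, z.re • ξ.im + z.im • ξ.re) : E × E) := rfl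

instance : Module ℂ (Complexification E) where
  one_smul ξ := by
    change ((1 : ℂ).re • ξ.1 - (1 : ℂ).im • ξ.2, (1 : ℂ).re • ξ.2 + (1 : ℂ).im • ξ.1) = ξ
    simp
    rfl
  mul_smul z w ξ := by
    change ((z * w).re • ξ.1 - (z * w).im • ξ.2, (z * w).re • ξ.2 + (z * w).im • ξ.1) =
      (z.re • (w.re • ξ.1 - w.im • ξ.2) - z.im • (w.re • ξ.2 + w.im • ξ.1),
        z.re • (w.re • ξ.2 + w.im • ξ.1) + z.im • (w.re • ξ.1 - w.im • ξ.2))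
    simp only [Complex.mul_re, Complex.mul_im]
    ext <;> simp only <;> module
  smul_zero z := by
    change (z.re • (0 : E) - z.im • (0 : E), z.re • (0 : E) + z.im • (0 : E)) = (0 : E × E)
    simp
  smul_add z ξ η := by
    change (z.re • (ξ.1 + η.1) - z.im • (ξ.2 + η.2), z.re • (ξ.2 + η.2) + z.im • (ξ.1 + η.1)) =
      ((z.re • ξ.1 - z.im • ξ.2) + (z.re • η.1 - z.im • η.2),
        (z.re • ξ.2 + z.im • ξ.1) + (z.re • η.2 + z.im • η.1))
    ext <;> simp only <;> module
  add_smul z w ξ := by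
    change ((z + w).re • ξ.1 - (z + w).im • ξ.2, (z + w).re • ξ.2 + (z + w).im • ξ.1) =
      ((z.re • ξ.1 - z.im • ξ.2) + (w.re • ξ.1 - w.im • ξ.2),
        (z.re • ξ.2 + z.im • ξ.1) + (w.re • ξ.2 + w.im • ξ.1))
    simp only [Complex.add_re, Complex.add_im]
    ext <;> simp only <;> module
  zero_smul ξ := by
    change ((0 : ℂ).re • ξ.1 - (0 : ℂ).im • ξ.2, (0 : ℂ).re • ξ.2 + (0 : ℂ).im • ξ.1) = (0 : E × E)
    simp

end Complexification

/-! ### Gaussian measure on the dual space, Wick powers -/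

/-- The dual space `E'`. -/
def DualSpace (E : Type*) [AddCommGroup E] [Module ℝ E] [TopologicalSpace E] : Type _ := E →L[ℝ] ℝ

section Gaussian

variable {E : Type*} [AddCommGroup E] [Module ℝ E] [TopologicalSpace E]

instance : FunLike (DualSpace E) E ℝ := inferInstanceAs (FunLike (E →L[ℝ] ℝ) E ℝ)

/-- `E'` carries the σ-algebra generated by the evaluations `x ↦ ⟨x, ξ⟩`, `ξ ∈ E`. -/
instance : MeasurableSpace (DualSpace E) :=
  ⨆ ξ : E, MeasurableSpace.comap (fun x : DualSpace E => x ξ) inferInstance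

namespace HilbertNorms

variable (S : HilbertNorms E)

/-- `μ` is the standard Gaussian measure on `E'`: the (unique) probability measure with
characteristic functional `∫ exp(i⟨x, ξ⟩) dμ(x) = exp(-|ξ|_0²/2)`. -/
class IsStandardGaussian (μ : Measure (DualSpace E)) : Prop where
  prob : IsProbabilityMeasure μ
  charFun : ∀ ξ : E, ∫ x : DualSpace E, Complex.exp (((x ξ : ℝ) : ℂ) * Complex.I) ∂μ =
    Complex.exp (-((S.inner0 ξ ξ : ℝ) : ℂ) / 2)

/-- The Wick monomial `⟨:x^{⊗n}:, ξ₁ ⊗ ⋯ ⊗ ξₙ⟩ = :⟨x, ξ₁⟩⋯⟨x, ξₙ⟩:`, through the recursion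
`:⟨x, ξ₁⟩⋯⟨x, ξₙ⟩: = ⟨x, ξ₁⟩ :⟨x, ξ₂⟩⋯⟨x, ξₙ⟩: - ∑_{j ≥ 2} ⟨ξ₁, ξⱼ⟩ :∏_{k ≠ 1, j} ⟨x, ξₖ⟩:`. -/
def wick : (n : ℕ) → (Fin n → E) → DualSpace E → ℝ
  | 0, _, _ => 1
  | 1, ξ, x => x (ξ 0)
  | n + 2, ξ, x => x (ξ 0) * wick (n + 1) (fun k => ξ k.succ) x -
      ∑ j : Fin (n + 1), S.inner0 (ξ 0) (ξ j.succ) * wick n (fun k => ξ (j.succAbove k).succ) x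

/-- The renormalized exponential `:e^{⟨x, ξ⟩}: = exp(⟨x, ξ⟩ - ⟨ξ, ξ⟩/2)`, `ξ ∈ E_c`, where the
pairings are extended complex bilinearly. -/
def wickExp (ξ : Complexification E) (x : DualSpace E) : ℂ :=
  Complex.exp (((x ξ.re : ℝ) : ℂ) + Complex.I * ((x ξ.im : ℝ) : ℂ) -
    (((S.inner0 ξ.re ξ.re - S.inner0 ξ.im ξ.im : ℝ) : ℂ) +
      2 * Complex.I * ((S.inner0 ξ.re ξ.im : ℝ) : ℂ)) / 2)

/-- The dual norm squared `|ξ|_{-p}²` on `E_c`. -/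
def normNegSqC (p : ℕ) (ξ : Complexification E) : ℝ :=
  S.normNeg p ξ.re ^ 2 + S.normNeg p ξ.im ^ 2

/-! ### Wick monomials are square integrable -/

theorem measurable_eval (ξ : E) : Measurable (fun x : DualSpace E => x ξ) :=
  Measurable.of_comap_le (le_iSup
    (fun ξ : E => MeasurableSpace.comap (fun x : DualSpace E => x ξ) inferInstance) ξ)

variable (μ : Measure (DualSpace E))

theorem inner0_self_nonneg (ξ : E) : 0 ≤ S.inner0 ξ ξ := real_inner_self_nonneg

theorem map_eval [hμ : S.IsStandardGaussian μ] (ξ : E) :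
    μ.map (fun x : DualSpace E => x ξ) = gaussianReal 0 (S.inner0 ξ ξ).toNNReal := by
  have hm := measurable_eval ξ
  have := hμ.prob
  have : IsProbabilityMeasure (μ.map (fun x : DualSpace E => x ξ)) :=
    Measure.isProbabilityMeasure_map hm.aemeasurable
  refine Measure.ext_of_charFun ?_
  ext t
  rw [charFun_apply_real, charFun_gaussianReal,
    integral_map hm.aemeasurable (by fun_prop)]
  have h := hμ.charFun (t • ξ)
  have h1 : ∀ x : DualSpace E, x (t • ξ) = t * x ξ := fun x =>
    (map_smul (show E →L[ℝ] ℝ from x) t ξ)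
  have h2 : S.inner0 (t • ξ) (t • ξ) = t ^ 2 * S.inner0 ξ ξ := by
    simp only [inner0, map_smul, inner_smul_left, inner_smul_right, RCLike.conj_to_real]
    ring
  simp only [h1, h2] at h
  push_cast at h
  rw [h, Real.coe_toNNReal _ (S.inner0_self_nonneg ξ)]
  congr 1
  push_cast
  ring

theorem memLp_eval [S.IsStandardGaussian μ] (ξ : E) (p : ℝ≥0) :
    MemLp (fun x : DualSpace E => x ξ) p μ := by
  have h := memLp_id_gaussianReal (μ := 0) (v := (S.inner0 ξ ξ).toNNReal) p
  rw [← S.map_eval μ ξ] at h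
  exact (memLp_map_measure_iff (by fun_prop) (measurable_eval ξ).aemeasurable).1 h

theorem memLp_wick [hμ : S.IsStandardGaussian μ] (n : ℕ) (ξ : Fin n → E) (p : ℝ≥0) :
    MemLp (S.wick n ξ) p μ := by
  have := hμ.prob
  induction n using Nat.strong_induction_on generalizing p with
  | _ n ih =>
    match n, ξ, ih with
    | 0, ξ, _ => exact memLp_const (1 : ℝ)
    | 1, ξ, _ => exact S.memLp_eval μ (ξ 0) p
    | n + 2, ξ, ih =>
      have h1 := ih (n + 1) (by omega) (fun k => ξ k.succ) (2 * p)
      have h2 := S.memLp_eval μ (ξ 0) (2 * p)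
      have : ENNReal.HolderTriple ((2 * p : ℝ≥0) : ℝ≥0∞) ((2 * p : ℝ≥0) : ℝ≥0∞) (p : ℝ≥0∞) := by
        constructor
        rw [ENNReal.coe_mul, ENNReal.mul_inv (by simp) (by simp), ← add_mul, ENNReal.coe_ofNat,
          ENNReal.inv_two_add_inv_two, one_mul]
      have h3 := MemLp.mul (r := (p : ℝ≥0∞)) h1 h2
      have h4 : MemLp (fun x => ∑ j : Fin (n + 1), S.inner0 (ξ 0) (ξ j.succ) *
          S.wick n (fun k => ξ (j.succAbove k).succ) x) p μ :=
        memLp_finsetSum _ fun j _ => (ih n (by omega) _ p).const_mul _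
      exact h3.sub h4

/-! ### Chaos decomposition and the spaces of test and generalized functions -/

/-- The kernel `f_n` in the Wiener–Itô decomposition `φ = ∑ ⟨:·^{⊗n}:, f_n⟩` of `φ ∈ (L²)`, as the
`n`-linear form `(ξ₁, …, ξₙ) ↦ ⟨f_n, ξ₁ ⊗ ⋯ ⊗ ξₙ⟩ = (1/n!) ∫ φ(x) :⟨x, ξ₁⟩⋯⟨x, ξₙ⟩: dμ(x)`
on `E`. -/
def kernel (φ : Lp ℂ 2 μ) (n : ℕ) (ξ : Fin n → E) : ℂ :=
  ((n.factorial : ℝ) : ℂ)⁻¹ * ∫ x, φ x * ((S.wick n ξ x : ℝ) : ℂ) ∂μ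

/-- `‖φ‖²_{p,α} = ∑ n! α(n) |f_n|_p²`, possibly infinite. The norm `|f_n|_p` of `E_{p,c}^{⊗n}` is
the Hilbert–Schmidt norm of the `n`-linear form `f_n` with respect to the dual norm `|·|_{-p}`. -/
def normSq (α : ℕ → ℝ) (p : ℕ) (φ : Lp ℂ 2 μ) : ℝ≥0∞ :=
  ∑' n : ℕ, ENNReal.ofReal (n.factorial * α n) * hsFormSq (S.innerNeg p) (S.kernel μ φ n)

theorem integrable_mul_wick [S.IsStandardGaussian μ] (φ : Lp ℂ 2 μ) (n : ℕ) (ξ : Fin n → E) :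
    Integrable (fun x => φ x * ((S.wick n ξ x : ℝ) : ℂ)) μ := by
  have h : MemLp (fun x => ((S.wick n ξ x : ℝ) : ℂ)) 2 μ :=
    (S.memLp_wick μ n ξ 2).ofReal (K := ℂ)
  exact (Lp.memLp φ).integrable_mul h

theorem kernel_add [S.IsStandardGaussian μ] (φ ψ : Lp ℂ 2 μ) (n : ℕ) (ξ : Fin n → E) :
    S.kernel μ (φ + ψ) n ξ = S.kernel μ φ n ξ + S.kernel μ ψ n ξ := by
  simp only [kernel]
  rw [← mul_add, ← integral_add (S.integrable_mul_wick μ φ n ξ) (S.integrable_mul_wick μ ψ n ξ)]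
  congr 1
  refine integral_congr_ae ?_
  filter_upwards [Lp.coeFn_add φ ψ] with x hx
  rw [hx, Pi.add_apply, add_mul]

theorem kernel_smul (c : ℂ) (φ : Lp ℂ 2 μ) (n : ℕ) (ξ : Fin n → E) :
    S.kernel μ (c • φ) n ξ = c * S.kernel μ φ n ξ := by
  simp only [kernel]
  rw [mul_left_comm, ← integral_const_mul (μ := μ) c]
  congr 1
  refine integral_congr_ae ?_
  filter_upwards [Lp.coeFn_smul c φ] with x hx
  rw [hx, Pi.smul_apply, smul_eq_mul, mul_assoc]

theorem normSq_add_le [S.IsStandardGaussian μ] (α : ℕ → ℝ) (p : ℕ) (φ ψ : Lp ℂ 2 μ) :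
    S.normSq μ α p (φ + ψ) ≤ 2 * S.normSq μ α p φ + 2 * S.normSq μ α p ψ := by
  simp only [normSq]
  rw [← ENNReal.tsum_mul_left, ← ENNReal.tsum_mul_left, ← ENNReal.tsum_add]
  refine ENNReal.tsum_le_tsum fun n => ?_
  have h : S.kernel μ (φ + ψ) n = fun ξ => S.kernel μ φ n ξ + S.kernel μ ψ n ξ :=
    funext fun ξ => S.kernel_add μ φ ψ n ξ
  rw [h]
  refine (mul_le_mul_right (hsFormSq_add_le _ _ _) _).trans (le_of_eq ?_)
  ring

theorem normSq_smul_le (α : ℕ → ℝ) (p : ℕ) (c : ℂ) (φ : Lp ℂ 2 μ) :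
    S.normSq μ α p (c • φ) ≤ ‖c‖ₑ ^ 2 * S.normSq μ α p φ := by
  simp only [normSq]
  rw [← ENNReal.tsum_mul_left]
  refine ENNReal.tsum_le_tsum fun n => ?_
  have h : S.kernel μ (c • φ) n = fun ξ => c * S.kernel μ φ n ξ :=
    funext fun ξ => S.kernel_smul μ c φ n ξ
  rw [h]
  refine (mul_le_mul_right (hsFormSq_smul_le _ _ _) _).trans (le_of_eq ?_)
  ring

/-- The space `[E_p]_α = {φ ∈ (L²) ; ‖φ‖_{p,α} < ∞}`. -/
def chaosSpace [S.IsStandardGaussian μ] (α : ℕ → ℝ) (p : ℕ) : Submodule ℂ (Lp ℂ 2 μ) where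
  carrier := {φ | S.normSq μ α p φ < ∞}
  add_mem' {φ ψ} hφ hψ := lt_of_le_of_lt (S.normSq_add_le μ α p φ ψ)
    (ENNReal.add_lt_top.2
      ⟨ENNReal.mul_lt_top (by simp) hφ, ENNReal.mul_lt_top (by simp) hψ⟩)
  zero_mem' := by
    have h := S.normSq_smul_le μ α p 0 0
    simp only [smul_zero, enorm_zero, ne_eq, OfNat.ofNat_ne_zero, not_false_eq_true, zero_pow,
      zero_mul] at h
    exact lt_of_le_of_lt h (by simp)
  smul_mem' c φ hφ := lt_of_le_of_lt (S.normSq_smul_le μ α p c φ)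
    (ENNReal.mul_lt_top (by simp) hφ)

/-- The space `[E]_α` of test functions, the intersection of all `[E_p]_α`. -/
def testSpace [S.IsStandardGaussian μ] (α : ℕ → ℝ) : Submodule ℂ (Lp ℂ 2 μ) :=
  ⨅ p : ℕ, S.chaosSpace μ α p

/-- The space `[E]_α^*` of generalized functions: the linear functionals on `[E]_α` that are
continuous for the projective limit topology, that is, bounded with respect to one of the
increasing norms `‖·‖_{p,α}`. -/
def GeneralizedFunction [S.IsStandardGaussian μ] (α : ℕ → ℝ) : Type _ :=
  {Φ : S.testSpace μ α →ₗ[ℂ] ℂ // ∃ (p : ℕ) (C : ℝ≥0), ∀ ψ : S.testSpace μ α,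
    ‖Φ ψ‖ₑ ^ 2 ≤ C * S.normSq μ α p (ψ : Lp ℂ 2 μ)}

/-- `F` is the `S`-transform of `Φ ∈ [E]_α^*`: for every `ξ ∈ E_c` the renormalized exponential
`:e^{⟨·, ξ⟩}:` is a test function and `F(ξ) = ⟪Φ, :e^{⟨·, ξ⟩}:⟫`. -/
def IsSTransform [S.IsStandardGaussian μ] {α : ℕ → ℝ} (F : Complexification E → ℂ)
    (Φ : S.GeneralizedFunction μ α) : Prop :=
  ∀ ξ : Complexification E, ∃ ψ : S.testSpace μ α,
    ((ψ : Lp ℂ 2 μ) : DualSpace E → ℂ) =ᵐ[μ] S.wickExp ξ ∧ F ξ = Φ.1 ψ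

/-- `Φ ∈ [E]_α^*` is given by the function `φ ∈ (L²)`: `⟪Φ, ψ⟫ = ∫ φ ψ dμ` (the complex bilinear
pairing) for every test function `ψ`. -/
def IsRepresentedBy [S.IsStandardGaussian μ] {α : ℕ → ℝ} (Φ : S.GeneralizedFunction μ α)
    (φ : Lp ℂ 2 μ) : Prop :=
  ∀ ψ : S.testSpace μ α, Φ.1 ψ = ∫ x, φ x * (ψ : Lp ℂ 2 μ) x ∂μ

end HilbertNorms

end Gaussian

/-! ### The weight sequence -/

/-- The exponential generating function `G_{1/α}(r) = ∑ rⁿ / (n! α(n))`. -/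
def genInv (α : ℕ → ℝ) (r : ℝ) : ℝ := ∑' n : ℕ, r ^ n / (n.factorial * α n)

/-- `n! α(n) inf_{r > 0} G_{1/α}(r) / rⁿ`. -/
def growthCoeff (α : ℕ → ℝ) (n : ℕ) : ℝ :=
  n.factorial * α n * ⨅ r : Set.Ioi (0 : ℝ), genInv α r / (r : ℝ) ^ n

/-- `limsup (n! α(n) inf_{r > 0} G_{1/α}(r) / rⁿ)^{1/n}`. -/
def growthRate (α : ℕ → ℝ) : ℝ≥0∞ :=
  limsup (fun n : ℕ => ENNReal.ofReal (growthCoeff α n ^ (1 / (n : ℝ)))) atTop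

/-- Conditions (A1), `α(0) = 1` and `inf α(n) > 0`, and (A2), `(α(n)/n!)^{1/n} → 0`. -/
structure IsWeight (α : ℕ → ℝ) : Prop where
  zero : α 0 = 1
  lower : ∃ c : ℝ, 0 < c ∧ ∀ n, c ≤ α n
  growth : Tendsto (fun n : ℕ => (α n / n.factorial) ^ (1 / (n : ℝ))) atTop (𝓝 0)

end WhiteNoise

end

open WhiteNoise

/-!
# The characterization theorem for generalized white noise functions

Write `⟪·, ·⟫` for the bilinear pairing. If `φ` has the kernels `f_n`, its `S`-transform is
`Sφ(ξ) = ∑ ⟨f_n, ξ^{⊗n}⟩`, so the kernels have to be the Taylor coefficients of `F` at `0`, and the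
question is how large these are. An entire function `F` with the given growth has an `n`-th
derivative at `0` that is a symmetric `n`-linear form (`GateauxEntire.derivForm`). Cauchy's
estimate on polydiscs, with the radius optimized, produces the numbers `c_n`, and Stirling's
formula produces `e²` and `2π` (`IsWeight.norm_taylorForm_sq_le`). A form that is bounded in
`|·|_{-p}` is Hilbert–Schmidt in `|·|_{-q}` when `i_{p,q}` is, at the cost of a factor
`‖i_{p,q}‖_HS` for each argument (`IsNuclear.hsFormSq_le_of_bound`). Summing over `n` gives the
bound of the theorem for the Taylor coefficients (`IsNuclear.tsum_hsFormSq_taylorForm_le`).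

It remains to produce a functional with these kernels. The Wiener–Itô theorem is used only for
finite linear combinations `h = ∑ c(ξ) :e^{⟨·, ξ⟩}:`. Differentiating `S`-transforms under the
integral sign shows that the kernels of a square integrable function are the Taylor coefficients
of its `S`-transform (`kernel_eq_taylorForm`). Hence the pairing that `h` should have with the
functional, `∑ c(ξ) F(ξ)`, is a series in the Taylor coefficients of `F` and the kernels of `h`,
all evaluated on a finite basis that spans the parameters `ξ` (`hasSum_taylorForm_mul_kernel`). By
Cauchy–Schwarz, `∑ c(ξ) F(ξ)` is bounded by the norm of `h` in `L²` if the Taylor coefficients are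
small enough (`IsNuclear.enorm_linearCombination_sq_le_norm`), and by the norm of `h` in `[E_s]_α`
for some large `s` in any case (`IsNuclear.enorm_linearCombination_sq_le_normSq`). For the latter
the basis is chosen orthogonal for two norms at once.

So `∑ c(ξ) :e^{⟨·, ξ⟩}: ↦ ∑ c(ξ) F(ξ)` is well defined and bounded, and extends by density. In
`L²` the exponentials are total because finite measures on `E'` are determined by their
characteristic functionals (`ae_eq_zero_of_sTransform`), and the Riesz theorem gives `φ`. In the
test functions they are total because nuclearity approximates every kernel by kernels of Wick
monomials, and these are limits of difference quotients of exponentials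
(`IsNuclear.exists_normSq_sub_wickComb_le`). This gives the generalized function as well as its
uniqueness, and uniqueness identifies it with `φ` when `φ` exists.
-/

noncomputable section

/-! ### Entire functions on complex vector spaces -/

namespace WhiteNoise

section GateauxEntire

variable {X : Type*} [AddCommGroup X] [Module ℂ X]

/-- The derivative of `F` at `ξ` in the direction `η`. -/
def dirDeriv (η : X) (F : X → ℂ) (ξ : X) : ℂ := deriv (fun z : ℂ => F (ξ + z • η)) 0

/-- Gateaux-entire functions on a complex vector space without topology: the restriction to every
complex line is entire, and the function is bounded on finite-dimensional polydiscs. By Hartogs'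
theorem the bound is automatic; it is a field because the growth condition on `F` supplies it, and
it makes the derivatives additive in the direction by elementary means. -/
structure GateauxEntire (F : X → ℂ) : Prop where
  differentiable : ∀ ξ η : X, Differentiable ℂ (fun z : ℂ => F (ξ + z • η))
  bounded : ∀ (n : ℕ) (v : Fin n → X) (ξ : X) (R : ℝ), ∃ M : ℝ, ∀ z : Fin n → ℂ,
    (∀ i, ‖z i‖ ≤ R) → ‖F (ξ + ∑ i, z i • v i)‖ ≤ M

/-- The Schwarz lemma to second order: a difference quotient is within `O(‖w‖)` of the derivative,
with a constant that depends only on a bound on the unit disc. -/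
theorem norm_slope_sub_deriv_le {f : ℂ → ℂ} (hf : Differentiable ℂ f) {M : ℝ}
    (hM : ∀ w : ℂ, ‖w‖ ≤ 1 → ‖f w‖ ≤ M) {w : ℂ} (hw : ‖w‖ < 1) (hw0 : w ≠ 0) :
    ‖w⁻¹ * (f w - f 0) - deriv f 0‖ ≤ (3 * M + 1) * ‖w‖ := by
  have hd : ‖deriv f 0‖ ≤ M := by
    have := Complex.norm_deriv_le_of_forall_mem_sphere_norm_le (c := 0) (R := 1) (C := M)
      one_pos hf.diffContOnCl (fun z hz => hM z (by simpa using hz.le))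
    simpa using this
  have h0 : ‖f 0‖ ≤ M := hM 0 (by simp)
  have hg : Differentiable ℂ (fun z => f z - z * deriv f 0) := by fun_prop
  have key := Complex.dist_le_mul_div_pow_of_mapsTo_ball_of_isLittleO (n := 1) (R₁ := 1)
    (R₂ := 3 * M + 1) (c := 0) (z := w) (f := fun z => f z - z * deriv f 0)
    hg.differentiableOn ?_ ?_ (by simpa using hw)
  · have e : w⁻¹ * (f w - f 0) - deriv f 0 = w⁻¹ * ((f w - w * deriv f 0) - f 0) := by
      field_simp
      ring
    rw [e, norm_mul, norm_inv, inv_mul_le_iff₀ (norm_pos_iff.2 hw0)]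
    simp only [dist_eq_norm, zero_mul, sub_zero, div_one] at key
    calc _ ≤ _ := key
      _ = _ := by ring
  · intro z hz
    simp only [Metric.mem_ball, dist_zero_right] at hz
    simp only [Metric.mem_closedBall, dist_eq_norm, zero_mul, sub_zero]
    calc ‖f z - z * deriv f 0 - f 0‖ ≤ ‖f z‖ + ‖z‖ * ‖deriv f 0‖ + ‖f 0‖ := by
          refine (norm_sub_le _ _).trans (add_le_add_left ((norm_sub_le _ _).trans ?_) _)
          rw [norm_mul]
      _ ≤ M + 1 * M + M := by
          gcongr
          exact hM z hz.le
      _ ≤ 3 * M + 1 := by linarith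
  · have := (hf 0).hasDerivAt.isLittleO
    have h2 := this.norm_right
    simp only [sub_zero, smul_eq_mul] at h2
    simpa [sub_right_comm] using h2

namespace GateauxEntire

variable {F G : X → ℂ}

theorem differentiable_translate (hF : GateauxEntire F) (ξ η ζ : X) :
    Differentiable ℂ (fun z : ℂ => F (ξ + z • η + ζ)) := by
  simpa only [add_right_comm] using hF.differentiable (ξ + ζ) η

theorem hasDerivAt (hF : GateauxEntire F) (ξ η : X) (z : ℂ) :
    HasDerivAt (fun z : ℂ => F (ξ + z • η)) (dirDeriv η F (ξ + z • η)) z := by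
  have h := (hF.differentiable ξ η z).hasDerivAt
  have h2 := deriv_comp_const_add (fun z : ℂ => F (ξ + z • η)) z 0
  rw [add_zero] at h2
  rw [← h2] at h
  simpa only [dirDeriv, add_smul, add_assoc] using h

theorem deriv_eq (hF : GateauxEntire F) (ξ η : X) :
    deriv (fun z : ℂ => F (ξ + z • η)) = fun z => dirDeriv η F (ξ + z • η) :=
  funext fun z => (hF.hasDerivAt ξ η z).deriv

theorem exists_bound_two (hF : GateauxEntire F) (ξ η ζ : X) (R : ℝ) :
    ∃ M : ℝ, 0 ≤ M ∧ ∀ z w : ℂ, ‖z‖ ≤ R → ‖w‖ ≤ R → ‖F (ξ + z • η + w • ζ)‖ ≤ M := by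
  obtain ⟨M, hM⟩ := hF.bounded 2 ![η, ζ] ξ R
  refine ⟨max M 0, le_max_right _ _, fun z w hz hw => le_max_of_le_left ?_⟩
  have := hM ![z, w] (by intro i; fin_cases i <;> simpa)
  simpa [Fin.sum_univ_two, add_assoc] using this

/-- Difference quotients in the direction `ζ` converge to the derivative, locally uniformly on
complex lines. -/
theorem tendstoLocallyUniformlyOn_slope (hF : GateauxEntire F) (ξ η ζ : X) :
    TendstoLocallyUniformlyOn
      (fun (w : ℂ) (z : ℂ) => w⁻¹ * (F (ξ + z • η + w • ζ) - F (ξ + z • η)))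
      (fun z => dirDeriv ζ F (ξ + z • η)) (𝓝[≠] 0) Set.univ := by
  rw [tendstoLocallyUniformlyOn_iff_forall_isCompact isOpen_univ]
  intro C _ hC
  obtain ⟨R, hR⟩ := hC.isBounded.exists_norm_le
  obtain ⟨M, hM0, hM⟩ := hF.exists_bound_two ξ η ζ (max R 1)
  rw [Metric.tendstoUniformlyOn_iff]
  intro ε hε
  have h1 : ∀ᶠ w : ℂ in 𝓝[≠] 0, ‖w‖ < 1 ∧ (3 * M + 1) * ‖w‖ < ε := by
    refine nhdsWithin_le_nhds ?_
    have c1 : Tendsto (fun w : ℂ => ‖w‖) (𝓝 0) (𝓝 0) := tendsto_norm_zero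
    have c2 : Tendsto (fun w : ℂ => (3 * M + 1) * ‖w‖) (𝓝 0) (𝓝 0) := by
      simpa using c1.const_mul (3 * M + 1)
    exact (c1.eventually_lt_const one_pos).and (c2.eventually_lt_const hε)
  filter_upwards [h1, self_mem_nhdsWithin] with w hw hw0 z hz
  rw [dist_comm, dist_eq_norm]
  refine lt_of_le_of_lt ?_ hw.2
  have := norm_slope_sub_deriv_le (hF.differentiable (ξ + z • η) ζ) (M := M)
    (fun u hu => hM z u ((hR z hz).trans (le_max_left _ _)) (hu.trans (le_max_right _ _)))
    hw.1 hw0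
  simpa [dirDeriv] using this

theorem tendsto_slope (hF : GateauxEntire F) (ξ ζ : X) :
    Tendsto (fun w : ℂ => w⁻¹ * (F (ξ + w • ζ) - F ξ)) (𝓝[≠] 0) (𝓝 (dirDeriv ζ F ξ)) := by
  have := (hF.tendstoLocallyUniformlyOn_slope ξ 0 ζ).tendsto_at (Set.mem_univ 0)
  simpa using this

/-- A directional derivative is a locally uniform limit of difference quotients on complex lines,
hence again Gateaux-entire; Cauchy's estimate bounds it. -/
theorem dirDeriv_mem (hF : GateauxEntire F) (η : X) : GateauxEntire (dirDeriv η F) where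
  differentiable ξ ζ := by
    rw [← differentiableOn_univ]
    refine (hF.tendstoLocallyUniformlyOn_slope ξ ζ η).differentiableOn
      (Eventually.of_forall fun w => ?_) isOpen_univ
    exact (((hF.differentiable_translate ξ ζ (w • η)).sub (hF.differentiable ξ ζ)).const_mul
      _).differentiableOn
  bounded n v ξ R := by
    obtain ⟨M, hM⟩ := hF.bounded (n + 1) (Fin.cons η v) ξ (max R 1)
    refine ⟨M, fun z hz => ?_⟩
    have := Complex.norm_deriv_le_of_forall_mem_sphere_norm_le (c := 0) (R := 1) (C := M)
      one_pos (hF.differentiable (ξ + ∑ i, z i • v i) η).diffContOnCl (fun u hu => ?_)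
    · simpa [dirDeriv] using this
    · have hu' : ‖u‖ = 1 := by simpa using hu
      have := hM (Fin.cons u z) (fun i => ?_)
      · rw [Fin.sum_univ_succ] at this
        simp only [Fin.cons_zero, Fin.cons_succ] at this
        rwa [add_assoc, add_comm (∑ i, z i • v i)]
      · refine Fin.cases ?_ (fun j => ?_) i
        · simp [hu']
        · simpa using Or.inl (hz j)

/-- Directional derivatives commute, because a locally uniform limit of holomorphic functions may be
differentiated term by term. -/
theorem dirDeriv_comm (hF : GateauxEntire F) (η ζ : X) :
    dirDeriv η (dirDeriv ζ F) = dirDeriv ζ (dirDeriv η F) := by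
  funext ξ
  have h := (hF.tendstoLocallyUniformlyOn_slope ξ η ζ).deriv
    (Eventually.of_forall fun w => (((hF.differentiable_translate ξ η (w • ζ)).sub
      (hF.differentiable ξ η)).const_mul _).differentiableOn) isOpen_univ
  have h0 := h.tendsto_at (Set.mem_univ 0)
  refine tendsto_nhds_unique h0 ?_
  refine ((hF.dirDeriv_mem η).tendsto_slope ξ ζ).congr fun w => ?_
  simp only [Function.comp]
  rw [deriv_const_mul_field, deriv_fun_sub ((hF.differentiable_translate ξ η (w • ζ)) 0)
    (hF.differentiable ξ η 0)]
  congr 2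
  rw [dirDeriv]
  congr 1
  ext z
  congr 1
  abel

theorem dirDeriv_add_left (hF : GateauxEntire F) (η ζ : X) :
    dirDeriv (η + ζ) F = fun ξ => dirDeriv η F ξ + dirDeriv ζ F ξ := by
  funext ξ
  refine tendsto_nhds_unique (hF.tendsto_slope ξ (η + ζ)) ?_
  obtain ⟨M, hM0, hM⟩ := hF.exists_bound_two ξ η ζ 1
  -- the quotient splits at the intermediate point `ξ + w • η`, where the derivative is continuous
  have h1 := hF.tendsto_slope ξ η
  have h2 : Tendsto (fun w : ℂ => dirDeriv ζ F (ξ + w • η)) (𝓝[≠] 0) (𝓝 (dirDeriv ζ F ξ)) := by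
    have := ((hF.dirDeriv_mem ζ).differentiable ξ η).continuous.tendsto 0
    simp only [zero_smul, add_zero] at this
    exact this.mono_left nhdsWithin_le_nhds
  have h3 : Tendsto (fun w : ℂ => w⁻¹ * (F (ξ + w • η + w • ζ) - F (ξ + w • η)) -
      dirDeriv ζ F (ξ + w • η)) (𝓝[≠] 0) (𝓝 0) := by
    refine squeeze_zero_norm' (a := fun w : ℂ => (3 * M + 1) * ‖w‖) ?_ ?_
    · have : ∀ᶠ w : ℂ in 𝓝[≠] 0, ‖w‖ < 1 :=
        nhdsWithin_le_nhds (tendsto_norm_zero.eventually_lt_const one_pos)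
      filter_upwards [this, self_mem_nhdsWithin] with w hw hw0
      have := norm_slope_sub_deriv_le (hF.differentiable (ξ + w • η) ζ) (M := M)
        (fun u hu => hM w u hw.le hu) hw hw0
      simpa [dirDeriv] using this
    · have : Tendsto (fun w : ℂ => (3 * M + 1) * ‖w‖) (𝓝 0) (𝓝 ((3 * M + 1) * 0)) :=
        tendsto_norm_zero.const_mul _
      rw [mul_zero] at this
      exact this.mono_left nhdsWithin_le_nhds
  have := h1.add (h3.add h2)
  rw [zero_add] at this
  refine this.congr fun w => ?_
  rw [smul_add, ← add_assoc ξ]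
  ring

theorem dirDeriv_smul_left (hF : GateauxEntire F) (c : ℂ) (η : X) :
    dirDeriv (c • η) F = fun ξ => c * dirDeriv η F ξ := by
  funext ξ
  have h := hF.hasDerivAt ξ η (0 * c)
  have h2 : HasDerivAt (fun z : ℂ => z * c) c 0 := by
    simpa using (hasDerivAt_id (0 : ℂ)).mul_const c
  have h3 := (h.comp (0 : ℂ) h2).deriv
  simp only [zero_mul, zero_smul, add_zero] at h3
  rw [dirDeriv, mul_comm, ← h3]
  congr 1
  ext z
  simp [mul_smul]

theorem dirDeriv_add (hF : GateauxEntire F) (hG : GateauxEntire G) (η : X) :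
    dirDeriv η (fun ξ => F ξ + G ξ) = fun ξ => dirDeriv η F ξ + dirDeriv η G ξ := by
  funext ξ
  exact deriv_fun_add (hF.differentiable ξ η 0) (hG.differentiable ξ η 0)

theorem dirDeriv_const_mul (c : ℂ) (F : X → ℂ) (η : X) :
    dirDeriv η (fun ξ => c * F ξ) = fun ξ => c * dirDeriv η F ξ := by
  funext ξ
  exact deriv_const_mul_field c

end GateauxEntire

/-- The iterated derivative of `F` in the directions of a list. -/
def iterDir (F : X → ℂ) : List X → X → ℂ
  | [] => F
  | η :: l => dirDeriv η (iterDir F l)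

namespace GateauxEntire

variable {F : X → ℂ}

theorem iterDir_mem (hF : GateauxEntire F) : ∀ l : List X, GateauxEntire (iterDir F l)
  | [] => hF
  | η :: l => (iterDir_mem hF l).dirDeriv_mem η

theorem iterDir_perm (hF : GateauxEntire F) {l l' : List X} (h : l.Perm l') :
    iterDir F l = iterDir F l' := by
  induction h with
  | nil => rfl
  | cons x _ ih => simp only [iterDir, ih]
  | swap x y l => exact (hF.iterDir_mem l).dirDeriv_comm y x
  | trans _ _ ih1 ih2 => exact ih1.trans ih2

theorem iterDir_update_add (hF : GateauxEntire F) {n : ℕ} [inst : DecidableEq (Fin n)]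
    (m : Fin n → X) (i : Fin n) (x y : X) :
    iterDir F (List.ofFn (Function.update m i (x + y))) = fun ξ =>
      iterDir F (List.ofFn (Function.update m i x)) ξ +
        iterDir F (List.ofFn (Function.update m i y)) ξ := by
  obtain rfl : inst = instDecidableEqFin n := Subsingleton.elim _ _
  induction n with
  | zero => exact i.elim0
  | succ n ih =>
    simp only [List.ofFn_succ, iterDir]
    refine Fin.cases ?_ (fun j => ?_) i
    · simp only [Function.update_self]
      simp only [ne_eq, Fin.succ_ne_zero, not_false_eq_true, Function.update_of_ne]
      exact (hF.iterDir_mem _).dirDeriv_add_left x y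
    · have h : ∀ v : X, (fun k : Fin n => Function.update m j.succ v k.succ) =
          Function.update (fun k => m k.succ) j v := fun v => Fin.tail_update_succ m j v
      simp only [h, ne_eq, (Fin.succ_ne_zero j).symm, not_false_eq_true, Function.update_of_ne]
      rw [ih]
      exact (hF.iterDir_mem _).dirDeriv_add (hF.iterDir_mem _) _

theorem iterDir_update_smul (hF : GateauxEntire F) {n : ℕ} [inst : DecidableEq (Fin n)]
    (m : Fin n → X) (i : Fin n) (c : ℂ) (x : X) :
    iterDir F (List.ofFn (Function.update m i (c • x))) = fun ξ =>
      c * iterDir F (List.ofFn (Function.update m i x)) ξ := by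
  obtain rfl : inst = instDecidableEqFin n := Subsingleton.elim _ _
  induction n with
  | zero => exact i.elim0
  | succ n ih =>
    simp only [List.ofFn_succ, iterDir]
    refine Fin.cases ?_ (fun j => ?_) i
    · simp only [Function.update_self]
      simp only [ne_eq, Fin.succ_ne_zero, not_false_eq_true, Function.update_of_ne]
      exact (hF.iterDir_mem _).dirDeriv_smul_left c x
    · have h : ∀ v : X, (fun k : Fin n => Function.update m j.succ v k.succ) =
          Function.update (fun k => m k.succ) j v := fun v => Fin.tail_update_succ m j v
      simp only [h, ne_eq, (Fin.succ_ne_zero j).symm, not_false_eq_true, Function.update_of_ne]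
      rw [ih]
      exact dirDeriv_const_mul _ _ _

/-- The `n`-th derivative of a Gateaux-entire function at `0`, as an `n`-linear form. -/
def derivForm (hF : GateauxEntire F) (n : ℕ) : MultilinearMap ℂ (fun _ : Fin n => X) ℂ where
  toFun η := iterDir F (List.ofFn η) 0
  map_update_add' m i x y := congrFun (hF.iterDir_update_add m i x y) 0
  map_update_smul' m i c x := congrFun (hF.iterDir_update_smul m i c x) 0

theorem derivForm_apply (hF : GateauxEntire F) (n : ℕ) (η : Fin n → X) :
    hF.derivForm n η = iterDir F (List.ofFn η) 0 := rfl

theorem derivForm_comp_perm (hF : GateauxEntire F) (n : ℕ) (η : Fin n → X)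
    (σ : Equiv.Perm (Fin n)) : hF.derivForm n (η ∘ σ) = hF.derivForm n η := by
  rw [derivForm_apply, derivForm_apply, hF.iterDir_perm (σ.ofFn_comp_perm η)]

/-- Derivatives along a line through `0` are diagonal values of the iterated derivatives. -/
theorem iteratedDeriv_line (hF : GateauxEntire F) (ξ : X) (n : ℕ) :
    iteratedDeriv n (fun z : ℂ => F (z • ξ)) =
      fun z => iterDir F (List.ofFn fun _ : Fin n => ξ) (z • ξ) := by
  induction n with
  | zero => simp [iterDir]
  | succ n ih =>
    rw [iteratedDeriv_succ, ih, List.ofFn_succ]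
    have := (hF.iterDir_mem (List.ofFn fun _ : Fin n => ξ)).deriv_eq 0 ξ
    simpa [iterDir] using this

/-- The Taylor expansion at `0`. -/
theorem hasSum_derivForm (hF : GateauxEntire F) (ξ : X) :
    HasSum (fun n : ℕ => ((n.factorial : ℂ))⁻¹ * hF.derivForm n (fun _ => ξ)) (F ξ) := by
  have hd : Differentiable ℂ (fun z : ℂ => F (z • ξ)) := by
    simpa using hF.differentiable 0 ξ
  have := Complex.hasSum_taylorSeries_of_entire hd 0 1
  simpa [hF.iteratedDeriv_line, derivForm_apply] using this

/-- The Cauchy estimate on a polydisc. -/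
theorem norm_iterDir_le (hF : GateauxEntire F) {n : ℕ} (η : Fin n → X) (R : Fin n → ℝ)
    (hR : ∀ i, 0 < R i) (M : ℝ) (ξ : X)
    (hM : ∀ z : Fin n → ℂ, (∀ i, ‖z i‖ ≤ R i) → ‖F (ξ + ∑ i, z i • η i)‖ ≤ M) :
    ‖iterDir F (List.ofFn η) ξ‖ ≤ M / ∏ i, R i := by
  induction n generalizing ξ with
  | zero => simpa [iterDir] using hM 0 (by simp)
  | succ n ih =>
    rw [List.ofFn_succ, iterDir, Fin.prod_univ_succ, mul_comm, ← div_div]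
    have := Complex.norm_deriv_le_of_forall_mem_sphere_norm_le (c := 0) (R := R 0)
      (C := M / ∏ i : Fin n, R i.succ) (hR 0)
      ((hF.iterDir_mem (List.ofFn fun i : Fin n => η i.succ)).differentiable ξ
        (η 0)).diffContOnCl (fun u hu => ?_)
    · exact this
    · have hu' : ‖u‖ = R 0 := by simpa using hu
      refine ih _ _ (fun i => hR i.succ) _ fun z hz => ?_
      have := hM (Fin.cons u z) (fun i => ?_)
      · rw [Fin.sum_univ_succ] at this
        simp only [Fin.cons_zero, Fin.cons_succ] at this
        rwa [add_assoc]
      · refine Fin.cases ?_ (fun j => ?_) i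
        · simp [hu']
        · simpa using hz j

end GateauxEntire

end GateauxEntire

end WhiteNoise

/-! ### Hilbert–Schmidt operators -/

namespace WhiteNoise

section HilbertSchmidt

variable {H K : Type*} [NormedAddCommGroup H] [InnerProductSpace ℝ H]
    [NormedAddCommGroup K] [InnerProductSpace ℝ K]

theorem enorm_sq_eq_ofReal {V : Type*} [SeminormedAddCommGroup V] (v : V) :
    ‖v‖ₑ ^ 2 = ENNReal.ofReal (‖v‖ ^ 2) := by
  rw [ENNReal.ofReal_pow (norm_nonneg _), ofReal_norm]

theorem sum_enorm_sq_le_hilbertSchmidtSq (T : H →L[ℝ] K) {ι : Type*} [Fintype ι] {u : ι → H}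
    (hu : Orthonormal ℝ u) : ∑ i, ‖T (u i)‖ₑ ^ 2 ≤ hilbertSchmidtSq T := by
  classical
  have h1 : ∑ i, ‖T (u i)‖ₑ ^ 2 =
      ∑ v ∈ Finset.univ.map ⟨u, hu.linearIndependent.injective⟩, ‖T v‖ₑ ^ 2 := by
    simp
  rw [h1]
  refine le_iSup₂_of_le (f := fun (s : Finset H)
    (_ : Orthonormal ℝ (fun v : s => (v : H))) => ∑ v ∈ s, ‖T v‖ₑ ^ 2) _ ?_ le_rfl
  have h2 := hu.toSubtypeRange
  have h3 : ∀ v : (Finset.univ.map ⟨u, hu.linearIndependent.injective⟩ : Finset H),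
      (v : H) ∈ Set.range u := by
    intro v
    have := v.2
    simp only [Finset.mem_map, Finset.mem_univ, Function.Embedding.coeFn_mk, true_and] at this
    exact this
  exact h2.comp (fun v : (Finset.univ.map ⟨u, hu.linearIndependent.injective⟩ : Finset H) =>
    (⟨v, h3 v⟩ : Set.range u)) fun v w hvw =>
    Subtype.ext (congrArg (fun x : Set.range u => (x : H)) hvw)

/-- The Hilbert–Schmidt norm bounds the adjoint along orthonormal families. -/
theorem sum_enorm_sq_adjoint_le [CompleteSpace H] [CompleteSpace K] (T : H →L[ℝ] K) {ι : Type*}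
    [Fintype ι] {u : ι → K} (hu : Orthonormal ℝ u) :
    ∑ i, ‖ContinuousLinearMap.adjoint T (u i)‖ₑ ^ 2 ≤ hilbertSchmidtSq T := by
  set W : Submodule ℝ H := Submodule.span ℝ
    (Set.range fun i => ContinuousLinearMap.adjoint T (u i)) with hW
  have : FiniteDimensional ℝ W := FiniteDimensional.span_of_finite ℝ (Set.finite_range _)
  set b := stdOrthonormalBasis ℝ W
  have hb : Orthonormal ℝ (fun k => (b k : H)) :=
    b.orthonormal.comp_linearIsometry W.subtypeₗᵢ
  refine le_trans ?_ (sum_enorm_sq_le_hilbertSchmidtSq T hb)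
  simp only [enorm_sq_eq_ofReal]
  rw [← ENNReal.ofReal_sum_of_nonneg fun _ _ => by positivity,
    ← ENNReal.ofReal_sum_of_nonneg fun _ _ => by positivity]
  refine ENNReal.ofReal_le_ofReal ?_
  have h1 : ∀ i, ‖ContinuousLinearMap.adjoint T (u i)‖ ^ 2 =
      ∑ k, ‖inner ℝ (u i) (T (b k))‖ ^ 2 := by
    intro i
    have hm : ContinuousLinearMap.adjoint T (u i) ∈ W := Submodule.subset_span ⟨i, rfl⟩
    have := b.sum_sq_norm_inner_right ⟨_, hm⟩
    rw [Submodule.coe_norm] at this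
    rw [← this]
    refine Finset.sum_congr rfl fun k _ => ?_
    rw [Submodule.coe_inner, ContinuousLinearMap.adjoint_inner_right, real_inner_comm]
  simp only [h1]
  rw [Finset.sum_comm]
  exact Finset.sum_le_sum fun k _ => hu.sum_inner_products_le _

/-- A Hilbert–Schmidt operator is small on the complement of a finite orthonormal family. -/
theorem exists_orthonormal_small {T : H →L[ℝ] K} (hT : hilbertSchmidtSq T < ∞) {δ : ℝ}
    (hδ : 0 < δ) : ∃ s : Finset H, Orthonormal ℝ (fun v : s => (v : H)) ∧
      ∀ v : H, (∀ b ∈ s, inner ℝ b v = 0) → ‖T v‖ ≤ δ * ‖v‖ := by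
  classical
  -- an almost maximizing family: one more unit vector adds at most `δ²` to the sum
  have hδ2 : 0 < ENNReal.ofReal (δ ^ 2) := by simpa using pow_pos hδ 2
  obtain ⟨s, hs, hlt⟩ : ∃ s : Finset H, Orthonormal ℝ (fun v : s => (v : H)) ∧
      hilbertSchmidtSq T < ∑ v ∈ s, ‖T v‖ₑ ^ 2 + ENNReal.ofReal (δ ^ 2) := by
    rcases eq_or_ne (hilbertSchmidtSq T) 0 with h0 | h0
    · refine ⟨∅, ⟨fun v => absurd v.2 (Finset.notMem_empty _),
        fun v => absurd v.2 (Finset.notMem_empty _)⟩, ?_⟩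
      rw [h0]
      simpa using hδ2
    · have h1 : hilbertSchmidtSq T - ENNReal.ofReal (δ ^ 2) < hilbertSchmidtSq T :=
        ENNReal.sub_lt_self hT.ne h0 hδ2.ne'
      conv_rhs at h1 => rw [hilbertSchmidtSq]
      simp only [lt_iSup_iff] at h1
      obtain ⟨s, hs, h⟩ := h1
      exact ⟨s, hs, ENNReal.lt_add_of_sub_lt_right (Or.inl hT.ne) h⟩
  refine ⟨s, hs, fun v hv => ?_⟩
  rcases eq_or_ne v 0 with rfl | hv0
  · simp
  set w : H := ‖v‖⁻¹ • v with hw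
  have hw1 : ‖w‖ = 1 := by
    rw [hw, norm_smul, norm_inv, norm_norm, inv_mul_cancel₀ (norm_ne_zero_iff.2 hv0)]
  have hws : ∀ b ∈ s, inner ℝ b w = 0 := fun b hb => by
    rw [hw, inner_smul_right, hv b hb, mul_zero]
  have hwn : w ∉ s := fun h => by
    have := hws w h
    rw [real_inner_self_eq_norm_sq, hw1] at this
    norm_num at this
  have ho : Orthonormal ℝ (fun x : (insert w s : Finset H) => (x : H)) := by
    refine ⟨fun x => ?_, fun x y hxy => ?_⟩
    · rcases Finset.mem_insert.1 x.2 with h | h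
      · simp only [h, hw1]
      · exact hs.1 ⟨x, h⟩
    · have hxy' : (x : H) ≠ y := fun h => hxy (Subtype.ext h)
      rcases Finset.mem_insert.1 x.2 with h | h <;> rcases Finset.mem_insert.1 y.2 with h' | h'
      · exact absurd (h.trans h'.symm) hxy'
      · simp only
        rw [h, real_inner_comm, hws _ h']
      · simp only
        rw [h', hws _ h]
      · exact hs.2 (i := ⟨x, h⟩) (j := ⟨y, h'⟩) fun e => hxy' (congrArg (fun z : s => (z : H)) e)
  have h2 : ∑ x ∈ insert w s, ‖T x‖ₑ ^ 2 ≤ hilbertSchmidtSq T :=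
    le_iSup₂_of_le (f := fun (s : Finset H)
      (_ : Orthonormal ℝ (fun v : s => (v : H))) => ∑ v ∈ s, ‖T v‖ₑ ^ 2) _ ho le_rfl
  rw [Finset.sum_insert hwn, add_comm] at h2
  have h3 : ‖T w‖ₑ ^ 2 < ENNReal.ofReal (δ ^ 2) :=
    lt_of_add_lt_add_left (h2.trans_lt hlt)
  rw [enorm_sq_eq_ofReal, ENNReal.ofReal_lt_ofReal_iff (by positivity)] at h3
  have h4 : ‖T w‖ < δ := lt_of_pow_lt_pow_left₀ 2 hδ.le h3
  rw [hw, map_smul, norm_smul, norm_inv, norm_norm,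
    inv_mul_lt_iff₀ (norm_pos_iff.2 hv0)] at h4
  linarith

end HilbertSchmidt

/-! ### Countably-Hilbert spaces and their duals -/

namespace HilbertNorms

variable {E : Type*} [AddCommGroup E] [Module ℝ E] [TopologicalSpace E] (S : HilbertNorms E)

theorem denseRange_toEp (p : ℕ) : DenseRange (S.toEp p) :=
  UniformSpace.Completion.denseRange_coe (α := NormCopy (S.core p))

variable {S} (hS : S.IsNuclear)

theorem IsNuclear.exists_rho (hS : S.IsNuclear) : ∃ ρ : ℝ, 0 < ρ ∧ ρ < 1 ∧
    ∀ (p k : ℕ) (ξ : E), ‖S.toEp p ξ‖ ≤ ρ ^ k * ‖S.toEp (p + k) ξ‖ := by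
  obtain ⟨ρ, h0, h1, h⟩ := hS.norm_le
  refine ⟨ρ, h0, h1, fun p k ξ => ?_⟩
  induction k with
  | zero => simp
  | succ k ih =>
    refine ih.trans ?_
    rw [pow_succ, mul_assoc]
    exact mul_le_mul_of_nonneg_left (h (p + k) ξ) (by positivity)

theorem IsNuclear.norm_toEp_le (hS : S.IsNuclear) {p q : ℕ} (hpq : p ≤ q) (ξ : E) :
    ‖S.toEp p ξ‖ ≤ 1 * ‖S.toEp q ξ‖ := by
  obtain ⟨ρ, h0, h1, h⟩ := hS.exists_rho
  obtain ⟨k, rfl⟩ := Nat.exists_eq_add_of_le hpq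
  exact (h p k ξ).trans (by gcongr; exact pow_le_one₀ h0.le h1.le)

theorem IsNuclear.incl_toEp (hS : S.IsNuclear) {p q : ℕ} (hpq : p ≤ q) (ξ : E) :
    S.incl q p (S.toEp q ξ) = S.toEp p ξ :=
  LinearMap.extendOfNorm_eq (S.denseRange_toEp q) ⟨1, hS.norm_toEp_le hpq⟩ ξ

theorem IsNuclear.norm_incl_apply_le (hS : S.IsNuclear) {p q : ℕ} (hpq : p ≤ q) (v : S.Ep q) :
    ‖S.incl q p v‖ ≤ ‖v‖ := by
  have := LinearMap.norm_extendOfNorm_apply_le (f := S.toEp p) (S.denseRange_toEp q) 1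
    (hS.norm_toEp_le hpq) v
  rwa [one_mul] at this

theorem IsNuclear.exists_rho_incl (hS : S.IsNuclear) : ∃ ρ : ℝ, 0 < ρ ∧ ρ < 1 ∧
    ∀ (p k : ℕ) (v : S.Ep (p + k)), ‖S.incl (p + k) p v‖ ≤ ρ ^ k * ‖v‖ := by
  obtain ⟨ρ, h0, h1, h⟩ := hS.exists_rho
  exact ⟨ρ, h0, h1, fun p k v => LinearMap.norm_extendOfNorm_apply_le (S.denseRange_toEp _) _
    (h p k) v⟩

theorem IsNuclear.incl_incl (hS : S.IsNuclear) {p q r : ℕ} (hpq : p ≤ q) (hqr : q ≤ r)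
    (v : S.Ep r) : S.incl q p (S.incl r q v) = S.incl r p v := by
  have h : (fun v => S.incl q p (S.incl r q v)) = S.incl r p := by
    refine (S.denseRange_toEp r).equalizer (by fun_prop) (by fun_prop) ?_
    funext ξ
    simp only [Function.comp]
    rw [hS.incl_toEp hqr, hS.incl_toEp hpq, hS.incl_toEp (hpq.trans hqr)]
  exact congrFun h v

variable (S)

/-- The Riesz representative in `E_q` of `ξ ∈ E ⊂ E_q'`. -/
def riesz (q : ℕ) : E →ₗ[ℝ] S.Ep q :=
  (ContinuousLinearMap.adjoint (S.incl q 0) : S.Ep 0 →ₗ[ℝ] S.Ep q).comp (S.toEp 0)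

theorem toDual_symm_toDualEp (q : ℕ) (ξ : E) :
    (InnerProductSpace.toDual ℝ (S.Ep q)).symm (S.toDualEp q ξ) = S.riesz q ξ := by
  rw [LinearIsometryEquiv.symm_apply_eq]
  ext v
  simp [toDualEp, riesz, ContinuousLinearMap.adjoint_inner_left]

theorem innerNeg_eq (q : ℕ) (ξ η : E) :
    S.innerNeg q ξ η = inner ℝ (S.riesz q ξ) (S.riesz q η) := by
  rw [innerNeg, toDual_symm_toDualEp, toDual_symm_toDualEp]

theorem normNeg_eq (q : ℕ) (ξ : E) : S.normNeg q ξ = ‖S.riesz q ξ‖ := by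
  rw [normNeg, ← toDual_symm_toDualEp, LinearIsometryEquiv.norm_map]

variable {S}

/-- `E_q'` pairs with `E` through the inner product of `E_0`. -/
theorem IsNuclear.inner_riesz_toEp (hS : S.IsNuclear) (q : ℕ) (ξ η : E) :
    inner ℝ (S.riesz q ξ) (S.toEp q η) = S.inner0 ξ η := by
  change inner ℝ (ContinuousLinearMap.adjoint (S.incl q 0) (S.toEp 0 ξ)) _ = _
  rw [ContinuousLinearMap.adjoint_inner_left, hS.incl_toEp (Nat.zero_le q)]
  rfl

/-- The inclusion `E_s' ⊂ E_q'` is the adjoint of `i_{q,s}`. -/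
theorem IsNuclear.adjoint_riesz (hS : S.IsNuclear) {q s : ℕ} (hsq : s ≤ q) (ξ : E) :
    ContinuousLinearMap.adjoint (S.incl q s) (S.riesz s ξ) = S.riesz q ξ := by
  refine ext_inner_right ℝ fun v => ?_
  change inner ℝ _ v = inner ℝ (ContinuousLinearMap.adjoint (S.incl q 0) (S.toEp 0 ξ)) v
  rw [ContinuousLinearMap.adjoint_inner_left, ContinuousLinearMap.adjoint_inner_left]
  change inner ℝ (ContinuousLinearMap.adjoint (S.incl s 0) (S.toEp 0 ξ)) _ = _
  rw [ContinuousLinearMap.adjoint_inner_left, hS.incl_incl (Nat.zero_le _) hsq]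

theorem IsNuclear.riesz_zero (hS : S.IsNuclear) (ξ : E) : S.riesz 0 ξ = S.toEp 0 ξ := by
  refine (S.denseRange_toEp 0).eq_of_inner_right ℝ ?_
  intro η
  rw [real_inner_comm, hS.inner_riesz_toEp, real_inner_comm]
  rfl

theorem IsNuclear.innerNeg_zero (hS : S.IsNuclear) : S.innerNeg 0 = S.inner0 := by
  funext ξ η
  rw [S.innerNeg_eq, hS.riesz_zero, hS.riesz_zero]
  rfl

theorem IsNuclear.norm_riesz_le (hS : S.IsNuclear) {q s : ℕ} (hsq : s ≤ q) (ξ : E) :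
    ‖S.riesz q ξ‖ ≤ ‖S.riesz s ξ‖ := by
  rw [← hS.adjoint_riesz hsq]
  refine (ContinuousLinearMap.le_opNorm _ _).trans ?_
  rw [LinearIsometryEquiv.norm_map]
  refine mul_le_of_le_one_left (norm_nonneg _) ?_
  exact ContinuousLinearMap.opNorm_le_bound _ zero_le_one
    fun v => by rw [one_mul]; exact hS.norm_incl_apply_le hsq v

theorem IsNuclear.exists_rho_riesz (hS : S.IsNuclear) : ∃ ρ : ℝ, 0 < ρ ∧ ρ < 1 ∧
    ∀ (p k : ℕ) (ξ : E), ‖S.riesz (p + k) ξ‖ ≤ ρ ^ k * ‖S.riesz p ξ‖ := by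
  obtain ⟨ρ, h0, h1, h⟩ := hS.exists_rho_incl
  refine ⟨ρ, h0, h1, fun p k ξ => ?_⟩
  rw [← hS.adjoint_riesz (Nat.le_add_right p k)]
  refine (ContinuousLinearMap.le_opNorm _ _).trans ?_
  rw [LinearIsometryEquiv.norm_map]
  gcongr
  exact ContinuousLinearMap.opNorm_le_bound _ (by positivity) (h p k)

/-- `E` is dense in `E_q'`, because the inclusion `E_q ⊂ E_0` is injective. -/
theorem IsNuclear.denseRange_riesz (hS : S.IsNuclear) (q : ℕ) : DenseRange (S.riesz q) := by
  rw [DenseRange, ← LinearMap.coe_range, Submodule.dense_iff_topologicalClosure_eq_top,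
    Submodule.topologicalClosure_eq_top_iff, Submodule.eq_bot_iff]
  intro v hv
  refine hS.compatible 0 q (Nat.zero_le _) ?_
  rw [map_zero]
  refine (S.denseRange_toEp 0).eq_zero_of_inner_right ℝ ?_
  intro ξ
  have := hv _ ⟨ξ, rfl⟩
  change inner ℝ (ContinuousLinearMap.adjoint (S.incl q 0) (S.toEp 0 ξ)) v = 0 at this
  rwa [ContinuousLinearMap.adjoint_inner_left] at this

theorem toEp_eq_zero {p : ℕ} {ξ : E} (h : S.toEp p ξ = 0) : ξ = 0 := by
  let x : NormCopy (S.core p) := ξ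
  have h2 : ‖x‖ = 0 := by
    rw [← UniformSpace.Completion.norm_coe]
    exact norm_eq_zero.2 h
  exact norm_eq_zero.1 h2

theorem IsNuclear.riesz_injective (hS : S.IsNuclear) (q : ℕ) : Function.Injective (S.riesz q) := by
  rw [injective_iff_map_eq_zero]
  intro ξ hξ
  have h := hS.inner_riesz_toEp q ξ ξ
  rw [hξ, inner_zero_left] at h
  exact toEp_eq_zero (p := 0) (inner_self_eq_zero.1 h.symm)

/-- A finite family in `E` lies in the span of a finite family that is orthonormal in `E_q'` and
orthogonal in `E_s'`: the spectral theorem for `T* T`, where `T` carries the `|·|_{-q}` norm on the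
span to the `|·|_{-s}` norm. -/
theorem IsNuclear.exists_orthonormal_basis (hS : S.IsNuclear) (q s : ℕ) {ι : Type*} [Finite ι]
    (v : ι → E) : ∃ (m : ℕ) (e : Fin m → E),
      (∀ i j, S.innerNeg q (e i) (e j) = if i = j then 1 else 0) ∧
      (∀ i j, i ≠ j → S.innerNeg s (e i) (e j) = 0) ∧
      ∀ k, v k = ∑ i, S.innerNeg q (e i) (v k) • e i := by
  set W : Submodule ℝ E := Submodule.span ℝ (Set.range v)
  have : FiniteDimensional ℝ W := FiniteDimensional.span_of_finite ℝ (Set.finite_range _)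
  set eqv := W.equivMapOfInjective (S.riesz q) (hS.riesz_injective q) with heqv
  have : FiniteDimensional ℝ (W.map (S.riesz q)) := eqv.finiteDimensional
  have : CompleteSpace (W.map (S.riesz q)) := FiniteDimensional.complete ℝ _
  set T : W.map (S.riesz q) →L[ℝ] S.Ep s := LinearMap.toContinuousLinearMap
    ((S.riesz s).comp (W.subtype.comp eqv.symm.toLinearMap)) with hT
  have hTa : ∀ x, T x = S.riesz s (eqv.symm x : E) := fun x => rfl
  set A : W.map (S.riesz q) →ₗ[ℝ] W.map (S.riesz q) :=
    ((ContinuousLinearMap.adjoint T).comp T).toLinearMap with hA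
  have hAi : ∀ x y, inner ℝ (A x) y = inner ℝ (T x) (T y) := fun x y =>
    ContinuousLinearMap.adjoint_inner_left T y (T x)
  have hAs : A.IsSymmetric := fun x y => by
    rw [hAi, real_inner_comm, ← hAi, real_inner_comm]
  set b := hAs.eigenvectorBasis rfl
  have hcoe : ∀ x, S.riesz q (eqv.symm x : E) = x := fun x => by
    have : ((eqv (eqv.symm x) : W.map (S.riesz q)) : S.Ep q) = S.riesz q (eqv.symm x : E) := rfl
    rw [← this, eqv.apply_symm_apply]
  refine ⟨_, fun i => (eqv.symm (b i) : E), fun i j => ?_, fun i j hij => ?_, fun k => ?_⟩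
  · rw [S.innerNeg_eq, hcoe, hcoe, ← Submodule.coe_inner]
    exact orthonormal_iff_ite.1 b.orthonormal i j
  · rw [S.innerNeg_eq, ← hTa, ← hTa, ← hAi, hAs.apply_eigenvectorBasis, inner_smul_left,
      b.orthonormal.2 hij, mul_zero]
  · have hk : v k ∈ W := Submodule.subset_span ⟨k, rfl⟩
    have h := b.sum_repr' (eqv ⟨v k, hk⟩)
    have h2 := congrArg (fun x => (eqv.symm x : E)) h
    simp only [map_sum, map_smul, LinearEquiv.symm_apply_apply, Submodule.coe_sum,
      Submodule.coe_smul] at h2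
    rw [← h2]
    refine Finset.sum_congr rfl fun i _ => ?_
    rw [h2, S.innerNeg_eq, hcoe, Submodule.coe_inner]
    rfl

theorem orthonormal_riesz {q : ℕ} {ι : Type*} [DecidableEq ι] {e : ι → E}
    (he : ∀ i j, S.innerNeg q (e i) (e j) = if i = j then 1 else 0) :
    Orthonormal ℝ (fun i => S.riesz q (e i)) := by
  rw [orthonormal_iff_ite]
  intro i j
  rw [← S.innerNeg_eq]
  exact he i j

theorem IsNuclear.sum_enorm_riesz_le (hS : S.IsNuclear) {q s : ℕ} (hqs : q ≤ s) {m : ℕ}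
    {e : Fin m → E} (he : ∀ i j, S.innerNeg q (e i) (e j) = if i = j then 1 else 0) :
    ∑ i, ‖S.riesz s (e i)‖ₑ ^ 2 ≤ hilbertSchmidtSq (S.incl s q) := by
  simp only [← hS.adjoint_riesz hqs]
  exact sum_enorm_sq_adjoint_le _ (orthonormal_riesz he)

/-- Finite rank approximation of the identity of `E`, uniformly as a map from `E_s'` to `E_q'`:
the inclusion `E_s' ⊂ E_q'` is Hilbert–Schmidt, hence compact. -/
theorem IsNuclear.exists_finite_rank (hS : S.IsNuclear) {q s : ℕ} (hsq : s ≤ q)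
    (hHS : hilbertSchmidtSq (S.incl q s) < ∞) {δ : ℝ} (hδ : 0 < δ) :
    ∃ (m : ℕ) (ξ ζ : Fin m → E), ∀ η : E,
      ‖S.riesz q (η - ∑ i, S.inner0 (ξ i) η • ζ i)‖ ≤ δ * ‖S.riesz s η‖ := by
  classical
  -- On `E_s'` the adjoint of `T = i_{q,s}` is nearly `u ↦ ∑ ⟨T b, u⟩ b`, summed over a finite
  -- orthonormal family `t` outside of which `T` is small. Half of `δ` pays for that; the other half
  -- pays for moving the vectors `T b` and `b` into the dense subspace `E`.
  obtain ⟨t, ht, hsmall⟩ := exists_orthonormal_small hHS (half_pos hδ)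
  set T := S.incl q s
  set ε : ℝ := δ / 2 / (2 * (t.card + 1)) with hε
  have hε0 : 0 < ε := by positivity
  have hx : ∀ b : t, ∃ ξ : E, ‖T b - S.toEp s ξ‖ < ε := fun b => by
    obtain ⟨ξ, hξ⟩ := (S.denseRange_toEp s).exists_dist_lt (T b) hε0
    exact ⟨ξ, by rwa [dist_eq_norm] at hξ⟩
  choose ξ hξ using hx
  have hz : ∀ b : t, ∃ ζ : E, ‖(b : S.Ep q) - S.riesz q ζ‖ < ε / (‖S.toEp s (ξ b)‖ + 1) :=
    fun b => by
      obtain ⟨ζ, hζ⟩ := (hS.denseRange_riesz q).exists_dist_lt (b : S.Ep q)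
        (ε := ε / (‖S.toEp s (ξ b)‖ + 1)) (by positivity)
      exact ⟨ζ, by rwa [dist_eq_norm] at hζ⟩
  choose ζ hζ using hz
  set φ := t.equivFin
  refine ⟨t.card, fun i => ξ (φ.symm i), fun i => ζ (φ.symm i), fun η => ?_⟩
  have hsum : ∑ i, S.inner0 (ξ (φ.symm i)) η • ζ (φ.symm i) = ∑ b : t, S.inner0 (ξ b) η • ζ b :=
    φ.symm.sum_comp (fun b : t => S.inner0 (ξ b) η • ζ b)
  rw [hsum]
  set u := S.riesz s η
  set w := ContinuousLinearMap.adjoint T u - ∑ b : t, inner ℝ (T b) u • (b : S.Ep q) with hw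
  have hwb : ∀ b ∈ t, inner ℝ b w = 0 := fun b hb => by
    rw [hw, inner_sub_right, ContinuousLinearMap.adjoint_inner_right, inner_sum]
    have h1 : ∀ c : t, inner ℝ b (inner ℝ (T c) u • (c : S.Ep q)) =
        if (⟨b, hb⟩ : t) = c then inner ℝ (T b) u else 0 := by
      intro c
      have h2 := orthonormal_iff_ite.1 ht ⟨b, hb⟩ c
      simp only at h2
      rw [inner_smul_right, h2]
      split_ifs with h
      · subst h
        simp
      · simp
    simp [h1]
  have hwn : ‖w‖ ≤ δ / 2 * ‖u‖ := by
    -- `w` is orthogonal to `t`, so only the first term of its definition contributes to `‖w‖²`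
    have h1 : ‖w‖ ^ 2 = inner ℝ (T w) u := by
      rw [← real_inner_self_eq_norm_sq, ← ContinuousLinearMap.adjoint_inner_right]
      conv_lhs => rw [hw, inner_sub_right, ← hw]
      rw [inner_sum, Finset.sum_eq_zero, sub_zero]
      intro b _
      rw [inner_smul_right, real_inner_comm (b : S.Ep q) w, hwb _ b.2, mul_zero]
    have h2 : ‖w‖ ^ 2 ≤ δ / 2 * ‖w‖ * ‖u‖ :=
      h1.trans_le ((real_inner_le_norm _ _).trans (by gcongr; exact hsmall w hwb))
    rcases (norm_nonneg w).eq_or_lt with h | h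
    · rw [← h]
      positivity
    · nlinarith
  have hterm : ∀ b : t, ‖inner ℝ (T b) u • (b : S.Ep q) -
      S.inner0 (ξ b) η • S.riesz q (ζ b)‖ ≤ 2 * ε * ‖u‖ := by
    intro b
    have h0 : S.inner0 (ξ b) η = inner ℝ (S.toEp s (ξ b)) u := by
      rw [real_inner_comm, hS.inner_riesz_toEp]
      exact real_inner_comm _ _
    have hb1 : ‖(b : S.Ep q)‖ = 1 := ht.1 b
    rw [h0]
    have h1 : inner ℝ (T b) u • (b : S.Ep q) - inner ℝ (S.toEp s (ξ b)) u • S.riesz q (ζ b) =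
        inner ℝ (T b - S.toEp s (ξ b)) u • (b : S.Ep q) +
          inner ℝ (S.toEp s (ξ b)) u • ((b : S.Ep q) - S.riesz q (ζ b)) := by
      rw [inner_sub_left]
      module
    rw [h1]
    refine (norm_add_le _ _).trans ?_
    rw [norm_smul, norm_smul, hb1, mul_one]
    have h3 : ‖inner ℝ (T b - S.toEp s (ξ b)) u‖ ≤ ε * ‖u‖ :=
      (norm_inner_le_norm _ _).trans (by gcongr; exact (hξ b).le)
    have h4 : ‖inner ℝ (S.toEp s (ξ b)) u‖ * ‖(b : S.Ep q) - S.riesz q (ζ b)‖ ≤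
        (‖S.toEp s (ξ b)‖ * ‖u‖) * (ε / (‖S.toEp s (ξ b)‖ + 1)) := by
      gcongr
      · exact norm_inner_le_norm _ _
      · exact (hζ b).le
    have h5 : (‖S.toEp s (ξ b)‖ * ‖u‖) * (ε / (‖S.toEp s (ξ b)‖ + 1)) ≤ ε * ‖u‖ := by
      rw [mul_div_assoc', div_le_iff₀ (by positivity)]
      nlinarith [norm_nonneg u, norm_nonneg (S.toEp s (ξ b)), mul_nonneg hε0.le (norm_nonneg u)]
    linarith
  have hfin : S.riesz q (η - ∑ b : t, S.inner0 (ξ b) η • ζ b) =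
      w + ∑ b : t, (inner ℝ (T b) u • (b : S.Ep q) - S.inner0 (ξ b) η • S.riesz q (ζ b)) := by
    rw [Finset.sum_sub_distrib, hw, hS.adjoint_riesz hsq, map_sub, map_sum]
    simp only [map_smul]
    abel
  rw [hfin]
  refine (norm_add_le _ _).trans ?_
  have h6 : ‖∑ b : t, (inner ℝ (T b) u • (b : S.Ep q) - S.inner0 (ξ b) η • S.riesz q (ζ b))‖ ≤
      t.card * (2 * ε * ‖u‖) := by
    refine (norm_sum_le _ _).trans ((Finset.sum_le_sum fun b _ => hterm b).trans ?_)
    simp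
  have h7 : (t.card : ℝ) * (2 * ε * ‖u‖) ≤ δ / 2 * ‖u‖ := by
    have : (t.card : ℝ) * (2 * ε) ≤ δ / 2 := by
      rw [hε]
      rw [show (t.card : ℝ) * (2 * (δ / 2 / (2 * (t.card + 1)))) =
        δ / 2 * (t.card / (t.card + 1)) by field_simp]
      refine mul_le_of_le_one_right (by positivity) ?_
      rw [div_le_one (by positivity)]
      linarith
    calc _ = (t.card : ℝ) * (2 * ε) * ‖u‖ := by ring
      _ ≤ _ := by gcongr
  linarith

end HilbertNorms

end WhiteNoise

/-! ### Hilbert–Schmidt norms of multilinear forms -/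

namespace WhiteNoise

theorem enorm_sum_mul_sq_le {ι : Type*} (s : Finset ι) (a b : ι → ℂ) :
    ‖∑ i ∈ s, a i * b i‖ₑ ^ 2 ≤ (∑ i ∈ s, ‖a i‖ₑ ^ 2) * ∑ i ∈ s, ‖b i‖ₑ ^ 2 := by
  have h : ‖∑ i ∈ s, a i * b i‖ ^ 2 ≤ (∑ i ∈ s, ‖a i‖ ^ 2) * ∑ i ∈ s, ‖b i‖ ^ 2 := by
    calc ‖∑ i ∈ s, a i * b i‖ ^ 2 ≤ (∑ i ∈ s, ‖a i‖ * ‖b i‖) ^ 2 := by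
          gcongr
          refine (norm_sum_le _ _).trans_eq (Finset.sum_congr rfl fun i _ => norm_mul _ _)
      _ ≤ _ := Finset.sum_mul_sq_le_sq_mul_sq _ _ _
  simp only [enorm_sq_eq_ofReal]
  rw [← ENNReal.ofReal_sum_of_nonneg fun _ _ => by positivity,
    ← ENNReal.ofReal_sum_of_nonneg fun _ _ => by positivity,
    ← ENNReal.ofReal_mul (Finset.sum_nonneg fun _ _ => by positivity)]
  exact ENNReal.ofReal_le_ofReal h

theorem enorm_sum_sq_le {ι : Type*} (s : Finset ι) (a : ι → ℂ) :
    ‖∑ i ∈ s, a i‖ₑ ^ 2 ≤ s.card * ∑ i ∈ s, ‖a i‖ₑ ^ 2 := by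
  have := enorm_sum_mul_sq_le s (fun _ => 1) a
  simpa using this

theorem hsFormSq_mono_sum {E : Type*} {B : E → E → ℝ} {n : ℕ} (f : (Fin n → E) → ℂ) {m : ℕ}
    {e : Fin m → E} (he : ∀ i j, B (e i) (e j) = if i = j then 1 else 0) :
    ∑ j : Fin n → Fin m, ‖f (fun k => e (j k))‖ₑ ^ 2 ≤ hsFormSq B f :=
  le_iSup_of_le m (le_iSup_of_le e (le_iSup_of_le he le_rfl))

theorem hsFormSq_sum_le {E ι : Type*} (B : E → E → ℝ) {n : ℕ} (s : Finset ι)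
    (f : ι → (Fin n → E) → ℂ) :
    hsFormSq B (fun ξ => ∑ i ∈ s, f i ξ) ≤ s.card * ∑ i ∈ s, hsFormSq B (f i) := by
  refine iSup_le fun m => iSup_le fun e => iSup_le fun he => ?_
  calc _ ≤ ∑ j : Fin n → Fin m, (s.card : ℝ≥0∞) * ∑ i ∈ s, ‖f i (fun k => e (j k))‖ₑ ^ 2 :=
        Finset.sum_le_sum fun j _ => enorm_sum_sq_le s _
    _ = s.card * ∑ i ∈ s, ∑ j : Fin n → Fin m, ‖f i (fun k => e (j k))‖ₑ ^ 2 := by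
        rw [← Finset.mul_sum, Finset.sum_comm]
    _ ≤ _ := by
        gcongr with i _
        exact hsFormSq_mono_sum (f i) he

theorem hsFormSq_zero {E : Type*} (B : E → E → ℝ) {n : ℕ} :
    hsFormSq B (fun _ : Fin n → E => (0 : ℂ)) = 0 := by
  simp [hsFormSq]

/-- The triangle inequality for the Hilbert–Schmidt norm. -/
theorem hsFormSq_add_rpow_le {E : Type*} (B : E → E → ℝ) {n : ℕ} (f g : (Fin n → E) → ℂ) :
    hsFormSq B (fun ξ => f ξ + g ξ) ^ (1 / 2 : ℝ) ≤
      hsFormSq B f ^ (1 / 2 : ℝ) + hsFormSq B g ^ (1 / 2 : ℝ) := by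
  rw [one_div, ENNReal.rpow_inv_le_iff two_pos]
  refine iSup_le fun m => iSup_le fun e => iSup_le fun he => ?_
  rw [← ENNReal.rpow_inv_le_iff two_pos, ← one_div]
  have hf := hsFormSq_mono_sum f he
  have hg := hsFormSq_mono_sum g he
  have key := ENNReal.Lp_add_le (p := 2) Finset.univ
    (fun j : Fin n → Fin m => ‖f (fun k => e (j k))‖ₑ)
    (fun j : Fin n → Fin m => ‖g (fun k => e (j k))‖ₑ) (by norm_num)
  simp only [ENNReal.rpow_ofNat] at key
  calc _ ≤ (∑ j : Fin n → Fin m,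
        (‖f (fun k => e (j k))‖ₑ + ‖g (fun k => e (j k))‖ₑ) ^ 2) ^ (1 / 2 : ℝ) := by
        gcongr with j _
        exact enorm_add_le _ _
    _ ≤ _ := key
    _ ≤ _ := by gcongr

namespace HilbertNorms

variable {E : Type*} [AddCommGroup E] [Module ℝ E] [TopologicalSpace E] {S : HilbertNorms E}

/-- The operator norm of a multilinear form is at most its Hilbert–Schmidt norm. -/
theorem IsNuclear.enorm_sq_le_hsFormSq (hS : S.IsNuclear) (q : ℕ) {n : ℕ}
    (f : MultilinearMap ℝ (fun _ : Fin n => E) ℂ) (η : Fin n → E) :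
    ‖f η‖ₑ ^ 2 ≤ hsFormSq (S.innerNeg q) f * ∏ k, ‖S.riesz q (η k)‖ₑ ^ 2 := by
  obtain ⟨m, e, he, -, hη⟩ := hS.exists_orthonormal_basis q q η
  have h1 : f η = ∑ j : Fin n → Fin m, f (fun k => e (j k)) *
      ((∏ k, S.innerNeg q (e (j k)) (η k) : ℝ) : ℂ) := by
    conv_lhs => rw [show η = fun k => ∑ i, S.innerNeg q (e i) (η k) • e i from funext hη]
    rw [f.map_sum]
    refine Finset.sum_congr rfl fun j _ => ?_
    rw [f.map_smul_univ, mul_comm]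
    exact Complex.real_smul
  rw [h1]
  refine (enorm_sum_mul_sq_le _ _ _).trans ?_
  refine mul_le_mul' (hsFormSq_mono_sum f he) ?_
  have h2 : ∀ j : Fin n → Fin m, ‖((∏ k, S.innerNeg q (e (j k)) (η k) : ℝ) : ℂ)‖ₑ ^ 2 =
      ENNReal.ofReal (∏ k, S.innerNeg q (e (j k)) (η k) ^ 2) := by
    intro j
    rw [enorm_sq_eq_ofReal, Complex.norm_real, Real.norm_eq_abs, sq_abs, Finset.prod_pow]
  have h3 : ∏ k, ‖S.riesz q (η k)‖ₑ ^ 2 = ENNReal.ofReal (∏ k, ‖S.riesz q (η k)‖ ^ 2) := by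
    rw [ENNReal.ofReal_prod_of_nonneg fun _ _ => by positivity]
    exact Finset.prod_congr rfl fun k _ => enorm_sq_eq_ofReal _
  simp only [h2]
  rw [h3, ← ENNReal.ofReal_sum_of_nonneg
    fun _ _ => Finset.prod_nonneg fun _ _ => by positivity]
  refine ENNReal.ofReal_le_ofReal ?_
  have h4 : ∑ j : Fin n → Fin m, ∏ k, S.innerNeg q (e (j k)) (η k) ^ 2 =
      ∏ k, ∑ i, S.innerNeg q (e i) (η k) ^ 2 := by
    rw [Finset.prod_univ_sum, Fintype.piFinset_univ]
  rw [h4]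
  refine Finset.prod_le_prod (fun k _ => Finset.sum_nonneg fun _ _ => by positivity) fun k _ => ?_
  have := (orthonormal_riesz he).sum_inner_products_le (S.riesz q (η k)) (s := Finset.univ)
  simpa [S.innerNeg_eq] using this

theorem sum_prod_enorm_sq {V : Type*} [SeminormedAddCommGroup V] {m : ℕ} (n : ℕ) (v : Fin m → V) :
    ∑ j : Fin n → Fin m, ∏ k, ‖v (j k)‖ₑ ^ 2 = (∑ i, ‖v i‖ₑ ^ 2) ^ n := by
  have := Finset.prod_univ_sum (fun _ : Fin n => (Finset.univ : Finset (Fin m)))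
    (fun _ i => ‖v i‖ₑ ^ 2)
  rw [Fintype.piFinset_univ] at this
  rw [← this]
  simp

/-- A multilinear form that is bounded for `|·|_{-s}` is Hilbert–Schmidt for `|·|_{-r}` when
`i_{s,r}` is Hilbert–Schmidt. -/
theorem IsNuclear.hsFormSq_le_of_bound (hS : S.IsNuclear) {r s : ℕ} (hrs : r ≤ s) {n : ℕ}
    (f : (Fin n → E) → ℂ) (C x : ℝ≥0∞)
    (hf : ∀ η, ‖f η‖ₑ ^ 2 ≤ C * x ^ n * ∏ k, ‖S.riesz s (η k)‖ₑ ^ 2) :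
    hsFormSq (S.innerNeg r) f ≤ C * (x * hilbertSchmidtSq (S.incl s r)) ^ n := by
  refine iSup_le fun m => iSup_le fun e => iSup_le fun he => ?_
  calc _ ≤ ∑ j : Fin n → Fin m, C * x ^ n * ∏ k, ‖S.riesz s (e (j k))‖ₑ ^ 2 :=
        Finset.sum_le_sum fun j _ => hf _
    _ = C * (x * ∑ i, ‖S.riesz s (e i)‖ₑ ^ 2) ^ n := by
        rw [← Finset.mul_sum, sum_prod_enorm_sq n fun i => S.riesz s (e i), mul_pow, mul_assoc]
    _ ≤ _ := by
        gcongr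
        exact hS.sum_enorm_riesz_le hrs he

theorem IsNuclear.hsFormSq_mono_of_nuclear (hS : S.IsNuclear) {r s : ℕ} (hrs : r ≤ s)
    (hHS : hilbertSchmidtSq (S.incl s r) ≤ 1) {n : ℕ}
    (f : MultilinearMap ℝ (fun _ : Fin n => E) ℂ) :
    hsFormSq (S.innerNeg r) f ≤ hsFormSq (S.innerNeg s) f := by
  refine (hS.hsFormSq_le_of_bound hrs f (hsFormSq (S.innerNeg s) f) 1
    (by simpa using hS.enorm_sq_le_hsFormSq s f)).trans ?_
  rw [one_mul]
  exact mul_le_of_le_one_right' (pow_le_one₀ zero_le hHS)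

/-- Replacing the arguments `η k` of a multilinear form by nearby `A (η k)`: in the expansion of
`f (η + (A η - η))` over subsets, all terms but one contain a factor `A (η k) - η k`. -/
theorem enorm_sub_le_of_near {q s : ℕ} {n : ℕ} (f : MultilinearMap ℝ (fun _ : Fin n => E) ℂ)
    {C : ℝ} (hC : 0 ≤ C) (hf : ∀ η, ‖f η‖ ≤ C * ∏ k, ‖S.riesz q (η k)‖) {δ : ℝ}
    (hqs : ∀ ξ, ‖S.riesz q ξ‖ ≤ ‖S.riesz s ξ‖)
    (A : E → E) (hA : ∀ ξ, ‖S.riesz q (ξ - A ξ)‖ ≤ δ * ‖S.riesz s ξ‖) (η : Fin n → E) :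
    ‖f η - f (fun k => A (η k))‖ ≤ C * ((1 + δ) ^ n - 1) * ∏ k, ‖S.riesz s (η k)‖ := by
  classical
  have h1 : (fun k => A (η k)) = η + fun k => A (η k) - η k := by
    funext k
    simp
  have hd : ∀ ξ, ‖S.riesz q (A ξ - ξ)‖ ≤ δ * ‖S.riesz s ξ‖ := fun ξ => by
    have := hA ξ
    rwa [← neg_sub, map_neg, norm_neg] at this
  rw [h1, f.map_add_univ, ← Finset.sum_erase_add _ _ (Finset.mem_univ Finset.univ)]
  rw [Finset.piecewise_univ, sub_add_cancel_right, norm_neg]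
  refine (norm_sum_le _ _).trans ?_
  have h2 : ∀ t : Finset (Fin n), ‖f (t.piecewise η fun k => A (η k) - η k)‖ ≤
      C * (1 ^ t.card * δ ^ (n - t.card)) * ∏ k, ‖S.riesz s (η k)‖ := by
    intro t
    refine (hf _).trans ?_
    rw [mul_assoc]
    refine mul_le_mul_of_nonneg_left ?_ hC
    have h3 : (1 : ℝ) ^ t.card * δ ^ (n - t.card) = ∏ k, if k ∈ t then 1 else δ := by
      rw [Finset.prod_ite]
      simp only [Finset.prod_const]
      congr 2
      · simp
      · rw [Finset.filter_not, ← Finset.compl_eq_univ_sdiff, Finset.card_compl]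
        simp
    rw [h3, ← Finset.prod_mul_distrib]
    refine Finset.prod_le_prod (fun _ _ => norm_nonneg _) fun k _ => ?_
    by_cases hk : k ∈ t
    · simpa [hk] using hqs _
    · simpa [hk] using hd _
  refine (Finset.sum_le_sum fun t _ => h2 t).trans ?_
  rw [← Finset.sum_mul, ← Finset.mul_sum]
  refine le_of_eq ?_
  congr 2
  have h4 := Fintype.sum_pow_mul_eq_add_pow (Fin n) (1 : ℝ) δ
  rw [Fintype.card_fin] at h4
  rw [← h4, ← Finset.sum_erase_add _ _ (Finset.mem_univ Finset.univ)]
  simp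

end HilbertNorms

end WhiteNoise

/-! ### The complexification and its bilinear pairing -/

namespace WhiteNoise

namespace Complexification

variable {E : Type*} [AddCommGroup E] [Module ℝ E]

omit [Module ℝ E] in
@[simp] theorem re_add (ξ η : Complexification E) : (ξ + η).re = ξ.re + η.re := rfl
omit [Module ℝ E] in
@[simp] theorem im_add (ξ η : Complexification E) : (ξ + η).im = ξ.im + η.im := rfl
@[simp] theorem re_smul (z : ℂ) (ξ : Complexification E) :
    (z • ξ).re = z.re • ξ.re - z.im • ξ.im := rfl
@[simp] theorem im_smul (z : ℂ) (ξ : Complexification E) :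
    (z • ξ).im = z.re • ξ.im + z.im • ξ.re := rfl

@[simp] theorem re_real_smul (r : ℝ) (ξ : Complexification E) : (r • ξ).re = r • ξ.re := by
  change (r : ℂ).re • ξ.re - (r : ℂ).im • ξ.im = _
  simp

@[simp] theorem im_real_smul (r : ℝ) (ξ : Complexification E) : (r • ξ).im = r • ξ.im := by
  change (r : ℂ).re • ξ.im + (r : ℂ).im • ξ.re = _
  simp

omit [AddCommGroup E] [Module ℝ E] in
@[ext] theorem ext {ξ η : Complexification E} (h1 : ξ.re = η.re) (h2 : ξ.im = η.im) : ξ = η :=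
  Prod.ext h1 h2

/-- The inclusion `E → E_c`. -/
def ofR : E →ₗ[ℝ] Complexification E where
  toFun η := ((η, 0) : E × E)
  map_add' η ζ := by
    ext
    · rfl
    · exact (add_zero (0 : E)).symm
  map_smul' r η := by
    ext
    · change r • η = (r : ℂ).re • η - (r : ℂ).im • (0 : E)
      simp
    · change (0 : E) = (r : ℂ).re • (0 : E) + (r : ℂ).im • η
      simp

@[simp] theorem re_ofR (η : E) : (ofR η).re = η := rfl
@[simp] theorem im_ofR (η : E) : (ofR η).im = 0 := rfl

theorem eq_ofR_add (ξ : Complexification E) : ξ = ofR ξ.re + Complex.I • ofR ξ.im := by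
  ext <;> simp

/-- Complex conjugation on `E_c`. -/
def conj (ξ : Complexification E) : Complexification E := ((ξ.re, -ξ.im) : E × E)

omit [Module ℝ E] in
@[simp] theorem re_conj (ξ : Complexification E) : ξ.conj.re = ξ.re := rfl
omit [Module ℝ E] in
@[simp] theorem im_conj (ξ : Complexification E) : ξ.conj.im = -ξ.im := rfl

variable [TopologicalSpace E]

/-- The complex linear extension of `x ∈ E'` to `E_c`. -/
def evalC (x : DualSpace E) (ξ : Complexification E) : ℂ := (x ξ.re : ℂ) + Complex.I * (x ξ.im : ℂ)

theorem dual_add (x : DualSpace E) (ξ η : E) : x (ξ + η) = x ξ + x η :=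
  map_add (show E →L[ℝ] ℝ from x) ξ η

theorem dual_neg (x : DualSpace E) (ξ : E) : x (-ξ) = -x ξ :=
  map_neg (show E →L[ℝ] ℝ from x) ξ

theorem dual_sub (x : DualSpace E) (ξ η : E) : x (ξ - η) = x ξ - x η :=
  map_sub (show E →L[ℝ] ℝ from x) ξ η

theorem dual_smul (x : DualSpace E) (r : ℝ) (ξ : E) : x (r • ξ) = r * x ξ :=
  map_smul (show E →L[ℝ] ℝ from x) r ξ

theorem dual_zero (x : DualSpace E) : x 0 = 0 :=
  map_zero (show E →L[ℝ] ℝ from x)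

theorem evalC_add (x : DualSpace E) (ξ η : Complexification E) :
    evalC x (ξ + η) = evalC x ξ + evalC x η := by
  simp only [evalC, re_add, im_add, dual_add]
  push_cast
  ring

theorem evalC_smul (x : DualSpace E) (z : ℂ) (ξ : Complexification E) :
    evalC x (z • ξ) = z * evalC x ξ := by
  simp only [evalC, re_smul, im_smul, dual_add, dual_sub, dual_smul]
  push_cast
  conv_rhs => rw [← Complex.re_add_im z]
  linear_combination (-(z.im : ℂ) * x ξ.im) * Complex.I_mul_I

theorem evalC_ofR (x : DualSpace E) (η : E) : evalC x (ofR η) = x η := by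
  simp [evalC, dual_zero]

end Complexification

namespace HilbertNorms

open Complexification

variable {E : Type*} [AddCommGroup E] [Module ℝ E] [TopologicalSpace E] (S : HilbertNorms E)

theorem inner0_comm (ξ η : E) : S.inner0 ξ η = S.inner0 η ξ := real_inner_comm _ _

theorem inner0_add_left (ξ η ζ : E) : S.inner0 (ξ + η) ζ = S.inner0 ξ ζ + S.inner0 η ζ := by
  simp [inner0, inner_add_left]

theorem inner0_sub_left (ξ η ζ : E) : S.inner0 (ξ - η) ζ = S.inner0 ξ ζ - S.inner0 η ζ := by
  simp [inner0, inner_sub_left]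

theorem inner0_smul_left (r : ℝ) (ξ ζ : E) : S.inner0 (r • ξ) ζ = r * S.inner0 ξ ζ := by
  simp [inner0, inner_smul_left]

theorem inner0_zero_left (ζ : E) : S.inner0 0 ζ = 0 := by
  simp [inner0]

/-- The complex bilinear extension of `⟨ξ, η⟩` to `E_c`. -/
def pairC (ξ η : Complexification E) : ℂ :=
  ((S.inner0 ξ.re η.re - S.inner0 ξ.im η.im : ℝ) : ℂ) +
    Complex.I * ((S.inner0 ξ.re η.im + S.inner0 ξ.im η.re : ℝ) : ℂ)

theorem pairC_comm (ξ η : Complexification E) : S.pairC ξ η = S.pairC η ξ := by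
  simp only [pairC, S.inner0_comm ξ.re, S.inner0_comm ξ.im, add_comm (S.inner0 η.im ξ.re)]

theorem pairC_add_left (ξ η ζ : Complexification E) :
    S.pairC (ξ + η) ζ = S.pairC ξ ζ + S.pairC η ζ := by
  simp only [pairC, re_add, im_add, inner0_add_left]
  push_cast
  ring

theorem pairC_smul_left (z : ℂ) (ξ ζ : Complexification E) :
    S.pairC (z • ξ) ζ = z * S.pairC ξ ζ := by
  simp only [pairC, re_smul, im_smul, inner0_add_left, inner0_sub_left, inner0_smul_left]
  push_cast
  conv_rhs => rw [← Complex.re_add_im z]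
  linear_combination (-(z.im : ℂ) * (S.inner0 ξ.re ζ.im + S.inner0 ξ.im ζ.re)) * Complex.I_mul_I

theorem pairC_add_right (ξ η ζ : Complexification E) :
    S.pairC ζ (ξ + η) = S.pairC ζ ξ + S.pairC ζ η := by
  rw [pairC_comm, pairC_add_left, pairC_comm, S.pairC_comm η]

theorem pairC_smul_right (z : ℂ) (ξ ζ : Complexification E) :
    S.pairC ζ (z • ξ) = z * S.pairC ζ ξ := by
  rw [pairC_comm, pairC_smul_left, pairC_comm]

theorem pairC_ofR (ξ η : E) : S.pairC (ofR ξ) (ofR η) = S.inner0 ξ η := by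
  simp [pairC, inner0_zero_left, S.inner0_comm ξ 0]

theorem wickExp_eq (ξ : Complexification E) (x : DualSpace E) :
    S.wickExp ξ x = Complex.exp (evalC x ξ - S.pairC ξ ξ / 2) := by
  rw [wickExp, pairC, evalC, S.inner0_comm ξ.im ξ.re]
  congr 1
  push_cast
  ring

theorem wickExp_mul (ξ η : Complexification E) (x : DualSpace E) :
    S.wickExp ξ x * S.wickExp η x = Complex.exp (S.pairC ξ η) * S.wickExp (ξ + η) x := by
  simp only [wickExp_eq, ← Complex.exp_add, evalC_add, pairC_add_left, pairC_add_right]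
  congr 1
  rw [S.pairC_comm η ξ]
  ring

theorem conj_wickExp (ξ : Complexification E) (x : DualSpace E) :
    (starRingEnd ℂ) (S.wickExp ξ x) = S.wickExp ξ.conj x := by
  rw [wickExp, wickExp, ← Complex.exp_conj]
  have h : S.inner0 ξ.re (-ξ.im) = -S.inner0 ξ.re ξ.im := by simp [inner0]
  have h2 : S.inner0 (-ξ.im) (-ξ.im) = S.inner0 ξ.im ξ.im := by simp [inner0]
  simp only [re_conj, im_conj, h, h2, dual_neg]
  congr 1
  simp only [map_sub, map_add, map_mul, map_div₀, Complex.conj_ofReal, Complex.conj_I, map_ofNat]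
  push_cast
  ring

end HilbertNorms

/-! ### Wick monomials and their derivatives -/

/-- The contraction of a family of functions of `n` arguments, `n = 0, 1, 2, …`, with a functional
`a`: every argument in turn is fed to `a`. -/
def contr {E : Type*} (a : E → ℂ) (W : (n : ℕ) → (Fin n → E) → ℂ) : (n : ℕ) → (Fin n → E) → ℂ
  | 0, _ => 0
  | n + 1, η => ∑ j, a (η j) * W n (fun k => η (j.succAbove k))

/-- The recursion for Wick monomials, with values `X η` in place of the pairings `⟨x, η⟩` and with
covariance `B`. -/
def wickRec {E : Type*} (X : E → ℂ) (B : E → E → ℝ) : (n : ℕ) → (Fin n → E) → ℂ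
  | 0, _ => 1
  | 1, η => X (η 0)
  | n + 2, η => X (η 0) * wickRec X B (n + 1) (fun k => η k.succ) -
      ∑ j : Fin (n + 1), (B (η 0) (η j.succ) : ℂ) *
        wickRec X B n (fun k => η (j.succAbove k).succ)

theorem contr_comm {E : Type*} (a b : E → ℂ) (W : (n : ℕ) → (Fin n → E) → ℂ) :
    ∀ (n : ℕ) (η : Fin n → E), contr a (contr b W) n η = contr b (contr a W) n η
  | 0, _ => rfl
  | 1, _ => by simp [contr]
  | n + 2, η => by
    simp only [contr, Finset.mul_sum]
    rw [← Fintype.sum_prod_type', ← Fintype.sum_prod_type']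
    refine Finset.sum_bij' (fun p _ => (p.1.succAbove p.2, p.2.predAbove p.1))
      (fun p _ => (p.1.succAbove p.2, p.2.predAbove p.1)) (by simp) (by simp) ?_ ?_ ?_
    · rintro ⟨i, j⟩ _
      simp [Fin.succAbove_succAbove_predAbove, Fin.predAbove_predAbove_succAbove]
    · rintro ⟨i, j⟩ _
      simp [Fin.succAbove_succAbove_predAbove, Fin.predAbove_predAbove_succAbove]
    · rintro ⟨i, j⟩ _
      simp only [Fin.succAbove_succAbove_predAbove]
      rw [mul_left_comm]
      congr 3
      funext k
      rw [Fin.succAbove_succAbove_succAbove_predAbove]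

theorem contr_const_mul {E : Type*} (a : E → ℂ) (c : ℂ) (W : (n : ℕ) → (Fin n → E) → ℂ) (n : ℕ)
    (η : Fin n → E) : contr a (fun n η => c * W n η) n η = c * contr a W n η := by
  cases n with
  | zero => simp [contr]
  | succ n =>
    simp only [contr, Finset.mul_sum]
    exact Finset.sum_congr rfl fun j _ => by ring

theorem contr_neg {E : Type*} (a : E → ℂ) (W : (n : ℕ) → (Fin n → E) → ℂ) (n : ℕ)
    (η : Fin n → E) : contr a (fun n η => -W n η) n η = -contr a W n η := by
  simpa using contr_const_mul a (-1) W n η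

/-- The recursion for Wick monomials, with the cases `1` and `n + 2` treated alike. -/
theorem wickRec_succ {E : Type*} (X : E → ℂ) (B : E → E → ℝ) (n : ℕ) (η : Fin (n + 1) → E) :
    wickRec X B (n + 1) η = X (η 0) * wickRec X B n (fun k => η k.succ) -
      contr (fun e => (B (η 0) e : ℂ)) (wickRec X B) n (fun k => η k.succ) := by
  cases n with
  | zero => simp [wickRec, contr]
  | succ n => simp [wickRec, contr]

/-- The Leibniz rule for contractions of Wick monomials. -/
theorem contr_wickRec_succ {E : Type*} (a X : E → ℂ) (B : E → E → ℝ) (n : ℕ)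
    (η : Fin (n + 1) → E) :
    contr a (wickRec X B) (n + 1) η = a (η 0) * wickRec X B n (fun k => η k.succ) +
      (X (η 0) * contr a (wickRec X B) n (fun k => η k.succ) -
        contr (fun e => (B (η 0) e : ℂ)) (contr a (wickRec X B)) n (fun k => η k.succ)) := by
  rw [contr_comm]
  cases n with
  | zero => simp [contr]
  | succ n =>
    rw [contr, Fin.sum_univ_succ]
    congr 1
    rw [contr, contr, Finset.mul_sum, ← Finset.sum_sub_distrib]
    refine Finset.sum_congr rfl fun j _ => ?_
    rw [wickRec_succ]
    simp only [Fin.succ_succAbove_zero, Fin.succ_succAbove_succ]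
    ring

/-- Differentiating a Wick monomial in its base point contracts it. For the pairings
`⟨x - zζ, η⟩ = ⟨x, η⟩ - z⟨ζ, η⟩` this is `d/dz :(x - zζ)^{⊗n}: = -n ζ ⊗ :(x - zζ)^{⊗(n-1)}:`. -/
theorem hasDerivAt_wickRec {E : Type*} (X a : E → ℂ) (B : E → E → ℝ) (n : ℕ) (η : Fin n → E)
    (z : ℂ) :
    HasDerivAt (fun z : ℂ => wickRec (fun e => X e - z * a e) B n η)
      (-contr a (wickRec (fun e => X e - z * a e) B) n η) z := by
  induction n using Nat.strong_induction_on with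
  | _ n ih =>
  cases n with
  | zero => simpa [wickRec, contr] using hasDerivAt_const z (1 : ℂ)
  | succ n =>
    have hX : HasDerivAt (fun z : ℂ => X (η 0) - z * a (η 0)) (-a (η 0)) z := by
      simpa using ((hasDerivAt_id z).mul_const (a (η 0))).const_sub (X (η 0))
    have h1 := hX.mul (ih n (Nat.lt_succ_self n) (fun k => η k.succ))
    have h2 : HasDerivAt (fun z : ℂ => contr (fun e => (B (η 0) e : ℂ))
        (wickRec (fun e => X e - z * a e) B) n (fun k => η k.succ))
        (-contr (fun e => (B (η 0) e : ℂ)) (contr a (wickRec (fun e => X e - z * a e) B)) n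
          (fun k => η k.succ)) z := by
      rw [← contr_neg]
      cases n with
      | zero => simpa [contr] using hasDerivAt_const z (0 : ℂ)
      | succ n =>
        simp only [contr]
        refine HasDerivAt.fun_sum fun j _ => ?_
        exact (ih n (by omega) _).const_mul _
    have h3 := h1.sub h2
    simp only [wickRec_succ]
    refine h3.congr_deriv ?_
    rw [contr_wickRec_succ]
    ring

/-! ### Functions with moments of all orders -/

/-- Real functions with finite moments of all orders. -/
def HasAllMoments {Ω : Type*} [MeasurableSpace Ω] (μ : Measure Ω) (f : Ω → ℝ) : Prop :=
  ∀ p : ℝ≥0, MemLp f p μ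

namespace HasAllMoments

variable {Ω : Type*} [MeasurableSpace Ω] {μ : Measure Ω} {f g : Ω → ℝ}

theorem const [IsFiniteMeasure μ] (c : ℝ) : HasAllMoments μ (fun _ => c) :=
  fun _ => memLp_const c

theorem add (hf : HasAllMoments μ f) (hg : HasAllMoments μ g) :
    HasAllMoments μ (fun x => f x + g x) :=
  fun p => (hf p).add (hg p)

theorem mul (hf : HasAllMoments μ f) (hg : HasAllMoments μ g) :
    HasAllMoments μ (fun x => f x * g x) := fun p => by
  have : ENNReal.HolderTriple ((2 * p : ℝ≥0) : ℝ≥0∞) ((2 * p : ℝ≥0) : ℝ≥0∞) (p : ℝ≥0∞) := by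
    constructor
    rw [ENNReal.coe_mul, ENNReal.mul_inv (by simp) (by simp), ← add_mul, ENNReal.coe_ofNat,
      ENNReal.inv_two_add_inv_two, one_mul]
  exact MemLp.mul (r := (p : ℝ≥0∞)) (hg (2 * p)) (hf (2 * p))

theorem const_mul [IsFiniteMeasure μ] (hf : HasAllMoments μ f) (c : ℝ) :
    HasAllMoments μ (fun x => c * f x) :=
  (const c).mul hf

theorem abs (hf : HasAllMoments μ f) : HasAllMoments μ (fun x => |f x|) :=
  fun p => (hf p).norm

theorem sum {ι : Type*} (s : Finset ι) {f : ι → Ω → ℝ} (hf : ∀ i, HasAllMoments μ (f i)) :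
    HasAllMoments μ (fun x => ∑ i ∈ s, f i x) :=
  fun p => memLp_finsetSum _ fun i _ => hf i p

theorem memLp_two (hf : HasAllMoments μ f) : MemLp f 2 μ := hf 2

theorem integrable_norm_mul {ψ : Ω → ℂ} (hf : HasAllMoments μ f) (hψ : MemLp ψ 2 μ) :
    Integrable (fun x => ‖ψ x‖ * f x) μ :=
  hψ.norm.integrable_mul hf.memLp_two

end HasAllMoments

namespace HilbertNorms

open Complexification

variable {E : Type*} [AddCommGroup E] [Module ℝ E] [TopologicalSpace E] (S : HilbertNorms E)
  (μ : Measure (DualSpace E)) [hμ : S.IsStandardGaussian μ]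

theorem hasAllMoments_eval (S : HilbertNorms E) (μ : Measure (DualSpace E))
    [S.IsStandardGaussian μ] (ξ : E) : HasAllMoments μ (fun x : DualSpace E => x ξ) :=
  fun p => S.memLp_eval μ ξ p

theorem hasAllMoments_exp (S : HilbertNorms E) (μ : Measure (DualSpace E))
    [S.IsStandardGaussian μ] (ξ : E) :
    HasAllMoments μ (fun x : DualSpace E => Real.exp (x ξ)) := by
  intro p
  have hm : AEStronglyMeasurable (fun x : DualSpace E => Real.exp (x ξ)) μ :=
    (Real.measurable_exp.comp (measurable_eval ξ)).aestronglyMeasurable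
  rcases eq_or_ne p 0 with rfl | hp
  · rw [ENNReal.coe_zero, memLp_zero_iff_aestronglyMeasurable]
    exact hm
  rw [← integrable_norm_rpow_iff hm (by simpa using hp) (by simp)]
  have h1 : Integrable (fun t : ℝ => Real.exp (p * t))
      (gaussianReal 0 (S.inner0 ξ ξ).toNNReal) := integrable_exp_mul_gaussianReal _
  rw [← S.map_eval μ ξ, integrable_map_measure (by fun_prop) (measurable_eval ξ).aemeasurable] at h1
  refine h1.congr (Eventually.of_forall fun x => ?_)
  simp only [Function.comp, ENNReal.coe_toReal, Real.norm_eq_abs, Real.abs_exp]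
  rw [← Real.exp_mul, mul_comm]

/-- The Wick monomial recentred at `ξ ∈ E_c`, that is, evaluated at `x - ξ`. -/
def wickAt (ξ : Complexification E) (n : ℕ) (η : Fin n → E) (x : DualSpace E) : ℂ :=
  wickRec (fun e => (x e : ℂ) - S.pairC ξ (ofR e)) S.inner0 n η

theorem wickAt_zero (n : ℕ) (η : Fin n → E) (x : DualSpace E) :
    S.wickAt 0 n η x = (S.wick n η x : ℂ) := by
  have h0 : ∀ e : E, S.pairC 0 (ofR e) = 0 := fun e => by
    simpa using S.pairC_smul_left 0 0 (ofR e)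
  simp only [wickAt, h0, sub_zero]
  induction n using Nat.strong_induction_on with
  | _ n ih =>
    match n, η, ih with
    | 0, η, _ => simp [wickRec, wick]
    | 1, η, _ => simp [wickRec, wick]
    | n + 2, η, ih =>
      rw [wickRec, wick, ih (n + 1) (by omega)]
      push_cast
      congr 1
      exact Finset.sum_congr rfl fun j _ => by rw [ih n (by omega)]

theorem measurable_evalC (ξ : Complexification E) :
    Measurable (fun x : DualSpace E => evalC x ξ) := by
  unfold evalC
  exact (Complex.measurable_ofReal.comp (measurable_eval ξ.re)).add
    ((Complex.measurable_ofReal.comp (measurable_eval ξ.im)).const_mul _)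

theorem measurable_wickExp (ξ : Complexification E) : Measurable (S.wickExp ξ) := by
  have : S.wickExp ξ = fun x => Complex.exp (evalC x ξ - S.pairC ξ ξ / 2) :=
    funext fun x => S.wickExp_eq ξ x
  rw [this]
  have h1 := measurable_evalC ξ
  fun_prop

theorem measurable_wickAt (ξ : Complexification E) (n : ℕ) (η : Fin n → E) :
    Measurable (S.wickAt ξ n η) := by
  have hX : ∀ e : E, Measurable (fun x : DualSpace E => (x e : ℂ) - S.pairC ξ (ofR e)) :=
    fun e => (Complex.measurable_ofReal.comp (measurable_eval e)).sub_const _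
  induction n using Nat.strong_induction_on with
  | _ n ih =>
    match n, η, ih with
    | 0, η, _ => exact measurable_const
    | 1, η, _ => exact hX (η 0)
    | n + 2, η, ih =>
      refine ((hX (η 0)).mul (ih (n + 1) (by omega) _)).sub ?_
      exact Finset.measurable_fun_sum _ fun j _ => (ih n (by omega) _).const_mul _

/-- A bound for recentred Wick monomials that is locally uniform in the base point. -/
theorem exists_bound_wickAt (ξ ζ : Complexification E) (n : ℕ) (η : Fin n → E) :
    ∃ g : DualSpace E → ℝ, HasAllMoments μ g ∧
      ∀ (x : DualSpace E) (z : ℂ), ‖z‖ ≤ 1 → ‖S.wickAt (ξ + z • ζ) n η x‖ ≤ g x := by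
  have := hμ.prob
  have hX : ∀ (e : E) (x : DualSpace E) (z : ℂ), ‖z‖ ≤ 1 →
      ‖(x e : ℂ) - S.pairC (ξ + z • ζ) (ofR e)‖ ≤
        |x e| + (‖S.pairC ξ (ofR e)‖ + ‖S.pairC ζ (ofR e)‖) := by
    intro e x z hz
    rw [pairC_add_left, pairC_smul_left]
    refine (norm_sub_le _ _).trans (add_le_add (by simp) ((norm_add_le _ _).trans ?_))
    gcongr
    rw [norm_mul]
    exact mul_le_of_le_one_left (norm_nonneg _) hz
  have hXm : ∀ e : E, HasAllMoments μ (fun x : DualSpace E =>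
      |x e| + (‖S.pairC ξ (ofR e)‖ + ‖S.pairC ζ (ofR e)‖)) := fun e =>
    (S.hasAllMoments_eval μ e).abs.add (HasAllMoments.const _)
  induction n using Nat.strong_induction_on with
  | _ n ih =>
    match n, η, ih with
    | 0, η, _ => exact ⟨fun _ => 1, HasAllMoments.const 1, fun x z _ => by simp [wickAt, wickRec]⟩
    | 1, η, _ => exact ⟨_, hXm (η 0), fun x z hz => hX (η 0) x z hz⟩
    | n + 2, η, ih =>
      obtain ⟨g, hg, hgb⟩ := ih (n + 1) (by omega) (fun k => η k.succ)
      have h2 : ∀ j : Fin (n + 1), ∃ g : DualSpace E → ℝ, HasAllMoments μ g ∧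
          ∀ (x : DualSpace E) (z : ℂ), ‖z‖ ≤ 1 →
            ‖S.wickAt (ξ + z • ζ) n (fun k => η (j.succAbove k).succ) x‖ ≤ g x :=
        fun j => ih n (by omega) _
      choose h hh hhb using h2
      refine ⟨_, ((hXm (η 0)).mul hg).add (HasAllMoments.sum Finset.univ
        fun j => (hh j).const_mul ‖(S.inner0 (η 0) (η j.succ) : ℂ)‖), fun x z hz => ?_⟩
      refine (norm_sub_le _ _).trans (add_le_add ?_ ((norm_sum_le _ _).trans
        (Finset.sum_le_sum fun j _ => ?_)))
      · rw [norm_mul]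
        exact mul_le_mul (hX _ _ _ hz) (hgb x z hz) (norm_nonneg _)
          (by positivity)
      · rw [norm_mul]
        exact mul_le_mul_of_nonneg_left (hhb j x z hz) (norm_nonneg _)

theorem norm_wickExp (ξ : Complexification E) (x : DualSpace E) :
    ‖S.wickExp ξ x‖ = Real.exp (x ξ.re - (S.pairC ξ ξ).re / 2) := by
  rw [wickExp_eq, Complex.norm_exp]
  simp [evalC]

/-- A bound for renormalized exponentials that is locally uniform in the parameter. -/
theorem exists_bound_wickExp (ξ ζ : Complexification E) :
    ∃ g : DualSpace E → ℝ, HasAllMoments μ g ∧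
      ∀ (x : DualSpace E) (z : ℂ), ‖z‖ ≤ 1 → ‖S.wickExp (ξ + z • ζ) x‖ ≤ g x := by
  have := hμ.prob
  set C : ℝ := ‖S.pairC ξ ξ‖ + 2 * ‖S.pairC ξ ζ‖ + ‖S.pairC ζ ζ‖ with hC
  have hsymm : ∀ e : E, HasAllMoments μ
      (fun x : DualSpace E => Real.exp (x e) + Real.exp (x (-e))) := fun e =>
    (S.hasAllMoments_exp μ e).add (S.hasAllMoments_exp μ (-e))
  refine ⟨_, (((S.hasAllMoments_exp μ ξ.re).mul (hsymm ζ.re)).mul (hsymm ζ.im)).const_mul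
    (Real.exp C), fun x z hz => ?_⟩
  rw [norm_wickExp, mul_comm]
  have habs : ∀ t s : ℝ, |s| ≤ 1 → Real.exp (s * t) ≤ Real.exp t + Real.exp (-t) := by
    intro t s hs
    have h1 : s * t ≤ |t| := by
      calc s * t ≤ |s * t| := le_abs_self _
        _ = |s| * |t| := abs_mul _ _
        _ ≤ 1 * |t| := by gcongr
        _ = |t| := one_mul _
    refine (Real.exp_le_exp.2 h1).trans ?_
    rcases abs_cases t with ⟨h, _⟩ | ⟨h, _⟩ <;> rw [h]
    · linarith [Real.exp_pos (-t)]
    · linarith [Real.exp_pos t]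
  have h1 : x (ξ + z • ζ).re = x ξ.re + z.re * x ζ.re + (-z.im) * x ζ.im := by
    simp only [re_add, re_smul, dual_add, dual_sub, dual_smul]
    ring
  have h2 : -(S.pairC (ξ + z • ζ) (ξ + z • ζ)).re / 2 ≤ C := by
    have h3 : ‖S.pairC (ξ + z • ζ) (ξ + z • ζ)‖ ≤ C := by
      have h4 : S.pairC (ξ + z • ζ) (ξ + z • ζ) =
          S.pairC ξ ξ + 2 * z * S.pairC ξ ζ + z ^ 2 * S.pairC ζ ζ := by
        simp only [pairC_add_left, pairC_add_right, pairC_smul_left, pairC_smul_right]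
        rw [S.pairC_comm ζ ξ]
        ring
      rw [h4]
      refine (norm_add₃_le).trans ?_
      simp only [norm_mul, norm_pow, hC, Complex.norm_ofNat]
      have hz2 : ‖z‖ ^ 2 ≤ 1 := pow_le_one₀ (norm_nonneg _) hz
      have e1 := norm_nonneg (S.pairC ξ ζ)
      have e2 := norm_nonneg (S.pairC ζ ζ)
      nlinarith
    have h5 := (Complex.abs_re_le_norm (S.pairC (ξ + z • ζ) (ξ + z • ζ)))
    have h6 := neg_abs_le (S.pairC (ξ + z • ζ) (ξ + z • ζ)).re
    have hC0 : 0 ≤ C := (norm_nonneg _).trans h3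
    linarith
  rw [h1, sub_eq_add_neg, Real.exp_add, Real.exp_add, Real.exp_add, ← neg_div]
  have h7 := habs (x ζ.re) z.re ((Complex.abs_re_le_norm z).trans hz)
  have h8 := habs (x ζ.im) (-z.im) (by rw [abs_neg]; exact (Complex.abs_im_le_norm z).trans hz)
  rw [dual_neg, dual_neg]
  gcongr

theorem memLp_wickExp (ξ : Complexification E) : MemLp (S.wickExp ξ) 2 μ := by
  obtain ⟨g, hg, hb⟩ := S.exists_bound_wickExp μ ξ 0
  refine hg.memLp_two.mono' (S.measurable_wickExp ξ).aestronglyMeasurable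
    (Eventually.of_forall fun x => ?_)
  simpa using hb x 0 (by simp)

/-! ### The `S`-transform of a square integrable function -/

/-- Differentiating a recentred Wick monomial times a renormalized exponential. -/
theorem hasDerivAt_wickAt_mul_wickExp (ξ ζ : Complexification E) (n : ℕ) (η : Fin n → E)
    (x : DualSpace E) (z : ℂ) :
    HasDerivAt (fun z : ℂ => S.wickAt (ξ + z • ζ) n η x * S.wickExp (ξ + z • ζ) x)
      (((evalC x ζ - S.pairC (ξ + z • ζ) ζ) * S.wickAt (ξ + z • ζ) n η x -
        contr (fun e => S.pairC ζ (ofR e)) (fun n η => S.wickAt (ξ + z • ζ) n η x) n η) *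
          S.wickExp (ξ + z • ζ) x) z := by
  have h1 := hasDerivAt_wickRec (fun e => (x e : ℂ) - S.pairC ξ (ofR e))
    (fun e => S.pairC ζ (ofR e)) S.inner0 n η z
  have e1 : ∀ (z : ℂ), (fun e : E => (x e : ℂ) - S.pairC ξ (ofR e) - z * S.pairC ζ (ofR e)) =
      fun e => (x e : ℂ) - S.pairC (ξ + z • ζ) (ofR e) := by
    intro z
    funext e
    rw [pairC_add_left, pairC_smul_left]
    ring
  simp only [e1] at h1
  have h2 : HasDerivAt (fun z : ℂ => S.wickExp (ξ + z • ζ) x)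
      ((evalC x ζ - S.pairC (ξ + z • ζ) ζ) * S.wickExp (ξ + z • ζ) x) z := by
    have e2 : ∀ z : ℂ, S.wickExp (ξ + z • ζ) x = Complex.exp (evalC x ξ + z * evalC x ζ -
        (S.pairC ξ ξ + 2 * z * S.pairC ξ ζ + z ^ 2 * S.pairC ζ ζ) / 2) := by
      intro z
      rw [wickExp_eq]
      congr 1
      simp only [evalC_add, evalC_smul, pairC_add_left, pairC_add_right, pairC_smul_left,
        pairC_smul_right]
      rw [S.pairC_comm ζ ξ]
      ring
    simp only [e2]
    have h3 : HasDerivAt (fun z : ℂ => evalC x ξ + z * evalC x ζ -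
        (S.pairC ξ ξ + 2 * z * S.pairC ξ ζ + z ^ 2 * S.pairC ζ ζ) / 2)
        (evalC x ζ - S.pairC (ξ + z • ζ) ζ) z := by
      have a1 := ((hasDerivAt_id z).mul_const (evalC x ζ)).const_add (evalC x ξ)
      have a2 := (((hasDerivAt_id z).const_mul 2).mul_const (S.pairC ξ ζ)).const_add (S.pairC ξ ξ)
      have a3 := ((hasDerivAt_pow 2 z).mul_const (S.pairC ζ ζ))
      refine (a1.sub ((a2.add a3).div_const 2)).congr_deriv ?_
      rw [pairC_add_left, pairC_smul_left]
      simp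
      ring
    exact h3.cexp.congr_deriv (by ring)
  refine (h1.mul h2).congr_deriv ?_
  simp only [wickAt]
  ring

/-- The pairing of `ψ ∈ (L²)` with recentred Wick monomials times renormalized exponentials may be
differentiated under the integral sign. -/
theorem hasDerivAt_integral_wickAt {ψ : DualSpace E → ℂ} (hψ : MemLp ψ 2 μ)
    (ξ ζ : Complexification E) (n : ℕ) (η : Fin n → E) :
    HasDerivAt (fun z : ℂ => ∫ x, ψ x * (S.wickAt (ξ + z • ζ) n η x * S.wickExp (ξ + z • ζ) x) ∂μ)
      (∫ x, ψ x * (((evalC x ζ - S.pairC ξ ζ) * S.wickAt ξ n η x -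
        contr (fun e => S.pairC ζ (ofR e)) (fun n η => S.wickAt ξ n η x) n η) *
          S.wickExp ξ x) ∂μ) 0 := by
  have := hμ.prob
  obtain ⟨g, hg, hgb⟩ := S.exists_bound_wickAt μ ξ ζ n η
  obtain ⟨e, he, heb⟩ := S.exists_bound_wickExp μ ξ ζ
  obtain ⟨c, hc, hcb⟩ : ∃ c : DualSpace E → ℝ, HasAllMoments μ c ∧ ∀ (x : DualSpace E) (z : ℂ),
      ‖z‖ ≤ 1 → ‖contr (fun e => S.pairC ζ (ofR e))
        (fun n η => S.wickAt (ξ + z • ζ) n η x) n η‖ ≤ c x := by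
    cases n with
    | zero => exact ⟨fun _ => 0, HasAllMoments.const 0, fun x z _ => by simp [contr]⟩
    | succ n =>
      have h := fun j : Fin (n + 1) =>
        S.exists_bound_wickAt μ ξ ζ n (fun k => η (j.succAbove k))
      choose h hh hhb using h
      refine ⟨_, HasAllMoments.sum Finset.univ
        fun j => (hh j).const_mul ‖S.pairC ζ (ofR (η j))‖, fun x z hz => ?_⟩
      refine (norm_sum_le _ _).trans (Finset.sum_le_sum fun j _ => ?_)
      rw [norm_mul]
      exact mul_le_mul_of_nonneg_left (hhb j x z hz) (norm_nonneg _)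
  have hv : HasAllMoments μ (fun x : DualSpace E => |x ζ.re| + |x ζ.im| +
      (‖S.pairC ξ ζ‖ + ‖S.pairC ζ ζ‖)) :=
    ((S.hasAllMoments_eval μ _).abs.add (S.hasAllMoments_eval μ _).abs).add
      (HasAllMoments.const _)
  have hvb : ∀ (x : DualSpace E) (z : ℂ), ‖z‖ ≤ 1 → ‖evalC x ζ - S.pairC (ξ + z • ζ) ζ‖ ≤
      |x ζ.re| + |x ζ.im| + (‖S.pairC ξ ζ‖ + ‖S.pairC ζ ζ‖) := by
    intro x z hz
    refine (norm_sub_le _ _).trans (add_le_add ?_ ?_)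
    · refine (norm_add_le _ _).trans (by simp)
    · rw [pairC_add_left, pairC_smul_left]
      refine (norm_add_le _ _).trans ?_
      gcongr
      rw [norm_mul]
      exact mul_le_of_le_one_left (norm_nonneg _) hz
  have hmeas : ∀ (ξ : Complexification E), AEStronglyMeasurable
      (fun x => ψ x * (S.wickAt ξ n η x * S.wickExp ξ x)) μ := fun ξ =>
    hψ.aestronglyMeasurable.mul
      ((S.measurable_wickAt ξ n η).mul (S.measurable_wickExp ξ)).aestronglyMeasurable
  have hcm : Measurable (fun x : DualSpace E =>
      contr (fun e => S.pairC ζ (ofR e)) (fun n η => S.wickAt ξ n η x) n η) := by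
    cases n with
    | zero => exact measurable_const
    | succ n =>
      exact Finset.measurable_fun_sum _ fun j _ => (S.measurable_wickAt ξ n _).const_mul _
  have key := hasDerivAt_integral_of_dominated_loc_of_deriv_le (μ := μ) (𝕜 := ℂ)
    (F := fun (z : ℂ) x => ψ x * (S.wickAt (ξ + z • ζ) n η x * S.wickExp (ξ + z • ζ) x))
    (F' := fun (z : ℂ) x => ψ x * (((evalC x ζ - S.pairC (ξ + z • ζ) ζ) *
      S.wickAt (ξ + z • ζ) n η x -
        contr (fun e => S.pairC ζ (ofR e)) (fun n η => S.wickAt (ξ + z • ζ) n η x) n η) *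
          S.wickExp (ξ + z • ζ) x)) (x₀ := 0) (s := Metric.ball 0 1)
    (bound := fun x => ‖ψ x‖ * (((|x ζ.re| + |x ζ.im| +
      (‖S.pairC ξ ζ‖ + ‖S.pairC ζ ζ‖)) * g x + c x) * e x))
    (Metric.ball_mem_nhds _ one_pos) (Eventually.of_forall fun z => hmeas _) ?_ ?_ ?_ ?_ ?_
  · simpa using key.2
  · refine ((hg.mul he).integrable_norm_mul hψ).mono' (hmeas _) (Eventually.of_forall fun x => ?_)
    rw [norm_mul, norm_mul]
    exact mul_le_mul_of_nonneg_left (mul_le_mul (hgb x 0 (by simp)) (heb x 0 (by simp))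
      (norm_nonneg _) ((norm_nonneg _).trans (hgb x 0 (by simp)))) (norm_nonneg _)
  · simp only [zero_smul, add_zero]
    refine hψ.aestronglyMeasurable.mul (Measurable.aestronglyMeasurable ?_)
    exact ((((measurable_evalC ζ).sub_const _).mul (S.measurable_wickAt ξ n η)).sub hcm).mul
      (S.measurable_wickExp ξ)
  · refine Eventually.of_forall fun x z hz => ?_
    have hz' : ‖z‖ ≤ 1 := by
      have : ‖z‖ < 1 := by simpa using hz
      exact this.le
    have hg0 : 0 ≤ g x := (norm_nonneg _).trans (hgb x z hz')
    have hc0 : 0 ≤ c x := (norm_nonneg _).trans (hcb x z hz')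
    rw [norm_mul, norm_mul]
    refine mul_le_mul_of_nonneg_left (mul_le_mul ((norm_sub_le _ _).trans (add_le_add ?_
      (hcb x z hz'))) (heb x z hz') (norm_nonneg _) (by positivity)) (norm_nonneg _)
    rw [norm_mul]
    exact mul_le_mul (hvb x z hz') (hgb x z hz') (norm_nonneg _) (by positivity)
  · exact (((((hv.mul hg).add hc).mul he).integrable_norm_mul hψ))
  · exact Eventually.of_forall fun x z _ =>
      (S.hasDerivAt_wickAt_mul_wickExp ξ ζ n η x z).const_mul (ψ x)

/-- The `S`-transform of a function. -/
def sTransform (ψ : DualSpace E → ℂ) (ξ : Complexification E) : ℂ := ∫ x, ψ x * S.wickExp ξ x ∂μ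

theorem differentiable_sTransform {ψ : DualSpace E → ℂ} (hψ : MemLp ψ 2 μ)
    (ξ ζ : Complexification E) : Differentiable ℂ (fun z : ℂ => S.sTransform μ ψ (ξ + z • ζ)) := by
  intro z
  have h := S.hasDerivAt_integral_wickAt μ hψ (ξ + z • ζ) ζ 0 Fin.elim0
  have h2 : DifferentiableAt ℂ (fun w : ℂ => S.sTransform μ ψ (ξ + z • ζ + w • ζ)) (z - z) := by
    rw [sub_self]
    simpa [wickAt, wickRec, sTransform] using h.differentiableAt
  have hs : DifferentiableAt ℂ (fun w : ℂ => w - z) z := by fun_prop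
  have h3 := DifferentiableAt.comp z (f := fun w : ℂ => w - z) h2 hs
  refine h3.congr_of_eventuallyEq (Eventually.of_forall fun w => ?_)
  simp only [Function.comp]
  congr 1
  rw [sub_smul]
  abel

/-- The renormalized exponentials have integral one. -/
theorem integral_wickExp (ξ : Complexification E) : ∫ x, S.wickExp ξ x ∂μ = 1 := by
  have := hμ.prob
  -- by analytic continuation from the purely imaginary case, which is the characteristic functional
  have hψ : MemLp (fun _ : DualSpace E => (1 : ℂ)) 2 μ := memLp_const 1
  set f : ℂ → ℂ := fun z => S.sTransform μ (fun _ => (1 : ℂ))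
    (Complex.I • ofR ξ.im + z • ofR ξ.re) with hf
  have hd : Differentiable ℂ f := S.differentiable_sTransform μ hψ _ _
  have him : ∀ t : ℝ, f (t * Complex.I) = 1 := by
    intro t
    have h1 : Complex.I • ofR ξ.im + ((t : ℂ) * Complex.I) • ofR ξ.re =
        Complex.I • ofR (ξ.im + t • ξ.re) := by
      ext <;> simp
    simp only [hf, sTransform, one_mul, h1]
    set b := ξ.im + t • ξ.re
    have h2 : ∀ x : DualSpace E, S.wickExp (Complex.I • ofR b) x =
        Complex.exp (((x b : ℝ) : ℂ) * Complex.I) * Complex.exp ((S.inner0 b b : ℂ) / 2) := by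
      intro x
      rw [wickExp_eq, evalC_smul, evalC_ofR, pairC_smul_left, pairC_smul_right, pairC_ofR,
        ← Complex.exp_add]
      congr 1
      linear_combination (-(S.inner0 b b : ℂ) / 2) * Complex.I_mul_I
    simp only [h2]
    rw [integral_mul_const, hμ.charFun b, ← Complex.exp_add]
    simp [neg_div]
  have h1 : f = fun _ => 1 := by
    have ha : AnalyticOnNhd ℂ f Set.univ := hd.differentiableOn.analyticOnNhd isOpen_univ
    have hb : AnalyticOnNhd ℂ (fun _ : ℂ => (1 : ℂ)) Set.univ := analyticOnNhd_const
    refine ha.eq_of_frequently_eq (z₀ := 0) hb ?_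
    have ht : Tendsto (fun t : ℝ => (t : ℂ) * Complex.I) (𝓝[≠] 0) (𝓝[≠] 0) := by
      refine tendsto_nhdsWithin_iff.2 ⟨?_, ?_⟩
      · have : Continuous fun t : ℝ => (t : ℂ) * Complex.I := by fun_prop
        have h0 := this.tendsto 0
        simp only [Complex.ofReal_zero, zero_mul] at h0
        exact h0.mono_left nhdsWithin_le_nhds
      · filter_upwards [self_mem_nhdsWithin] with t ht
        simpa using ht
    exact ht.frequently (Eventually.of_forall him).frequently
  have h2 := congrFun h1 1
  simp only [hf, sTransform, one_mul, one_smul] at h2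
  rw [add_comm, ← eq_ofR_add] at h2
  exact h2

theorem sTransform_wickExp (ξ η : Complexification E) :
    S.sTransform μ (S.wickExp ξ) η = Complex.exp (S.pairC ξ η) := by
  simp only [sTransform, wickExp_mul]
  rw [integral_const_mul, S.integral_wickExp μ, mul_one]

/-- The `L²` norms of the renormalized exponentials. -/
theorem integral_norm_sq_wickExp (ξ : Complexification E) :
    ∫ x, ‖S.wickExp ξ x‖ ^ 2 ∂μ = Real.exp (S.inner0 ξ.re ξ.re + S.inner0 ξ.im ξ.im) := by
  have h := S.sTransform_wickExp μ ξ ξ.conj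
  have h1 : ∀ x, S.wickExp ξ x * S.wickExp ξ.conj x = ((‖S.wickExp ξ x‖ ^ 2 : ℝ) : ℂ) := by
    intro x
    rw [← conj_wickExp, Complex.mul_conj, Complex.normSq_eq_norm_sq]
  simp only [sTransform, h1] at h
  rw [integral_complex_ofReal] at h
  have h2 : S.pairC ξ ξ.conj = ((S.inner0 ξ.re ξ.re + S.inner0 ξ.im ξ.im : ℝ) : ℂ) := by
    have a1 : S.inner0 ξ.im (-ξ.im) = -S.inner0 ξ.im ξ.im := by simp [inner0]
    have a2 : S.inner0 ξ.re (-ξ.im) = -S.inner0 ξ.re ξ.im := by simp [inner0]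
    simp only [pairC, re_conj, im_conj, a1, a2, S.inner0_comm ξ.im ξ.re]
    simp
  rw [h2, ← Complex.ofReal_exp] at h
  exact_mod_cast h

end HilbertNorms

namespace Complexification

variable {E : Type*} [AddCommGroup E] [Module ℝ E]

/-! ### Hilbertian norms on the complexification -/

section Norm

variable {H : Type*} [NormedAddCommGroup H] [InnerProductSpace ℝ H]

/-- The Hilbertian norm on `E_c` that extends the norm `ξ ↦ ‖L ξ‖` of `E`. -/
def normC (L : E →ₗ[ℝ] H) (ξ : Complexification E) : ℝ :=
  ‖(WithLp.toLp 2 (L ξ.re, L ξ.im) : WithLp 2 (H × H))‖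

theorem normC_sq (L : E →ₗ[ℝ] H) (ξ : Complexification E) :
    normC L ξ ^ 2 = ‖L ξ.re‖ ^ 2 + ‖L ξ.im‖ ^ 2 :=
  WithLp.prod_norm_sq_eq_of_L2 _

theorem normC_nonneg (L : E →ₗ[ℝ] H) (ξ : Complexification E) : 0 ≤ normC L ξ := norm_nonneg _

theorem normC_add_le (L : E →ₗ[ℝ] H) (ξ η : Complexification E) :
    normC L (ξ + η) ≤ normC L ξ + normC L η := by
  have : (WithLp.toLp 2 (L (ξ + η).re, L (ξ + η).im) : WithLp 2 (H × H)) =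
      WithLp.toLp 2 (L ξ.re, L ξ.im) + WithLp.toLp 2 (L η.re, L η.im) := by
    rw [← WithLp.toLp_add]
    simp
  rw [normC, this]
  exact norm_add_le _ _

theorem normC_smul (L : E →ₗ[ℝ] H) (z : ℂ) (ξ : Complexification E) :
    normC L (z • ξ) = ‖z‖ * normC L ξ := by
  rw [← sq_eq_sq₀ (normC_nonneg _ _) (mul_nonneg (norm_nonneg _) (normC_nonneg _ _)), mul_pow,
    normC_sq, normC_sq, ← Complex.normSq_eq_norm_sq, Complex.normSq_apply]
  simp only [re_smul, im_smul, map_add, map_sub, map_smul]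
  rw [norm_sub_sq_real, norm_add_sq_real]
  simp only [norm_smul, inner_smul_left, inner_smul_right, mul_pow, Real.norm_eq_abs, sq_abs,
    RCLike.conj_to_real, real_inner_comm (L ξ.im)]
  ring

theorem normC_ofR (L : E →ₗ[ℝ] H) (η : E) : normC L (ofR η) = ‖L η‖ := by
  rw [← sq_eq_sq₀ (normC_nonneg _ _) (norm_nonneg _), normC_sq]
  simp

theorem normC_zero (L : E →ₗ[ℝ] H) : normC L 0 = 0 := by
  have := normC_smul L 0 0
  simpa using this

theorem normC_sum_le (L : E →ₗ[ℝ] H) {ι : Type*} (s : Finset ι) (z : ι → ℂ)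
    (v : ι → Complexification E) :
    normC L (∑ i ∈ s, z i • v i) ≤ ∑ i ∈ s, ‖z i‖ * normC L (v i) := by
  classical
  induction s using Finset.induction_on with
  | empty => simp [normC_zero]
  | insert a s ha ih =>
    rw [Finset.sum_insert ha, Finset.sum_insert ha]
    refine (normC_add_le _ _ _).trans ?_
    rw [normC_smul]
    gcongr

/-- A function that is controlled by a Hilbertian norm is bounded on polydiscs. -/
theorem exists_normC_le (L : E →ₗ[ℝ] H) {n : ℕ} (v : Fin n → Complexification E)
    (ξ : Complexification E) (R : ℝ) :
    ∃ M : ℝ, ∀ z : Fin n → ℂ, (∀ i, ‖z i‖ ≤ R) → normC L (ξ + ∑ i, z i • v i) ≤ M := by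
  refine ⟨normC L ξ + ∑ i, R * normC L (v i), fun z hz => (normC_add_le _ _ _).trans ?_⟩
  gcongr
  refine (normC_sum_le _ _ _ _).trans (Finset.sum_le_sum fun i _ => ?_)
  exact mul_le_mul_of_nonneg_right (hz i) (normC_nonneg _ _)

end Norm

end Complexification

/-! ### Kernels as derivatives of the `S`-transform -/

namespace HilbertNorms

open Complexification

variable {E : Type*} [AddCommGroup E] [Module ℝ E] [TopologicalSpace E] (S : HilbertNorms E)
  (μ : Measure (DualSpace E)) [hμ : S.IsStandardGaussian μ]

/-- The `S`-transform of a square integrable function is entire; its bound comes from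
`2|ab| ≤ |a|² + |b|²` and the explicit `L²` norm of `:e^{⟨·, ξ⟩}:`. -/
theorem gateauxEntire_sTransform {ψ : DualSpace E → ℂ} (hψ : MemLp ψ 2 μ) :
    GateauxEntire (S.sTransform μ ψ) where
  differentiable := S.differentiable_sTransform μ hψ
  bounded n v ξ R := by
    obtain ⟨M, hM⟩ := exists_normC_le (S.toEp 0) v ξ R
    refine ⟨(∫ x, ‖ψ x‖ ^ 2 ∂μ) + Real.exp (M ^ 2), fun z hz => ?_⟩
    set ζ := ξ + ∑ i, z i • v i
    have h1 : Integrable (fun x => ‖ψ x‖ ^ 2) μ := hψ.integrable_norm_pow two_ne_zero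
    have h2 : Integrable (fun x => ‖S.wickExp ζ x‖ ^ 2) μ :=
      (S.memLp_wickExp μ ζ).integrable_norm_pow two_ne_zero
    calc ‖S.sTransform μ ψ ζ‖ ≤ ∫ x, ‖ψ x‖ ^ 2 + ‖S.wickExp ζ x‖ ^ 2 ∂μ := by
          refine norm_integral_le_of_norm_le (h1.add h2) (Eventually.of_forall fun x => ?_)
          rw [norm_mul]
          nlinarith [sq_nonneg (‖ψ x‖ - ‖S.wickExp ζ x‖), norm_nonneg (ψ x),
            norm_nonneg (S.wickExp ζ x), mul_nonneg (norm_nonneg (ψ x))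
              (norm_nonneg (S.wickExp ζ x))]
      _ = (∫ x, ‖ψ x‖ ^ 2 ∂μ) + Real.exp (normC (S.toEp 0) ζ ^ 2) := by
          rw [integral_add h1 h2, S.integral_norm_sq_wickExp μ, normC_sq]
          simp only [inner0, real_inner_self_eq_norm_sq]
      _ ≤ _ := by
          gcongr
          · exact normC_nonneg _ _
          · exact hM z hz

/-- Each derivative of the `S`-transform in a real direction `η` multiplies the Wick monomial
under the integral by `⟨x - ξ, η⟩` and subtracts its contraction with `η`, which is the recursion
for Wick monomials. -/
theorem iterDir_sTransform {ψ : DualSpace E → ℂ} (hψ : MemLp ψ 2 μ) (n : ℕ) (η : Fin n → E) :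
    iterDir (S.sTransform μ ψ) (List.ofFn fun k => ofR (η k)) =
      fun ξ => ∫ x, ψ x * (S.wickAt ξ n η x * S.wickExp ξ x) ∂μ := by
  induction n with
  | zero =>
    funext ξ
    simp [iterDir, sTransform, wickAt, wickRec]
  | succ n ih =>
    rw [List.ofFn_succ, iterDir, ih]
    funext ξ
    rw [dirDeriv, (S.hasDerivAt_integral_wickAt μ hψ ξ (ofR (η 0)) n fun k => η k.succ).deriv]
    congr 1
    funext x
    congr 2
    simp only [wickAt]
    rw [wickRec_succ, evalC_ofR]
    simp only [pairC_ofR]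

theorem wickExp_zero (x : DualSpace E) : S.wickExp 0 x = 1 := by
  rw [wickExp_eq]
  have h1 : S.pairC 0 0 = 0 := by simpa using S.pairC_smul_left 0 0 0
  have h2 : evalC x (0 : Complexification E) = 0 := by simpa using evalC_smul x 0 0
  simp [h1, h2]

/-- The Wick monomials are the derivatives at `0` of the renormalized exponentials. -/
theorem derivForm_sTransform {ψ : DualSpace E → ℂ} (hψ : MemLp ψ 2 μ) (n : ℕ) (η : Fin n → E) :
    (S.gateauxEntire_sTransform μ hψ).derivForm n (fun k => ofR (η k)) =
      ∫ x, ψ x * (S.wick n η x : ℂ) ∂μ := by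
  rw [GateauxEntire.derivForm_apply, S.iterDir_sTransform μ hψ]
  simp only [wickAt_zero, wickExp_zero, mul_one]

/-- The derivatives at `0` of a Gateaux-entire function on `E_c`, divided by `n!`, as `n`-linear
forms on `E`. -/
def taylorForm {F : Complexification E → ℂ} (hF : GateauxEntire F) (n : ℕ) :
    MultilinearMap ℝ (fun _ : Fin n => E) ℂ :=
  ((n.factorial : ℂ))⁻¹ • ((hF.derivForm n).restrictScalars ℝ).compLinearMap (fun _ => ofR)

omit [TopologicalSpace E] in
theorem taylorForm_apply {F : Complexification E → ℂ} (hF : GateauxEntire F) (n : ℕ)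
    (η : Fin n → E) :
    taylorForm hF n η = ((n.factorial : ℂ))⁻¹ * hF.derivForm n (fun k => ofR (η k)) := rfl

/-- The kernels of a square integrable function are the Taylor coefficients of its
`S`-transform. In particular they are multilinear. -/
theorem kernel_eq_taylorForm (φ : Lp ℂ 2 μ) (n : ℕ) :
    S.kernel μ φ n = taylorForm (S.gateauxEntire_sTransform μ (Lp.memLp φ)) n := by
  funext η
  rw [taylorForm_apply, S.derivForm_sTransform μ (Lp.memLp φ), kernel]
  simp

theorem kernel_comp_perm (φ : Lp ℂ 2 μ) (n : ℕ) (η : Fin n → E) (σ : Equiv.Perm (Fin n)) :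
    S.kernel μ φ n (η ∘ σ) = S.kernel μ φ n η := by
  rw [kernel_eq_taylorForm, taylorForm_apply, taylorForm_apply]
  congr 1
  exact GateauxEntire.derivForm_comp_perm _ n (fun k => ofR (η k)) σ

theorem iterDir_exp_pairC (ξ : Complexification E) (n : ℕ) (η : Fin n → Complexification E) :
    iterDir (fun ζ => Complex.exp (S.pairC ξ ζ)) (List.ofFn η) =
      fun ζ => (∏ k, S.pairC ξ (η k)) * Complex.exp (S.pairC ξ ζ) := by
  induction n with
  | zero => simp [iterDir]
  | succ n ih =>
    rw [List.ofFn_succ, iterDir, ih]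
    funext ζ
    rw [dirDeriv, Fin.prod_univ_succ]
    have h : HasDerivAt (fun z : ℂ => S.pairC ξ (ζ + z • η 0)) (S.pairC ξ (η 0)) 0 := by
      simp only [pairC_add_right, pairC_smul_right]
      simpa using ((hasDerivAt_id (0 : ℂ)).mul_const (S.pairC ξ (η 0))).const_add (S.pairC ξ ζ)
    rw [(h.cexp.const_mul _).deriv]
    simp
    ring

/-- The kernels of a renormalized exponential are the tensor powers of its parameter. -/
theorem integral_wickExp_mul_wick (ξ : Complexification E) (n : ℕ) (η : Fin n → E) :
    ∫ x, S.wickExp ξ x * (S.wick n η x : ℂ) ∂μ = ∏ k, S.pairC ξ (ofR (η k)) := by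
  rw [← S.derivForm_sTransform μ (S.memLp_wickExp μ ξ), GateauxEntire.derivForm_apply]
  have h : S.sTransform μ (S.wickExp ξ) = fun ζ => Complex.exp (S.pairC ξ ζ) :=
    funext (S.sTransform_wickExp μ ξ)
  rw [h, iterDir_exp_pairC]
  have h1 : S.pairC ξ 0 = 0 := by simpa using S.pairC_smul_right 0 0 ξ
  simp [h1]

/-! ### Totality of the renormalized exponentials -/

/-- Finite measures on `E'` are determined by their characteristic functionals. -/
theorem ext_of_charFunctional {ν₁ ν₂ : Measure (DualSpace E)} [IsFiniteMeasure ν₁]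
    [IsFiniteMeasure ν₂]
    (h : ∀ ξ : E, ∫ x : DualSpace E, Complex.exp (((x ξ : ℝ) : ℂ) * Complex.I) ∂ν₁ =
      ∫ x : DualSpace E, Complex.exp (((x ξ : ℝ) : ℂ) * Complex.I) ∂ν₂) : ν₁ = ν₂ := by
  classical
  set ι : DualSpace E → E → ℝ := fun x ξ => x ξ with hι
  have hιm : Measurable ι := measurable_pi_lambda _ fun ξ => measurable_eval ξ
  have hmarg : ∀ I : Finset E, (ν₁.map ι).map I.restrict = (ν₂.map ι).map I.restrict := by
    intro I
    have hI : Measurable (I.restrict (π := fun _ : E => ℝ)) := Finset.measurable_restrict I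
    refine Measure.ext_of_charFunDual ?_
    funext L
    rw [charFunDual_apply, charFunDual_apply]
    have hL : ∀ x : DualSpace E, L (I.restrict (ι x)) =
        x (∑ i : I, L (Pi.single i 1) • (i : E)) := by
      intro x
      have h1 : x (∑ i : I, L (Pi.single i 1) • (i : E)) = ∑ i : I, L (Pi.single i 1) * x i := by
        have := map_sum (show E →L[ℝ] ℝ from x) (fun i : I => L (Pi.single i 1) • (i : E))
          Finset.univ
        refine this.trans (Finset.sum_congr rfl fun i _ => dual_smul x _ _)
      rw [h1]
      conv_lhs => rw [pi_eq_sum_univ' (I.restrict (ι x))]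
      rw [map_sum]
      refine Finset.sum_congr rfl fun i _ => ?_
      rw [map_smul, smul_eq_mul, mul_comm]
      congr 2
    have hc : Measurable fun v : I → ℝ => Complex.exp ((L v : ℂ) * Complex.I) := by fun_prop
    have hc' : Measurable fun f : E → ℝ => Complex.exp ((L (I.restrict f) : ℂ) * Complex.I) :=
      hc.comp hI
    rw [integral_map hI.aemeasurable hc.aestronglyMeasurable,
      integral_map hI.aemeasurable hc.aestronglyMeasurable,
      integral_map hιm.aemeasurable hc'.aestronglyMeasurable,
      integral_map hιm.aemeasurable hc'.aestronglyMeasurable]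
    simp only [hL]
    exact h _
  have hmap : ν₁.map ι = ν₂.map ι := by
    have h1 : IsProjectiveLimit (ν₁.map ι) fun I => (ν₂.map ι).map I.restrict := hmarg
    have h2 : IsProjectiveLimit (ν₂.map ι) fun I => (ν₂.map ι).map I.restrict := fun I => rfl
    exact h1.unique h2
  ext A hA
  obtain ⟨B, hB, rfl⟩ : ∃ B, MeasurableSet B ∧ ι ⁻¹' B = A := by
    have hle : (inferInstance : MeasurableSpace (DualSpace E)) ≤
        MeasurableSpace.comap ι MeasurableSpace.pi := by
      refine iSup_le fun ξ => ?_
      rw [MeasurableSpace.comap_le_iff_le_map]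
      intro B hB
      exact ⟨(fun f : E → ℝ => f ξ) ⁻¹' B, measurable_pi_apply ξ hB, rfl⟩
    exact hle A hA
  rw [← Measure.map_apply hιm hB, hmap, Measure.map_apply hιm hB]

/-- An integrable real function with vanishing Fourier transform vanishes: its positive and negative
parts are densities of finite measures with the same characteristic functional. -/
theorem ae_eq_zero_of_real {g : DualSpace E → ℝ} {ν : Measure (DualSpace E)} [IsFiniteMeasure ν]
    (hg : Integrable g ν)
    (h : ∀ ξ : E, ∫ x : DualSpace E, (g x : ℂ) * Complex.exp (((x ξ : ℝ) : ℂ) * Complex.I) ∂ν = 0) :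
    g =ᵐ[ν] 0 := by
  have hpm : AEMeasurable (fun x => ENNReal.ofReal (g x)) ν := hg.aemeasurable.ennreal_ofReal
  have hnm : AEMeasurable (fun x => ENNReal.ofReal (-g x)) ν := hg.aemeasurable.neg.ennreal_ofReal
  have hpf : ∫⁻ x, ENNReal.ofReal (g x) ∂ν ≠ ∞ := hg.lintegral_lt_top.ne
  have hnf : ∫⁻ x, ENNReal.ofReal (-g x) ∂ν ≠ ∞ := hg.neg.lintegral_lt_top.ne
  have : IsFiniteMeasure (ν.withDensity fun x => ENNReal.ofReal (g x)) :=
    isFiniteMeasure_withDensity hpf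
  have : IsFiniteMeasure (ν.withDensity fun x => ENNReal.ofReal (-g x)) :=
    isFiniteMeasure_withDensity hnf
  have hcm : ∀ ξ : E, Measurable fun x : DualSpace E =>
      Complex.exp (((x ξ : ℝ) : ℂ) * Complex.I) := fun ξ =>
    Complex.measurable_exp.comp
      ((Complex.measurable_ofReal.comp (measurable_eval ξ)).mul_const _)
  have hcb : ∀ (ξ : E) (x : DualSpace E), ‖Complex.exp (((x ξ : ℝ) : ℂ) * Complex.I)‖ ≤ 1 :=
    fun ξ x => by rw [Complex.norm_exp_ofReal_mul_I]
  have hi : ∀ (f : DualSpace E → ℝ), Integrable f ν → ∀ ξ : E, Integrable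
      (fun x : DualSpace E => f x • Complex.exp (((x ξ : ℝ) : ℂ) * Complex.I)) ν := by
    intro f hf ξ
    simp only [Complex.real_smul]
    exact hf.ofReal.mul_bdd (c := 1) (hcm ξ).aestronglyMeasurable (Eventually.of_forall (hcb ξ))
  have heq : ν.withDensity (fun x => ENNReal.ofReal (g x)) =
      ν.withDensity fun x => ENNReal.ofReal (-g x) := by
    refine ext_of_charFunctional fun ξ => ?_
    rw [integral_withDensity_eq_integral_toReal_smul₀ hpm
      (Eventually.of_forall fun _ => ENNReal.ofReal_lt_top),
      integral_withDensity_eq_integral_toReal_smul₀ hnm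
      (Eventually.of_forall fun _ => ENNReal.ofReal_lt_top), ← sub_eq_zero]
    have i1 : Integrable (fun x => (ENNReal.ofReal (g x)).toReal) ν := by
      simpa [ENNReal.toReal_ofReal'] using hg.pos_part
    have i2 : Integrable (fun x => (ENNReal.ofReal (-g x)).toReal) ν := by
      simpa [ENNReal.toReal_ofReal'] using hg.neg_part
    rw [← integral_sub (hi _ i1 ξ) (hi _ i2 ξ), ← h ξ]
    congr 1
    funext x
    rw [← sub_smul, ENNReal.toReal_ofReal', ENNReal.toReal_ofReal', Complex.real_smul]
    congr 2
    rcases le_total 0 (g x) with h0 | h0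
    · rw [max_eq_left h0, max_eq_right (by linarith), sub_zero]
    · rw [max_eq_right h0, max_eq_left (by linarith)]
      ring
  have hae := (withDensity_eq_iff hpm hnm hpf).1 heq
  filter_upwards [hae] with x hx
  rcases le_total 0 (g x) with h0 | h0
  · rw [ENNReal.ofReal_of_nonpos (p := -g x) (by linarith), ENNReal.ofReal_eq_zero] at hx
    exact le_antisymm hx h0
  · rw [ENNReal.ofReal_of_nonpos h0, eq_comm, ENNReal.ofReal_eq_zero] at hx
    exact le_antisymm h0 (by simpa using hx)

/-- A square integrable function with vanishing `S`-transform vanishes. -/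
theorem ae_eq_zero_of_sTransform {ψ : DualSpace E → ℂ} (hψ : MemLp ψ 2 μ)
    (h : ∀ ξ, S.sTransform μ ψ ξ = 0) : ψ =ᵐ[μ] 0 := by
  have := hμ.prob
  have hi : Integrable ψ μ := hψ.integrable (by norm_num)
  have hcm : ∀ ξ : E, Measurable fun x : DualSpace E =>
      Complex.exp (((x ξ : ℝ) : ℂ) * Complex.I) := fun ξ =>
    Complex.measurable_exp.comp
      ((Complex.measurable_ofReal.comp (measurable_eval ξ)).mul_const _)
  have hcb : ∀ (ξ : E) (x : DualSpace E), ‖Complex.exp (((x ξ : ℝ) : ℂ) * Complex.I)‖ ≤ 1 :=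
    fun ξ x => by rw [Complex.norm_exp_ofReal_mul_I]
  have h1 : ∀ ξ : E, ∫ x, ψ x * Complex.exp (((x ξ : ℝ) : ℂ) * Complex.I) ∂μ = 0 := by
    intro ξ
    have h2 := h (Complex.I • ofR ξ)
    have h3 : ∀ x : DualSpace E, S.wickExp (Complex.I • ofR ξ) x =
        Complex.exp (((x ξ : ℝ) : ℂ) * Complex.I) * Complex.exp ((S.inner0 ξ ξ : ℂ) / 2) := by
      intro x
      rw [wickExp_eq, evalC_smul, evalC_ofR, pairC_smul_left, pairC_smul_right, pairC_ofR,
        ← Complex.exp_add]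
      congr 1
      linear_combination (-(S.inner0 ξ ξ : ℂ) / 2) * Complex.I_mul_I
    simp only [sTransform, h3, ← mul_assoc] at h2
    rw [integral_mul_const] at h2
    exact (mul_eq_zero.1 h2).resolve_right (Complex.exp_ne_zero _)
  have h2 : ∀ ξ : E, ∫ x, (starRingEnd ℂ) (ψ x) *
      Complex.exp (((x ξ : ℝ) : ℂ) * Complex.I) ∂μ = 0 := by
    intro ξ
    have h3 := congrArg (starRingEnd ℂ) (h1 (-ξ))
    rw [map_zero, ← integral_conj] at h3
    rw [← h3]
    congr 1
    funext x
    rw [map_mul, ← Complex.exp_conj, map_mul, Complex.conj_I, Complex.conj_ofReal, dual_neg]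
    congr 2
    push_cast
    ring
  have hm1 : ∀ ξ : E, Integrable (fun x => ψ x * Complex.exp (((x ξ : ℝ) : ℂ) * Complex.I)) μ :=
    fun ξ => hi.mul_bdd (c := 1) (hcm ξ).aestronglyMeasurable (Eventually.of_forall (hcb ξ))
  have hm2 : ∀ ξ : E, Integrable (fun x => (starRingEnd ℂ) (ψ x) *
      Complex.exp (((x ξ : ℝ) : ℂ) * Complex.I)) μ := fun ξ =>
    Integrable.mul_bdd (c := 1) (hi.norm.mono'
      (RCLike.continuous_conj.comp_aestronglyMeasurable hi.aestronglyMeasurable)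
      (Eventually.of_forall fun x => by simp))
      (hcm ξ).aestronglyMeasurable (Eventually.of_forall (hcb ξ))
  have hre := ae_eq_zero_of_real hi.re (fun ξ => by
    have h3 : ∀ x, ((RCLike.re (ψ x) : ℝ) : ℂ) * Complex.exp (((x ξ : ℝ) : ℂ) * Complex.I) =
        (1 / 2) * (ψ x * Complex.exp (((x ξ : ℝ) : ℂ) * Complex.I) + (starRingEnd ℂ) (ψ x) *
          Complex.exp (((x ξ : ℝ) : ℂ) * Complex.I)) := by
      intro x
      rw [← add_mul, Complex.add_conj, RCLike.re_eq_complex_re]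
      push_cast
      ring
    simp only [h3]
    rw [integral_const_mul, integral_add (hm1 ξ) (hm2 ξ), h1, h2]
    simp)
  have him := ae_eq_zero_of_real hi.im (fun ξ => by
    have h3 : ∀ x, ((RCLike.im (ψ x) : ℝ) : ℂ) * Complex.exp (((x ξ : ℝ) : ℂ) * Complex.I) =
        (1 / (2 * Complex.I)) * (ψ x * Complex.exp (((x ξ : ℝ) : ℂ) * Complex.I) -
          (starRingEnd ℂ) (ψ x) * Complex.exp (((x ξ : ℝ) : ℂ) * Complex.I)) := by
      intro x
      rw [← sub_mul, Complex.sub_conj, RCLike.im_eq_complex_im]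
      have := Complex.I_ne_zero
      field_simp
      push_cast
      ring
    simp only [h3]
    rw [integral_const_mul, integral_sub (hm1 ξ) (hm2 ξ), h1, h2]
    simp)
  filter_upwards [hre, him] with x hx1 hx2
  exact Complex.ext hx1 hx2

end HilbertNorms

/-! ### Weight sequences -/

/-- The root test. The value of the exponent `1 / n` at `n = 0` plays no role in the `limsup`. -/
theorem tsum_mul_pow_lt_top (u : ℕ → ℝ) (hu : ∀ n, 0 ≤ u n) {x : ℝ≥0∞} (hx : x ≠ ∞)
    (h : x * limsup (fun n : ℕ => ENNReal.ofReal (u n ^ (1 / (n : ℝ)))) atTop < 1) :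
    ∑' n : ℕ, ENNReal.ofReal (u n) * x ^ n < ∞ := by
  rcases eq_or_ne x 0 with rfl | hx0
  · rw [tsum_eq_single 0 fun n hn => by rw [zero_pow hn, mul_zero]]
    simp
  have hL : limsup (fun n : ℕ => ENNReal.ofReal (u n ^ (1 / (n : ℝ)))) atTop < x⁻¹ := by
    by_contra! hc
    have h1 := mul_le_mul_right hc x
    rw [ENNReal.mul_inv_cancel hx0 hx] at h1
    exact absurd h1 h.not_ge
  obtain ⟨y, hLy, hyx⟩ := exists_between hL
  have hxy : y * x < 1 := by
    rw [← one_div] at hyx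
    exact ENNReal.mul_lt_of_lt_div hyx
  have hev := eventually_lt_of_limsup_lt hLy
  obtain ⟨N, hN⟩ := eventually_atTop.1 hev
  have hb : ∀ n, ENNReal.ofReal (u (n + (N + 1))) * x ^ (n + (N + 1)) ≤ (y * x) ^ n := by
    intro n
    have hne : n + (N + 1) ≠ 0 := by omega
    have h1 : ENNReal.ofReal (u (n + (N + 1))) ≤ y ^ (n + (N + 1)) := by
      have h2 := (hN (n + (N + 1)) (by omega)).le
      have h3 := pow_le_pow_left₀ zero_le h2 (n + (N + 1))
      rw [← ENNReal.ofReal_pow (Real.rpow_nonneg (hu _) _), one_div,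
        Real.rpow_inv_natCast_pow (hu _) hne] at h3
      exact h3
    calc _ ≤ y ^ (n + (N + 1)) * x ^ (n + (N + 1)) := by gcongr
      _ = (y * x) ^ (n + (N + 1)) := (mul_pow _ _ _).symm
      _ ≤ _ := pow_le_pow_of_le_one zero_le hxy.le (by omega)
  rw [← ENNReal.summable.sum_add_tsum_nat_add' (f := fun n => ENNReal.ofReal (u n) * x ^ n)
    (k := N + 1)]
  refine ENNReal.add_lt_top.2 ⟨?_, ?_⟩
  · exact ENNReal.sum_lt_top.2 fun i _ => ENNReal.mul_lt_top ENNReal.ofReal_lt_top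
      (ENNReal.pow_lt_top hx.lt_top)
  · refine (ENNReal.tsum_le_tsum hb).trans_lt ?_
    rw [ENNReal.tsum_geometric]
    exact ENNReal.inv_lt_top.2 (tsub_pos_of_lt hxy)

namespace IsWeight

variable {α : ℕ → ℝ} (hα : IsWeight α)
include hα

theorem pos (n : ℕ) : 0 < α n := by
  obtain ⟨c, hc, h⟩ := hα.lower
  exact hc.trans_le (h n)

theorem factorial_mul_pos (n : ℕ) : 0 < (n.factorial : ℝ) * α n :=
  mul_pos (by positivity) (hα.pos n)

theorem summable_genInv (r : ℝ) : Summable fun n : ℕ => r ^ n / (n.factorial * α n) := by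
  obtain ⟨c, hc, h⟩ := hα.lower
  refine Summable.of_norm_bounded ((Real.summable_pow_div_factorial |r|).mul_left c⁻¹)
    fun n => ?_
  have := hα.pos n
  rw [norm_div, norm_pow, Real.norm_eq_abs, Real.norm_eq_abs, abs_of_pos (hα.factorial_mul_pos n),
    ← div_eq_inv_mul, div_div]
  gcongr
  exact h n

theorem genInv_term_le {r : ℝ} (hr : 0 ≤ r) (n : ℕ) :
    r ^ n / (n.factorial * α n) ≤ genInv α r :=
  (hα.summable_genInv r).le_tsum n fun k _ =>
    div_nonneg (pow_nonneg hr k) (hα.factorial_mul_pos k).le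

theorem genInv_nonneg {r : ℝ} (hr : 0 ≤ r) : 0 ≤ genInv α r :=
  tsum_nonneg fun k => div_nonneg (pow_nonneg hr k) (hα.factorial_mul_pos k).le

theorem genInv_mono {r t : ℝ} (hr : 0 ≤ r) (hrt : r ≤ t) : genInv α r ≤ genInv α t := by
  refine (hα.summable_genInv r).tsum_le_tsum (fun k => ?_) (hα.summable_genInv t)
  have := hα.factorial_mul_pos k
  gcongr

theorem genInv_zero : genInv α 0 = 1 := by
  rw [genInv, tsum_eq_single 0 fun n hn => by rw [zero_pow hn, zero_div]]
  simp [hα.zero]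

theorem one_le_growthCoeff (n : ℕ) : 1 ≤ growthCoeff α n := by
  have h := hα.factorial_mul_pos n
  rw [growthCoeff, mul_comm, ← div_le_iff₀ h]
  refine le_ciInf fun r => ?_
  have hr : (0 : ℝ) < r := r.2
  have := hα.genInv_term_le hr.le n
  rw [le_div_iff₀ (pow_pos hr n)]
  calc _ = (r : ℝ) ^ n / (n.factorial * α n) := by ring
    _ ≤ _ := this

/-- A bound that holds for every radius `r` holds with the optimal one, which is how `growthCoeff`
enters. -/
theorem le_growthCoeff {n : ℕ} {y B : ℝ} (hB : 0 ≤ B)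
    (h : ∀ r : ℝ, 0 < r → y ≤ B * (genInv α r / r ^ n)) :
    y ≤ B * (growthCoeff α n / (n.factorial * α n)) := by
  rw [growthCoeff, mul_div_cancel_left₀ _ (hα.factorial_mul_pos n).ne', Real.mul_iInf_of_nonneg hB]
  exact le_ciInf fun r => h r r.2

theorem one_le_growthRate : 1 ≤ growthRate α := by
  refine le_limsup_of_le (by isBoundedDefault) fun b hb => ?_
  obtain ⟨n, hn⟩ := hb.exists
  refine le_trans ?_ hn
  rw [ENNReal.one_le_ofReal]
  exact Real.one_le_rpow (hα.one_le_growthCoeff n) (by positivity)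

theorem tsum_growthCoeff_lt_top {x : ℝ≥0∞} (h : x * growthRate α < 1) :
    ∑' n : ℕ, ENNReal.ofReal (growthCoeff α n) * x ^ n < ∞ := by
  refine tsum_mul_pow_lt_top _ (fun n => zero_le_one.trans (hα.one_le_growthCoeff n)) ?_ h
  rintro rfl
  rw [ENNReal.top_mul (zero_lt_one.trans_le hα.one_le_growthRate).ne'] at h
  exact absurd h (by simp)

theorem tsum_weight_lt_top {x : ℝ≥0∞} (hx : x ≠ ∞) :
    ∑' n : ℕ, ENNReal.ofReal (α n / n.factorial) * x ^ n < ∞ := by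
  refine tsum_mul_pow_lt_top _ (fun n => div_nonneg (hα.pos n).le (by positivity)) hx ?_
  have h := (ENNReal.tendsto_ofReal hα.growth).limsup_eq
  rw [h]
  simp

end IsWeight

open Complexification HilbertNorms

/-- Stirling's formula, in the form in which `e²` and `2π` enter the estimates. -/
theorem pow_div_factorial_sq_le {n : ℕ} (hn : n ≠ 0) :
    ((n : ℝ) ^ 2) ^ n / (n.factorial : ℝ) ^ 2 ≤ (Real.exp 1 ^ 2) ^ n / (2 * Real.pi) := by
  have h := Stirling.le_factorial_stirling n
  have hn1 : (1 : ℝ) ≤ n := by exact_mod_cast Nat.one_le_iff_ne_zero.2 hn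
  have h2 := pow_le_pow_left₀ (by positivity) h 2
  rw [mul_pow, Real.sq_sqrt (by positivity)] at h2
  rw [div_le_div_iff₀ (by positivity) (by positivity)]
  calc _ = 2 * Real.pi * (((n : ℝ) / Real.exp 1) ^ n) ^ 2 * (Real.exp 1 ^ 2) ^ n := by
        rw [div_pow]
        field_simp
        ring
    _ ≤ 2 * Real.pi * n * (((n : ℝ) / Real.exp 1) ^ n) ^ 2 * (Real.exp 1 ^ 2) ^ n := by
        refine mul_le_mul_of_nonneg_right (mul_le_mul_of_nonneg_right ?_ (by positivity))
          (by positivity)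
        exact le_mul_of_one_le_right (by positivity) hn1
    _ ≤ (n.factorial : ℝ) ^ 2 * (Real.exp 1 ^ 2) ^ n := by gcongr
    _ = _ := mul_comm _ _

/-! ### Cauchy estimates under the growth condition -/

section Growth

variable {α : ℕ → ℝ} (hα : IsWeight α) {E H : Type*} [AddCommGroup E] [Module ℝ E]
  [NormedAddCommGroup H] [InnerProductSpace ℝ H]
include hα

theorem IsWeight.gateauxEntire {F : Complexification E → ℂ}
    (hF : ∀ ξ η : Complexification E, Differentiable ℂ (fun z : ℂ => F (z • ξ + η)))
    {K a : ℝ} (hK : 0 ≤ K) (ha : 0 ≤ a) (L : E →ₗ[ℝ] H)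
    (hb : ∀ ξ, ‖F ξ‖ ≤ K * genInv α (a * normC L ξ ^ 2) ^ (1 / 2 : ℝ)) : GateauxEntire F where
  differentiable ξ η := by
    simpa only [add_comm] using hF η ξ
  bounded n v ξ R := by
    obtain ⟨M, hM⟩ := exists_normC_le L v ξ R
    refine ⟨K * genInv α (a * M ^ 2) ^ (1 / 2 : ℝ), fun z hz => (hb _).trans ?_⟩
    have h1 := hM z hz
    have h0 := normC_nonneg L (ξ + ∑ i, z i • v i)
    gcongr
    · exact hα.genInv_nonneg (by positivity)
    · exact hα.genInv_mono (by positivity) (by gcongr)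

/-- Cauchy's estimate on the polydisc `|z_k| ≤ R / ‖L η_k‖`. -/
theorem IsWeight.norm_taylorForm_sq_le_genInv {F : Complexification E → ℂ} (hG : GateauxEntire F)
    {K a : ℝ} (hK : 0 ≤ K) (ha : 0 ≤ a) (L : E →ₗ[ℝ] H) (hL : Function.Injective L)
    (hb : ∀ ξ, ‖F ξ‖ ≤ K * genInv α (a * normC L ξ ^ 2) ^ (1 / 2 : ℝ)) (n : ℕ) (η : Fin n → E)
    {R : ℝ} (hR : 0 < R) :
    ‖taylorForm hG n η‖ ^ 2 ≤ K ^ 2 * genInv α (a * (n * R) ^ 2) / (n.factorial * R ^ n) ^ 2 *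
      ∏ k, ‖L (η k)‖ ^ 2 := by
  have hg : 0 ≤ genInv α (a * (n * R) ^ 2) := hα.genInv_nonneg (by positivity)
  by_cases hz : ∃ k, η k = 0
  · obtain ⟨k, hk⟩ := hz
    rw [(taylorForm hG n).map_coord_zero k hk]
    simp only [norm_zero, ne_eq, OfNat.ofNat_ne_zero, not_false_eq_true, zero_pow]
    exact mul_nonneg (by positivity) (Finset.prod_nonneg fun _ _ => by positivity)
  push Not at hz
  have hpos : ∀ k, 0 < ‖L (η k)‖ := fun k =>
    norm_pos_iff.2 fun h => hz k (hL (by rw [h, map_zero]))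
  have h1 := GateauxEntire.norm_iterDir_le hG (fun k => ofR (η k)) (fun k => R / ‖L (η k)‖)
    (fun k => div_pos hR (hpos k)) (K * genInv α (a * (n * R) ^ 2) ^ (1 / 2 : ℝ)) 0
    (fun z hzR => by
      refine (hb _).trans ?_
      have h2 : normC L (0 + ∑ i, z i • ofR (η i)) ≤ n * R := by
        rw [zero_add]
        refine (normC_sum_le _ _ _ _).trans ?_
        calc _ ≤ ∑ _i : Fin n, R := Finset.sum_le_sum fun i _ => by
              rw [normC_ofR, ← le_div_iff₀ (hpos i)]
              exact hzR i
          _ = _ := by simp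
      have h0 := normC_nonneg L (0 + ∑ i, z i • ofR (η i))
      gcongr
      · exact hα.genInv_nonneg (by positivity)
      · exact hα.genInv_mono (by positivity) (by gcongr))
  rw [Finset.prod_div_distrib, Finset.prod_const, Finset.card_univ, Fintype.card_fin,
    ← Real.sqrt_eq_rpow] at h1
  rw [taylorForm_apply, GateauxEntire.derivForm_apply, norm_mul, norm_inv, Complex.norm_natCast,
    mul_pow]
  have hP : 0 < ∏ k, ‖L (η k)‖ := Finset.prod_pos fun k _ => hpos k
  have h3 := pow_le_pow_left₀ (norm_nonneg _) h1 2
  calc _ ≤ ((n.factorial : ℝ)⁻¹) ^ 2 *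
        (K * √(genInv α (a * (n * R) ^ 2)) / (R ^ n / ∏ k, ‖L (η k)‖)) ^ 2 := by gcongr
    _ = _ := by
        rw [Finset.prod_pow, div_pow, mul_pow, Real.sq_sqrt hg]
        field_simp

theorem IsWeight.norm_taylorForm_zero_sq_le {F : Complexification E → ℂ} (hG : GateauxEntire F)
    {K a : ℝ} (hK : 0 ≤ K) (ha : 0 ≤ a) (L : E →ₗ[ℝ] H) (hL : Function.Injective L)
    (hb : ∀ ξ, ‖F ξ‖ ≤ K * genInv α (a * normC L ξ ^ 2) ^ (1 / 2 : ℝ)) (η : Fin 0 → E) :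
    ‖taylorForm hG 0 η‖ ^ 2 ≤ K ^ 2 := by
  have := hα.norm_taylorForm_sq_le_genInv hG hK ha L hL hb 0 η one_pos
  simpa [hα.genInv_zero] using this

/-- Cauchy's estimate with the optimal radius, and Stirling's formula. -/
theorem IsWeight.norm_taylorForm_sq_le {F : Complexification E → ℂ} (hG : GateauxEntire F)
    {K a : ℝ} (hK : 0 ≤ K) (ha : 0 ≤ a) (L : E →ₗ[ℝ] H) (hL : Function.Injective L)
    (hb : ∀ ξ, ‖F ξ‖ ≤ K * genInv α (a * normC L ξ ^ 2) ^ (1 / 2 : ℝ)) {n : ℕ} (hn : n ≠ 0)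
    (η : Fin n → E) :
    ‖taylorForm hG n η‖ ^ 2 ≤ K ^ 2 / (2 * Real.pi) * (growthCoeff α n / (n.factorial * α n)) *
      (a * Real.exp 1 ^ 2) ^ n * ∏ k, ‖L (η k)‖ ^ 2 := by
  have hP : 0 ≤ ∏ k, ‖L (η k)‖ ^ 2 := Finset.prod_nonneg fun _ _ => by positivity
  have hc : 0 ≤ growthCoeff α n / (n.factorial * α n) :=
    div_nonneg (zero_le_one.trans (hα.one_le_growthCoeff n)) (hα.factorial_mul_pos n).le
  have hn0 : (0 : ℝ) < n := by exact_mod_cast Nat.pos_of_ne_zero hn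
  -- the radii are divided by `a`; for `a = 0`, apply the estimate to all `b > 0` and let `b → 0`
  have key : ∀ b : ℝ, 0 < b → a ≤ b → ‖taylorForm hG n η‖ ^ 2 ≤
      K ^ 2 / (2 * Real.pi) * (growthCoeff α n / (n.factorial * α n)) *
      (b * Real.exp 1 ^ 2) ^ n * ∏ k, ‖L (η k)‖ ^ 2 := by
    intro b hb0 hab
    have h1 : ‖taylorForm hG n η‖ ^ 2 ≤ (K ^ 2 * b ^ n *
        (((n : ℝ) ^ 2) ^ n / (n.factorial : ℝ) ^ 2) * ∏ k, ‖L (η k)‖ ^ 2) *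
          (growthCoeff α n / (n.factorial * α n)) := by
      refine hα.le_growthCoeff (by positivity) fun r hr => ?_
      -- the radius for which the argument of `genInv` becomes `r`
      set R : ℝ := √(r / (b * n ^ 2)) with hR
      have hR0 : 0 < R := Real.sqrt_pos.2 (by positivity)
      have hR2 : R ^ 2 = r / (b * n ^ 2) := Real.sq_sqrt (by positivity)
      have hb' : ∀ ξ, ‖F ξ‖ ≤ K * genInv α (b * normC L ξ ^ 2) ^ (1 / 2 : ℝ) := fun ξ => by
        refine (hb ξ).trans ?_
        have h0 := normC_nonneg L ξ
        gcongr
        · exact hα.genInv_nonneg (by positivity)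
        · exact hα.genInv_mono (by positivity) (by gcongr)
      have h2 := hα.norm_taylorForm_sq_le_genInv hG hK hb0.le L hL hb' n η hR0
      refine h2.trans_eq ?_
      have h3 : b * (n * R) ^ 2 = r := by
        rw [mul_pow, hR2]
        field_simp
      have h4 : (R ^ n) ^ 2 = r ^ n / (b * n ^ 2) ^ n := by
        rw [← pow_mul, mul_comm n 2, pow_mul, hR2, div_pow]
      rw [h3, mul_pow, h4, mul_pow b]
      field_simp
    refine h1.trans ?_
    have h5 := pow_div_factorial_sq_le hn
    calc _ ≤ K ^ 2 * b ^ n * ((Real.exp 1 ^ 2) ^ n / (2 * Real.pi)) * (∏ k, ‖L (η k)‖ ^ 2) *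
          (growthCoeff α n / (n.factorial * α n)) := by gcongr
      _ = _ := by
        rw [mul_pow b]
        ring
  rcases ha.eq_or_lt with rfl | ha0
  · have hcont : Tendsto (fun b : ℝ => K ^ 2 / (2 * Real.pi) *
        (growthCoeff α n / (n.factorial * α n)) *
        (b * Real.exp 1 ^ 2) ^ n * ∏ k, ‖L (η k)‖ ^ 2) (𝓝[>] 0) (𝓝 (K ^ 2 / (2 * Real.pi) *
        (growthCoeff α n / (n.factorial * α n)) *
        (0 * Real.exp 1 ^ 2) ^ n * ∏ k, ‖L (η k)‖ ^ 2)) := by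
      refine Tendsto.mono_left (Continuous.tendsto ?_ 0) nhdsWithin_le_nhds
      fun_prop
    refine ge_of_tendsto hcont ?_
    filter_upwards [self_mem_nhdsWithin] with b hb0
    exact key b hb0 (le_of_lt hb0)
  · exact key a ha0 le_rfl

end Growth

namespace HilbertNorms

open Complexification

/-! ### Hilbert–Schmidt estimates for Taylor coefficients -/

section Estimates

variable {E : Type*} [AddCommGroup E] [Module ℝ E] [TopologicalSpace E] {S : HilbertNorms E}
  (hS : S.IsNuclear) {α : ℕ → ℝ} (hα : IsWeight α) {F : Complexification E → ℂ}
  (hG : GateauxEntire F) {K a : ℝ} (hK : 0 ≤ K) (ha : 0 ≤ a) {p : ℕ}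
  (hb : ∀ ξ, ‖F ξ‖ ≤ K * genInv α (a * normC (S.riesz p) ξ ^ 2) ^ (1 / 2 : ℝ))
include hS hα hK ha hb

theorem IsNuclear.enorm_taylorForm_sq_le {n : ℕ} (hn : n ≠ 0) (η : Fin n → E) :
    ‖taylorForm hG n η‖ₑ ^ 2 ≤
      ENNReal.ofReal (K ^ 2 / (2 * Real.pi) * (growthCoeff α n / (n.factorial * α n))) *
        ENNReal.ofReal (a * Real.exp 1 ^ 2) ^ n * ∏ k, ‖S.riesz p (η k)‖ₑ ^ 2 := by
  have hc : 0 ≤ growthCoeff α n / (n.factorial * α n) :=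
    div_nonneg (zero_le_one.trans (hα.one_le_growthCoeff n)) (hα.factorial_mul_pos n).le
  simp only [enorm_sq_eq_ofReal]
  rw [← ENNReal.ofReal_prod_of_nonneg fun _ _ => by positivity,
    ← ENNReal.ofReal_pow (by positivity), ← ENNReal.ofReal_mul (by positivity),
    ← ENNReal.ofReal_mul (by positivity)]
  exact ENNReal.ofReal_le_ofReal
    (hα.norm_taylorForm_sq_le hG hK ha (S.riesz p) (hS.riesz_injective p) hb hn η)

theorem IsNuclear.enorm_taylorForm_zero_sq_le (η : Fin 0 → E) :
    ‖taylorForm hG 0 η‖ₑ ^ 2 ≤ ENNReal.ofReal (K ^ 2) := by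
  rw [enorm_sq_eq_ofReal]
  exact ENNReal.ofReal_le_ofReal
    (hα.norm_taylorForm_zero_sq_le hG hK ha (S.riesz p) (hS.riesz_injective p) hb η)

/-- The norm of the formal chaos expansion whose kernels are the Taylor coefficients of `F`. -/
theorem IsNuclear.tsum_hsFormSq_taylorForm_le {r : ℕ} (hr : r ≤ p) :
    ∑' n : ℕ, ENNReal.ofReal (n.factorial * α n) *
        hsFormSq (S.innerNeg r) (taylorForm hG n) ≤
      ENNReal.ofReal (K ^ 2) + ENNReal.ofReal (K ^ 2 / (2 * Real.pi)) *
        ∑' n : ℕ, ENNReal.ofReal (growthCoeff α (n + 1)) *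
          (ENNReal.ofReal (a * Real.exp 1 ^ 2) * hilbertSchmidtSq (S.incl p r)) ^ (n + 1) := by
  rw [tsum_eq_zero_add' ENNReal.summable]
  refine add_le_add ?_ ?_
  · have h1 := hS.hsFormSq_le_of_bound hr (taylorForm hG 0) (ENNReal.ofReal (K ^ 2)) 1
      (fun η => by simpa using hS.enorm_taylorForm_zero_sq_le hα hG hK ha hb η)
    simpa [hα.zero] using h1
  · rw [← ENNReal.tsum_mul_left]
    refine ENNReal.tsum_le_tsum fun n => ?_
    have h1 := hS.hsFormSq_le_of_bound hr (taylorForm hG (n + 1)) _ _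
      (hS.enorm_taylorForm_sq_le hα hG hK ha hb n.succ_ne_zero)
    refine (mul_le_mul_right h1 _).trans_eq ?_
    have hpos := hα.factorial_mul_pos (n + 1)
    have hc := zero_le_one.trans (hα.one_le_growthCoeff (n + 1))
    rw [← mul_assoc, ← mul_assoc, ← ENNReal.ofReal_mul hpos.le,
      ← ENNReal.ofReal_mul (by positivity)]
    have hαn := (hα.pos (n + 1)).ne'
    congr 2
    field_simp

end Estimates

section Space

variable {E : Type*} [AddCommGroup E] [Module ℝ E] [TopologicalSpace E] (S : HilbertNorms E)
  (μ : Measure (DualSpace E)) [hμ : S.IsStandardGaussian μ]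

/-! ### The span of the renormalized exponentials -/

/-- The renormalized exponential as an element of `(L²)`. -/
def wickLp (ξ : Complexification E) : Lp ℂ 2 μ := (S.memLp_wickExp μ ξ).toLp

theorem coeFn_wickLp (ξ : Complexification E) : S.wickLp μ ξ =ᵐ[μ] S.wickExp ξ :=
  MemLp.coeFn_toLp _

/-- Linear combinations of renormalized exponentials. -/
def wickComb : (Complexification E →₀ ℂ) →ₗ[ℂ] Lp ℂ 2 μ :=
  Finsupp.linearCombination ℂ (S.wickLp μ)

theorem kernel_wickLp (ξ : Complexification E) (n : ℕ) (η : Fin n → E) :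
    S.kernel μ (S.wickLp μ ξ) n η = (n.factorial : ℂ)⁻¹ * ∏ k, S.pairC ξ (ofR (η k)) := by
  rw [kernel, ← S.integral_wickExp_mul_wick μ ξ n η]
  rw [Complex.ofReal_natCast]
  congr 1
  refine integral_congr_ae ?_
  filter_upwards [S.coeFn_wickLp μ ξ] with x hx
  rw [hx]

omit hμ in
theorem kernel_zero (n : ℕ) (η : Fin n → E) : S.kernel μ 0 n η = 0 := by
  have := S.kernel_smul μ 0 0 n η
  simpa using this

theorem kernel_sub (φ ψ : Lp ℂ 2 μ) (n : ℕ) (η : Fin n → E) :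
    S.kernel μ (φ - ψ) n η = S.kernel μ φ n η - S.kernel μ ψ n η := by
  have h := S.kernel_smul μ (-1) ψ n η
  rw [neg_one_smul] at h
  rw [sub_eq_add_neg, S.kernel_add, h]
  ring

theorem kernel_sum {ι : Type*} (s : Finset ι) (f : ι → Lp ℂ 2 μ) (n : ℕ) (η : Fin n → E) :
    S.kernel μ (∑ i ∈ s, f i) n η = ∑ i ∈ s, S.kernel μ (f i) n η := by
  classical
  induction s using Finset.induction_on with
  | empty => simpa using S.kernel_zero μ n η
  | insert i s hi ih => rw [Finset.sum_insert hi, Finset.sum_insert hi, S.kernel_add, ih]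

theorem kernel_wickComb (c : Complexification E →₀ ℂ) (n : ℕ) (η : Fin n → E) :
    S.kernel μ (S.wickComb μ c) n η =
      (n.factorial : ℂ)⁻¹ * ∑ ξ ∈ c.support, c ξ * ∏ k, S.pairC ξ (ofR (η k)) := by
  rw [wickComb, Finsupp.linearCombination_apply, Finsupp.sum, S.kernel_sum, Finset.mul_sum]
  refine Finset.sum_congr rfl fun ξ _ => ?_
  rw [S.kernel_smul, S.kernel_wickLp]
  ring

variable {S}

/-- Bessel's inequality on the complexification. -/
theorem IsNuclear.sum_enorm_pairC_sq_le (hS : S.IsNuclear) (p : ℕ) (ξ : Complexification E)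
    {m : ℕ} {e : Fin m → E} (he : ∀ i j, S.innerNeg p (e i) (e j) = if i = j then 1 else 0) :
    ∑ i, ‖S.pairC ξ (ofR (e i))‖ₑ ^ 2 ≤ ENNReal.ofReal (normC (S.toEp p) ξ ^ 2) := by
  simp only [enorm_sq_eq_ofReal]
  rw [← ENNReal.ofReal_sum_of_nonneg fun _ _ => by positivity]
  refine ENNReal.ofReal_le_ofReal ?_
  have h1 : ∀ i, ‖S.pairC ξ (ofR (e i))‖ ^ 2 =
      ‖inner ℝ (S.riesz p (e i)) (S.toEp p ξ.re)‖ ^ 2 +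
        ‖inner ℝ (S.riesz p (e i)) (S.toEp p ξ.im)‖ ^ 2 := by
    intro i
    rw [hS.inner_riesz_toEp, hS.inner_riesz_toEp, ← Complex.normSq_eq_norm_sq,
      Complex.normSq_apply, pairC, S.inner0_comm ξ.re, S.inner0_comm ξ.im, S.inner0_comm ξ.re,
      S.inner0_comm ξ.im]
    simp [inner0_zero_left]
    ring
  simp only [h1]
  rw [Finset.sum_add_distrib, normC_sq]
  have ho := orthonormal_riesz he
  exact add_le_add (ho.sum_inner_products_le _) (ho.sum_inner_products_le _)

theorem IsNuclear.hsFormSq_prod_pairC_le (hS : S.IsNuclear) (p : ℕ) (ξ : Complexification E)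
    (n : ℕ) : hsFormSq (S.innerNeg p) (fun η : Fin n → E => ∏ k, S.pairC ξ (ofR (η k))) ≤
      ENNReal.ofReal (normC (S.toEp p) ξ ^ 2) ^ n := by
  refine iSup_le fun m => iSup_le fun e => iSup_le fun he => ?_
  refine le_trans (le_of_eq ?_) (pow_le_pow_left₀ zero_le (hS.sum_enorm_pairC_sq_le p ξ he) n)
  rw [← sum_prod_enorm_sq]
  refine Finset.sum_congr rfl fun j _ => ?_
  simp only [enorm_sq_eq_ofReal]
  rw [norm_prod, ← Finset.prod_pow, ENNReal.ofReal_prod_of_nonneg fun _ _ => by positivity]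

variable {μ} in
theorem mem_testSpace {α : ℕ → ℝ} {ψ : Lp ℂ 2 μ} :
    ψ ∈ S.testSpace μ α ↔ ∀ p, S.normSq μ α p ψ < ∞ := by
  rw [testSpace, Submodule.mem_iInf]
  rfl

theorem IsNuclear.wickLp_mem (hS : S.IsNuclear) {α : ℕ → ℝ} (hα : IsWeight α)
    (ξ : Complexification E) : S.wickLp μ ξ ∈ S.testSpace μ α := by
  rw [mem_testSpace]
  intro p
  refine lt_of_le_of_lt (ENNReal.tsum_le_tsum fun n => ?_)
    (hα.tsum_weight_lt_top (x := ENNReal.ofReal (normC (S.toEp p) ξ ^ 2)) ENNReal.ofReal_ne_top)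
  rw [funext (S.kernel_wickLp μ ξ n)]
  refine (mul_le_mul_right ((hsFormSq_smul_le _ _ _).trans
    (mul_le_mul_right (hS.hsFormSq_prod_pairC_le p ξ n) _)) _).trans_eq ?_
  have := hα.pos n
  rw [← mul_assoc, enorm_sq_eq_ofReal, ← ENNReal.ofReal_mul (by positivity)]
  congr 2
  rw [norm_inv, Complex.norm_natCast]
  field_simp

theorem IsNuclear.wickComb_mem (hS : S.IsNuclear) {α : ℕ → ℝ} (hα : IsWeight α)
    (c : Complexification E →₀ ℂ) : S.wickComb μ c ∈ S.testSpace μ α :=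
  Submodule.sum_mem _ fun ξ _ => Submodule.smul_mem _ _ (hS.wickLp_mem μ hα ξ)

/-- Taylor expansion of `∑ c(ξ) F(ξ)`, in terms of the kernels of `∑ c(ξ) :e^{⟨·, ξ⟩}:`. This is
the chaos expansion of the pairing of these exponentials with the generalized function whose
kernels are the Taylor coefficients of `F`. -/
theorem hasSum_taylorForm_mul_kernel {F : Complexification E → ℂ} (hG : GateauxEntire F)
    (c : Complexification E →₀ ℂ) {m : ℕ} (e : Fin m → E)
    (he : ∀ ξ ∈ c.support, ξ = ∑ i, S.pairC ξ (ofR (e i)) • ofR (e i)) :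
    HasSum (fun n : ℕ => (n.factorial : ℂ) * ∑ j : Fin n → Fin m,
      taylorForm hG n (fun k => e (j k)) * S.kernel μ (S.wickComb μ c) n (fun k => e (j k)))
      (Finsupp.linearCombination ℂ F c) := by
  have h1 : HasSum (fun n : ℕ => ∑ ξ ∈ c.support, c ξ * ((n.factorial : ℂ)⁻¹ *
      hG.derivForm n (fun _ => ξ))) (Finsupp.linearCombination ℂ F c) := by
    rw [Finsupp.linearCombination_apply, Finsupp.sum]
    exact hasSum_sum fun ξ _ => (hG.hasSum_derivForm ξ).mul_left (c ξ)
  refine h1.congr_fun ?_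
  intro n
  have hn : (n.factorial : ℂ) ≠ 0 := by exact_mod_cast n.factorial_ne_zero
  have h2 : ∀ ξ ∈ c.support, hG.derivForm n (fun _ => ξ) = ∑ j : Fin n → Fin m,
      (∏ k, S.pairC ξ (ofR (e (j k)))) *
        ((n.factorial : ℂ) * taylorForm hG n (fun k => e (j k))) := by
    intro ξ hξ
    conv_lhs => rw [show (fun _ : Fin n => ξ) = fun _ : Fin n =>
      ∑ i, S.pairC ξ (ofR (e i)) • ofR (e i) from funext fun _ => he ξ hξ]
    rw [MultilinearMap.map_sum]
    refine Finset.sum_congr rfl fun j _ => ?_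
    rw [MultilinearMap.map_smul_univ, taylorForm_apply, mul_inv_cancel_left₀ hn, smul_eq_mul]
  simp only [S.kernel_wickComb]
  rw [eq_comm, Finset.sum_congr rfl fun ξ hξ => congrArg
    (fun w => c ξ * ((n.factorial : ℂ)⁻¹ * w)) (h2 ξ hξ)]
  simp only [Finset.mul_sum]
  rw [Finset.sum_comm]
  refine Finset.sum_congr rfl fun j _ => Finset.sum_congr rfl fun ξ _ => ?_
  field_simp

/-- A simultaneously orthogonal basis for the parameters of a linear combination of renormalized
exponentials. -/
theorem IsNuclear.exists_basis_support (hS : S.IsNuclear) (s : ℕ)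
    (c : Complexification E →₀ ℂ) : ∃ (m : ℕ) (e : Fin m → E),
      (∀ i j, S.innerNeg 0 (e i) (e j) = if i = j then 1 else 0) ∧
      (∀ i j, i ≠ j → S.innerNeg s (e i) (e j) = 0) ∧
      ∀ ξ ∈ c.support, ξ = ∑ i, S.pairC ξ (ofR (e i)) • ofR (e i) := by
  obtain ⟨m, e, h1, h2, h3⟩ := hS.exists_orthonormal_basis 0 s
    (fun x : c.support × Bool => if x.2 then (x.1 : Complexification E).re else
      (x.1 : Complexification E).im)
  refine ⟨m, e, h1, h2, fun ξ hξ => ?_⟩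
  have hr := h3 (⟨ξ, hξ⟩, true)
  have hi := h3 (⟨ξ, hξ⟩, false)
  simp only [if_true, Bool.false_eq_true, if_false, hS.innerNeg_zero] at hr hi
  have hre : ∀ v : Fin m → Complexification E, (∑ i, v i).re = ∑ i, (v i).re := fun v =>
    map_sum (⟨⟨re, rfl⟩, fun _ _ => rfl⟩ : Complexification E →+ E) v _
  have him : ∀ v : Fin m → Complexification E, (∑ i, v i).im = ∑ i, (v i).im := fun v =>
    map_sum (⟨⟨im, rfl⟩, fun _ _ => rfl⟩ : Complexification E →+ E) v _
  have hpr : ∀ i, (S.pairC ξ (ofR (e i))).re = S.inner0 (e i) ξ.re := fun i => by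
    simp [pairC, S.inner0_comm ξ.re, S.inner0_comm ξ.im, inner0_zero_left]
  have hpi : ∀ i, (S.pairC ξ (ofR (e i))).im = S.inner0 (e i) ξ.im := fun i => by
    simp [pairC, S.inner0_comm ξ.re, S.inner0_comm ξ.im, inner0_zero_left]
  refine Complexification.ext ?_ ?_
  · rw [hre]
    simp only [re_smul, re_ofR, im_ofR, smul_zero, sub_zero, hpr]
    exact hr
  · rw [him]
    simp only [im_smul, re_ofR, im_ofR, smul_zero, zero_add, hpi]
    exact hi

/-! ### The pairing estimate -/

/-- The Cauchy–Schwarz inequality for a convergent series of finite sums. -/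
theorem enorm_sq_le_of_hasSum {ι : ℕ → Type*} [∀ n, Fintype (ι n)] (a b : ∀ n, ι n → ℂ) {s : ℂ}
    (h : HasSum (fun n => ∑ j, a n j * b n j) s) :
    ‖s‖ₑ ^ 2 ≤ (∑' n, ∑ j, ‖a n j‖ₑ ^ 2) * ∑' n, ∑ j, ‖b n j‖ₑ ^ 2 := by
  have hc : Continuous fun z : ℂ => ‖z‖ₑ ^ 2 := (ENNReal.continuous_pow 2).comp continuous_enorm
  refine le_of_tendsto' ((hc.tendsto s).comp h) fun t => ?_
  simp only [Function.comp]
  rw [Finset.sum_sigma']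
  refine (enorm_sum_mul_sq_le _ _ _).trans ?_
  rw [Finset.sum_sigma, Finset.sum_sigma]
  exact mul_le_mul' (ENNReal.sum_le_tsum t) (ENNReal.sum_le_tsum t)

variable (S) in
/-- The inner product of `(L²)` is conjugate linear on the left, the pairing is bilinear. -/
theorem integral_mul_eq_inner (φ ψ : Lp ℂ 2 μ) : ∫ x, φ x * ψ x ∂μ = inner ℂ (star φ) ψ := by
  rw [L2.inner_def]
  refine integral_congr_ae ?_
  filter_upwards [Lp.coeFn_star φ] with x hx
  rw [hx]
  simp [mul_comm]

theorem norm_star_Lp (φ : Lp ℂ 2 μ) : ‖star φ‖ = ‖φ‖ := by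
  rw [Lp.norm_def, Lp.norm_def, eLpNorm_congr_ae (Lp.coeFn_star φ), eLpNorm_star]

theorem integral_mul_wickComb (φ : Lp ℂ 2 μ) (c : Complexification E →₀ ℂ) :
    ∫ x, φ x * S.wickComb μ c x ∂μ = Finsupp.linearCombination ℂ (S.sTransform μ φ) c := by
  rw [integral_mul_eq_inner]
  change innerSL ℂ (star φ) (Finsupp.linearCombination ℂ (S.wickLp μ) c) = _
  have h := Finsupp.apply_linearCombination ℂ
    (innerSL ℂ (star φ) : Lp ℂ 2 μ →ₗ[ℂ] ℂ) (S.wickLp μ) c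
  refine h.trans ?_
  congr 2
  funext ξ
  change inner ℂ (star φ) (S.wickLp μ ξ) = _
  rw [← integral_mul_eq_inner]
  refine integral_congr_ae ?_
  filter_upwards [S.coeFn_wickLp μ ξ] with x hx
  rw [hx]

omit hμ in
theorem kernel_star (φ : Lp ℂ 2 μ) (n : ℕ) (η : Fin n → E) :
    S.kernel μ (star φ) n η = (starRingEnd ℂ) (S.kernel μ φ n η) := by
  rw [kernel, kernel, map_mul, ← integral_conj]
  congr 1
  · simp
  · refine integral_congr_ae ?_
    filter_upwards [Lp.coeFn_star φ] with x hx
    rw [hx]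
    simp

/-- The Wiener–Itô isometry for a linear combination `h` of renormalized exponentials: the Taylor
expansion of the pairing of `star h` with `h`. -/
theorem tsum_kernel_wickComb (c : Complexification E →₀ ℂ) {m : ℕ} (e : Fin m → E)
    (he : ∀ ξ ∈ c.support, ξ = ∑ i, S.pairC ξ (ofR (e i)) • ofR (e i)) :
    ∑' n : ℕ, ∑ j : Fin n → Fin m, (n.factorial : ℝ≥0∞) *
      ‖S.kernel μ (S.wickComb μ c) n (fun k => e (j k))‖ₑ ^ 2 = ‖S.wickComb μ c‖ₑ ^ 2 := by
  set h := S.wickComb μ c with hh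
  have h1 := hasSum_taylorForm_mul_kernel μ
    (S.gateauxEntire_sTransform μ (Lp.memLp (star h))) c e he
  rw [← integral_mul_wickComb, integral_mul_eq_inner, star_star, ← hh,
    inner_self_eq_norm_sq_to_K] at h1
  have hk : ∀ (n : ℕ) (η : Fin n → E),
      taylorForm (S.gateauxEntire_sTransform μ (Lp.memLp (star h))) n η =
        (starRingEnd ℂ) (S.kernel μ h n η) := fun n η => by
    rw [← kernel_star, kernel_eq_taylorForm]
  simp only [hk, mul_comm ((starRingEnd ℂ) _), Complex.mul_conj', Finset.mul_sum] at h1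
  have h2 : HasSum (fun n : ℕ => ∑ j : Fin n → Fin m, (n.factorial : ℝ) *
      ‖S.kernel μ h n (fun k => e (j k))‖ ^ 2) (‖h‖ ^ 2) := by
    rw [← Complex.hasSum_ofReal]
    push_cast
    exact h1
  rw [enorm_sq_eq_ofReal, ← h2.tsum_eq, ENNReal.ofReal_tsum_of_nonneg
    (fun n => Finset.sum_nonneg fun _ _ => by positivity) h2.summable]
  refine tsum_congr fun n => ?_
  rw [ENNReal.ofReal_sum_of_nonneg fun _ _ => by positivity]
  refine Finset.sum_congr rfl fun j _ => ?_
  rw [ENNReal.ofReal_mul (by positivity), ← enorm_sq_eq_ofReal, ENNReal.ofReal_natCast]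

variable {μ}

/-- `∑ c(ξ) F(ξ)` is bounded by the norm of `∑ c(ξ) :e^{⟨·, ξ⟩}:` in `(L²)`: Cauchy–Schwarz in the
Taylor expansion, with `n! = √n! √n!`. -/
theorem IsNuclear.enorm_linearCombination_sq_le_norm (hS : S.IsNuclear)
    {F : Complexification E → ℂ} (hG : GateauxEntire F) {A : ℝ≥0∞}
    (hA : ∀ (m : ℕ) (e : Fin m → E), (∀ i j, S.innerNeg 0 (e i) (e j) = if i = j then 1 else 0) →
      ∑' n : ℕ, ∑ j : Fin n → Fin m, (n.factorial : ℝ≥0∞) *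
        ‖taylorForm hG n (fun k => e (j k))‖ₑ ^ 2 ≤ A) (c : Complexification E →₀ ℂ) :
    ‖Finsupp.linearCombination ℂ F c‖ₑ ^ 2 ≤ A * ‖S.wickComb μ c‖ₑ ^ 2 := by
  obtain ⟨m, e, he, -, hc⟩ := hS.exists_basis_support 0 c
  have hsq : ∀ n : ℕ, ((√n.factorial : ℝ) : ℂ) * ((√n.factorial : ℝ) : ℂ) = n.factorial :=
    fun n => by
      rw [← Complex.ofReal_mul, Real.mul_self_sqrt (by positivity), Complex.ofReal_natCast]
  have hen : ∀ (n : ℕ) (z : ℂ), ‖((√n.factorial : ℝ) : ℂ) * z‖ₑ ^ 2 =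
      (n.factorial : ℝ≥0∞) * ‖z‖ₑ ^ 2 := fun n z => by
    rw [enorm_mul, mul_pow, enorm_sq_eq_ofReal, Complex.norm_real, Real.norm_eq_abs, sq_abs,
      Real.sq_sqrt (by positivity), ENNReal.ofReal_natCast]
  have h1 := hasSum_taylorForm_mul_kernel μ hG c e hc
  have h2 := enorm_sq_le_of_hasSum
    (fun (n : ℕ) (j : Fin n → Fin m) =>
      ((√n.factorial : ℝ) : ℂ) * taylorForm hG n (fun k => e (j k)))
    (fun (n : ℕ) (j : Fin n → Fin m) =>
      ((√n.factorial : ℝ) : ℂ) * S.kernel μ (S.wickComb μ c) n (fun k => e (j k)))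
    (h1.congr_fun fun n => by
      rw [Finset.mul_sum]
      refine Finset.sum_congr rfl fun j _ => ?_
      rw [← hsq]
      ring)
  simp only [hen] at h2
  rw [tsum_kernel_wickComb μ c e hc] at h2
  exact h2.trans (mul_le_mul_left (hA m e he) _)

/-- `∑ c(ξ) F(ξ)` is bounded by the norm of `∑ c(ξ) :e^{⟨·, ξ⟩}:` in `[E_s]_α`: Cauchy–Schwarz in
the Taylor expansion, with `n! = √(n! / α(n)) √(n! α(n))`. In a basis `e` that is orthonormal in
`E_0` and orthogonal in `E_s'`, the norms `|e_i|_{-s}` move from the kernels to the Taylor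
coefficients. -/
theorem IsNuclear.enorm_linearCombination_sq_le_normSq (hS : S.IsNuclear) {α : ℕ → ℝ}
    (hα : IsWeight α) {F : Complexification E → ℂ} (hG : GateauxEntire F) (s : ℕ) {A : ℝ≥0∞}
    (hA : ∀ (m : ℕ) (e : Fin m → E), (∀ i j, S.innerNeg 0 (e i) (e j) = if i = j then 1 else 0) →
      ∑' n : ℕ, ∑ j : Fin n → Fin m, ENNReal.ofReal (n.factorial / α n) *
        ((∏ k, ‖S.riesz s (e (j k))‖ₑ ^ 2) * ‖taylorForm hG n (fun k => e (j k))‖ₑ ^ 2) ≤ A)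
    (c : Complexification E →₀ ℂ) :
    ‖Finsupp.linearCombination ℂ F c‖ₑ ^ 2 ≤ A * S.normSq μ α s (S.wickComb μ c) := by
  obtain ⟨m, e, he, hes, hc⟩ := hS.exists_basis_support s c
  set κ : Fin m → ℝ := fun i => ‖S.riesz s (e i)‖ with hκ
  have hκ0 : ∀ i, κ i ≠ 0 := fun i h => by
    have h1 : e i = 0 := hS.riesz_injective s (by rw [norm_eq_zero.1 h, map_zero])
    have h2 := he i i
    rw [h1, S.innerNeg_eq, map_zero, inner_zero_left, if_pos rfl] at h2
    exact zero_ne_one h2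
  -- orthonormal in `E_s'`, hence admissible in the norm of `[E_s]_α`
  set f : Fin m → E := fun i => (κ i)⁻¹ • e i with hf
  have hfo : ∀ i j, S.innerNeg s (f i) (f j) = if i = j then 1 else 0 := by
    intro i j
    rw [S.innerNeg_eq, hf, map_smul, map_smul, inner_smul_left, inner_smul_right,
      ← S.innerNeg_eq]
    split_ifs with hij
    · subst hij
      rw [S.innerNeg_eq, real_inner_self_eq_norm_sq]
      change _ * (_ * κ i ^ 2) = 1
      have := hκ0 i
      simp
      field_simp
    · rw [hes i j hij, mul_zero, mul_zero]
  have hker : ∀ (n : ℕ) (j : Fin n → Fin m), S.kernel μ (S.wickComb μ c) n (fun k => e (j k)) =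
      ((∏ k, κ (j k) : ℝ) : ℂ) * S.kernel μ (S.wickComb μ c) n (fun k => f (j k)) := by
    intro n j
    have h1 : (fun k => e (j k)) = fun k => κ (j k) • f (j k) := funext fun k => by
      rw [hf, smul_inv_smul₀ (hκ0 _)]
    rw [h1, kernel_eq_taylorForm, MultilinearMap.map_smul_univ]
    exact Complex.real_smul
  have hsq : ∀ n : ℕ, ((√(n.factorial / α n) : ℝ) : ℂ) * ((√(n.factorial * α n) : ℝ) : ℂ) =
      n.factorial := fun n => by
    have := hα.pos n
    rw [← Complex.ofReal_mul, ← Real.sqrt_mul (by positivity), show (n.factorial : ℝ) / α n *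
      (n.factorial * α n) = n.factorial ^ 2 by field_simp, Real.sqrt_sq (by positivity),
      Complex.ofReal_natCast]
  have hen : ∀ (x : ℝ) (z : ℂ), 0 ≤ x → ‖((√x : ℝ) : ℂ) * z‖ₑ ^ 2 =
      ENNReal.ofReal x * ‖z‖ₑ ^ 2 := fun x z hx => by
    rw [enorm_mul, mul_pow, enorm_sq_eq_ofReal, Complex.norm_real, Real.norm_eq_abs, sq_abs,
      Real.sq_sqrt hx]
  have h1 := hasSum_taylorForm_mul_kernel μ hG c e hc
  have h2 := enorm_sq_le_of_hasSum
    (fun (n : ℕ) (j : Fin n → Fin m) => ((√(n.factorial / α n) : ℝ) : ℂ) *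
      (((∏ k, κ (j k) : ℝ) : ℂ) * taylorForm hG n (fun k => e (j k))))
    (fun (n : ℕ) (j : Fin n → Fin m) =>
      ((√(n.factorial * α n) : ℝ) : ℂ) * S.kernel μ (S.wickComb μ c) n (fun k => f (j k)))
    (h1.congr_fun fun n => by
      rw [Finset.mul_sum]
      refine Finset.sum_congr rfl fun j _ => ?_
      rw [← hsq, hker]
      ring)
  refine h2.trans (mul_le_mul' ?_ ?_)
  · refine le_trans (le_of_eq ?_) (hA m e he)
    refine tsum_congr fun n => Finset.sum_congr rfl fun j _ => ?_
    have := hα.pos n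
    rw [hen _ _ (by positivity), enorm_mul, mul_pow, enorm_sq_eq_ofReal (((∏ k, κ (j k) : ℝ) : ℂ)),
      Complex.norm_real, Real.norm_eq_abs, sq_abs, ← Finset.prod_pow,
      ENNReal.ofReal_prod_of_nonneg fun _ _ => by positivity]
    simp only [enorm_sq_eq_ofReal, hκ]
  · refine ENNReal.tsum_le_tsum fun n => ?_
    simp only [hen _ _ (hα.factorial_mul_pos n).le]
    rw [← Finset.mul_sum]
    exact mul_le_mul_right (hsFormSq_mono_sum _ hfo) _

end Space

end HilbertNorms

/-- An operator that is dominated by `T` pointwise has a smaller Hilbert–Schmidt norm; in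
particular the composition of `T` with a contraction does. -/
theorem hilbertSchmidtSq_comp_le {H K G : Type*} [NormedAddCommGroup H] [InnerProductSpace ℝ H]
    [NormedAddCommGroup K] [InnerProductSpace ℝ K] [NormedAddCommGroup G] [InnerProductSpace ℝ G]
    (T : H →L[ℝ] K) (U : H →L[ℝ] G) (h : ∀ v, ‖U v‖ ≤ ‖T v‖) :
    hilbertSchmidtSq U ≤ hilbertSchmidtSq T := by
  refine iSup₂_mono fun s _ => Finset.sum_le_sum fun v _ => ?_
  rw [enorm_sq_eq_ofReal, enorm_sq_eq_ofReal]
  exact ENNReal.ofReal_le_ofReal (pow_le_pow_left₀ (norm_nonneg _) (h v) 2)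

namespace HilbertNorms

open Complexification

variable {E : Type*} [AddCommGroup E] [Module ℝ E] [TopologicalSpace E] {S : HilbertNorms E}
  {μ : Measure (DualSpace E)} [hμ : S.IsStandardGaussian μ]

/-! ### Square integrable functions with prescribed `S`-transform -/

variable (S μ) in
/-- The renormalized exponentials are total in `(L²)`. -/
theorem denseRange_wickComb : DenseRange (S.wickComb μ) := by
  rw [DenseRange, ← LinearMap.coe_range, Submodule.dense_iff_topologicalClosure_eq_top,
    Submodule.topologicalClosure_eq_top_iff, Submodule.eq_bot_iff]
  intro v hv
  rw [Lp.eq_zero_iff_ae_eq_zero]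
  refine S.ae_eq_zero_of_sTransform μ (Lp.memLp v) fun ξ => ?_
  have h1 := hv _ ⟨Finsupp.single ξ.conj 1, rfl⟩
  rw [wickComb, Finsupp.linearCombination_single, one_smul, L2.inner_def] at h1
  rw [← h1, sTransform]
  refine integral_congr_ae ?_
  filter_upwards [S.coeFn_wickLp μ ξ.conj] with x hx
  rw [hx, RCLike.inner_apply, conj_wickExp]
  have : ξ.conj.conj = ξ := Complexification.ext (by simp) (by simp)
  rw [this]

/-- If the Taylor coefficients of `F` are square summable with the weights `n!`, then
`∑ c(ξ) :e^{⟨·, ξ⟩}: ↦ ∑ c(ξ) F(ξ)` extends to a bounded functional on `(L²)`, and its Riesz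
representative has the `S`-transform `F`. -/
theorem IsNuclear.exists_sTransform_eq (hS : S.IsNuclear) {F : Complexification E → ℂ}
    (hG : GateauxEntire F) {A : ℝ≥0∞} (hAt : A ≠ ∞)
    (hA : ∀ (m : ℕ) (e : Fin m → E), (∀ i j, S.innerNeg 0 (e i) (e j) = if i = j then 1 else 0) →
      ∑' n : ℕ, ∑ j : Fin n → Fin m, (n.factorial : ℝ≥0∞) *
        ‖taylorForm hG n (fun k => e (j k))‖ₑ ^ 2 ≤ A) :
    ∃ φ : Lp ℂ 2 μ, S.sTransform μ φ = F := by
  set Λ : (Complexification E →₀ ℂ) →ₗ[ℂ] ℂ := Finsupp.linearCombination ℂ F with hΛ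
  have hb : ∀ c, ‖Λ c‖ ≤ √A.toReal * ‖S.wickComb μ c‖ := by
    intro c
    have h := hS.enorm_linearCombination_sq_le_norm (μ := μ) hG hA c
    rw [enorm_sq_eq_ofReal, enorm_sq_eq_ofReal, ← ENNReal.ofReal_toReal hAt,
      ← ENNReal.ofReal_mul ENNReal.toReal_nonneg,
      ENNReal.ofReal_le_ofReal_iff (by positivity)] at h
    rw [← abs_of_nonneg (norm_nonneg (Λ c)), ← abs_of_nonneg
      (show 0 ≤ √A.toReal * ‖S.wickComb μ c‖ by positivity), ← sq_le_sq, mul_pow,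
      Real.sq_sqrt ENNReal.toReal_nonneg]
    exact h
  set T := Λ.extendOfNorm (S.wickComb μ)
  refine ⟨star ((InnerProductSpace.toDual ℂ (Lp ℂ 2 μ)).symm T), funext fun ξ => ?_⟩
  have h1 := integral_mul_wickComb (S := S) μ
    (star ((InnerProductSpace.toDual ℂ (Lp ℂ 2 μ)).symm T)) (Finsupp.single ξ 1)
  rw [Finsupp.linearCombination_single, one_smul] at h1
  rw [← h1, integral_mul_eq_inner, star_star, InnerProductSpace.toDual_symm_apply,
    LinearMap.extendOfNorm_eq (S.denseRange_wickComb μ) ⟨_, hb⟩, hΛ,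
    Finsupp.linearCombination_single, one_smul]

/-- The norm of `(L²)` is bounded by the norm of `[E_0]_α`. The full Wiener–Itô isometry is not
needed: this is the estimate `|⟪ψ, h⟫|² ≤ A ‖h‖²`, first for linear combinations `h` of renormalized
exponentials, then by density for `h = star ψ`. -/
theorem IsNuclear.exists_enorm_sq_le_normSq (hS : S.IsNuclear) {α : ℕ → ℝ} (hα : IsWeight α) :
    ∃ C : ℝ≥0, ∀ ψ : Lp ℂ 2 μ, ‖ψ‖ₑ ^ 2 ≤ C * S.normSq μ α 0 ψ := by
  obtain ⟨b, hb0, hb⟩ := hα.lower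
  refine ⟨(b⁻¹).toNNReal, fun ψ => ?_⟩
  set A : ℝ≥0∞ := ((b⁻¹).toNNReal : ℝ≥0∞) * S.normSq μ α 0 ψ with hA
  have h1 : ∀ c, ‖∫ x, ψ x * S.wickComb μ c x ∂μ‖ₑ ^ 2 ≤ A * ‖S.wickComb μ c‖ₑ ^ 2 := by
    intro c
    rw [integral_mul_wickComb]
    refine hS.enorm_linearCombination_sq_le_norm
      (S.gateauxEntire_sTransform μ (Lp.memLp ψ)) (fun m e he => ?_) c
    rw [hA, normSq, ← ENNReal.tsum_mul_left]
    refine ENNReal.tsum_le_tsum fun n => ?_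
    rw [← Finset.mul_sum, ← mul_assoc, ← kernel_eq_taylorForm]
    refine mul_le_mul' ?_ (hsFormSq_mono_sum _ he)
    change _ ≤ ENNReal.ofReal _ * _
    rw [← ENNReal.ofReal_mul (by positivity), ← ENNReal.ofReal_natCast]
    refine ENNReal.ofReal_le_ofReal ?_
    rw [inv_mul_eq_div, le_div_iff₀ hb0]
    have := hb n
    gcongr
  rcases eq_or_ne A ∞ with hAt | hAt
  · rw [hAt]
    exact le_top
  have h2 : ∀ h : Lp ℂ 2 μ, ‖inner ℂ (star ψ) h‖ₑ ^ 2 ≤ A * ‖h‖ₑ ^ 2 := by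
    intro h
    refine (S.denseRange_wickComb μ).induction_on
      (p := fun h : Lp ℂ 2 μ => ‖inner ℂ (star ψ) h‖ₑ ^ 2 ≤ A * ‖h‖ₑ ^ 2) h ?_ fun c => ?_
    · refine isClosed_le ?_ ?_
      · exact (ENNReal.continuous_pow 2).comp (by fun_prop)
      · exact (ENNReal.continuous_const_mul hAt).comp
          ((ENNReal.continuous_pow 2).comp continuous_enorm)
    · rw [← integral_mul_eq_inner]
      exact h1 c
  have h3 := h2 (star ψ)
  rw [inner_self_eq_norm_sq_to_K, enorm_sq_eq_ofReal, enorm_sq_eq_ofReal,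
    ← ENNReal.ofReal_toReal hAt, ← ENNReal.ofReal_mul ENNReal.toReal_nonneg,
    ENNReal.ofReal_le_ofReal_iff (by positivity), norm_pow, norm_star_Lp] at h3
  have h4 : ‖((‖ψ‖ : ℝ) : ℂ)‖ = ‖ψ‖ := by simp
  rw [enorm_sq_eq_ofReal, ← ENNReal.ofReal_toReal hAt]
  refine ENNReal.ofReal_le_ofReal ?_
  change (‖((‖ψ‖ : ℝ) : ℂ)‖ ^ 2) ^ 2 ≤ _ at h3
  rw [h4] at h3
  by_contra! hlt
  nlinarith [sq_nonneg ‖ψ‖, ENNReal.toReal_nonneg (a := A)]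

/-! ### Bounds for functions of the given growth -/

section Growth

variable (hS : S.IsNuclear) {α : ℕ → ℝ} (hα : IsWeight α) {F : Complexification E → ℂ}
  (hG : GateauxEntire F) {K a : ℝ} (hK : 0 ≤ K) (ha : 0 ≤ a) {p : ℕ}
  (hb : ∀ ξ, ‖F ξ‖ ≤ K * genInv α (a * normC (S.riesz p) ξ ^ 2) ^ (1 / 2 : ℝ))
include hS hα hK ha hb

/-- If `a e² ‖i_{p,0}‖²_HS limsup c_n^{1/n} < 1`, the Taylor coefficients are square summable with
the weights `n!`, uniformly in the orthonormal family. -/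
theorem IsNuclear.exists_tsum_taylorForm_le
    (h0 : ENNReal.ofReal (a * Real.exp 1 ^ 2) * hilbertSchmidtSq (S.incl p 0) * growthRate α < 1) :
    ∃ A : ℝ≥0∞, A ≠ ∞ ∧ ∀ (m : ℕ) (e : Fin m → E),
      (∀ i j, S.innerNeg 0 (e i) (e j) = if i = j then 1 else 0) →
      ∑' n : ℕ, ∑ j : Fin n → Fin m, (n.factorial : ℝ≥0∞) *
        ‖taylorForm hG n (fun k => e (j k))‖ₑ ^ 2 ≤ A := by
  obtain ⟨b, hb0, hbα⟩ := hα.lower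
  set B := ∑' n : ℕ, ENNReal.ofReal (n.factorial * α n) *
        hsFormSq (S.innerNeg 0) (taylorForm hG n)
  have hB : B < ∞ := by
    refine (hS.tsum_hsFormSq_taylorForm_le hα hG hK ha hb (Nat.zero_le p)).trans_lt ?_
    refine ENNReal.add_lt_top.2 ⟨ENNReal.ofReal_lt_top,
      ENNReal.mul_lt_top ENNReal.ofReal_lt_top (lt_of_le_of_lt ?_ (hα.tsum_growthCoeff_lt_top h0))⟩
    rw [tsum_eq_zero_add' (f := fun n => ENNReal.ofReal (growthCoeff α n) * _) ENNReal.summable]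
    exact le_add_self
  refine ⟨ENNReal.ofReal b⁻¹ * B, (ENNReal.mul_lt_top ENNReal.ofReal_lt_top hB).ne,
    fun m e he => ?_⟩
  rw [← ENNReal.tsum_mul_left]
  refine ENNReal.tsum_le_tsum fun n => ?_
  rw [← Finset.mul_sum, ← mul_assoc]
  refine mul_le_mul' ?_ (hsFormSq_mono_sum _ he)
  rw [← ENNReal.ofReal_mul (by positivity), ← ENNReal.ofReal_natCast]
  refine ENNReal.ofReal_le_ofReal ?_
  rw [inv_mul_eq_div, le_div_iff₀ hb0]
  have := hbα n
  gcongr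

omit hα hK ha hb in
/-- Far out in the scale, the inclusions have small Hilbert–Schmidt norm. -/
theorem IsNuclear.exists_sum_enorm_riesz_le {ε : ℝ≥0∞} (hε : 0 < ε) :
    ∃ s : ℕ, ∀ (m : ℕ) (e : Fin m → E),
      (∀ i j, S.innerNeg 0 (e i) (e j) = if i = j then 1 else 0) →
      ∑ i, ‖S.riesz s (e i)‖ₑ ^ 2 ≤ ε := by
  obtain ⟨s, -, hs⟩ := hS.nuclear 0
  obtain ⟨ρ, hρ0, hρ1, hρ⟩ := hS.exists_rho_riesz
  have ht : Tendsto (fun k : ℕ => ENNReal.ofReal (ρ ^ 2) ^ k) atTop (𝓝 0) := by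
    refine ENNReal.tendsto_pow_atTop_nhds_zero_of_lt_one ?_
    rw [ENNReal.ofReal_lt_one]
    exact pow_lt_one₀ hρ0.le hρ1 two_ne_zero
  obtain ⟨k, hk⟩ := ((ENNReal.tendsto_nhds_zero.1 ht) ε hε).exists
  refine ⟨s + k, fun m e he => ?_⟩
  calc _ ≤ ∑ i, ENNReal.ofReal (ρ ^ 2) ^ k * ‖S.riesz s (e i)‖ₑ ^ 2 := by
        refine Finset.sum_le_sum fun i _ => ?_
        rw [enorm_sq_eq_ofReal, enorm_sq_eq_ofReal, ← ENNReal.ofReal_pow (by positivity),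
          ← ENNReal.ofReal_mul (by positivity)]
        refine ENNReal.ofReal_le_ofReal ?_
        rw [← pow_mul, mul_comm 2 k, pow_mul, ← mul_pow]
        exact pow_le_pow_left₀ (norm_nonneg _) (hρ s k (e i)) 2
    _ = ENNReal.ofReal (ρ ^ 2) ^ k * ∑ i, ‖S.riesz s (e i)‖ₑ ^ 2 := by rw [Finset.mul_sum]
    _ ≤ ENNReal.ofReal (ρ ^ 2) ^ k * 1 := by
        gcongr
        exact (hS.sum_enorm_riesz_le (Nat.zero_le s) he).trans hs.le
    _ ≤ ε := by rwa [mul_one]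

/-- For large `s` the Taylor coefficients are square summable with the weights of the dual of
`[E_s]_α`. The directions `e_i` contribute `(∑ |e_i|²_{-s})ⁿ ≤ εⁿ`, and finiteness of the growth
rate allows `ε` so small that the series converges, for any `a`. -/
theorem IsNuclear.exists_tsum_weighted_taylorForm_le (hB : growthRate α < ∞) :
    ∃ (s : ℕ) (A : ℝ≥0∞), A ≠ ∞ ∧ ∀ (m : ℕ) (e : Fin m → E),
      (∀ i j, S.innerNeg 0 (e i) (e j) = if i = j then 1 else 0) →
      ∑' n : ℕ, ∑ j : Fin n → Fin m, ENNReal.ofReal (n.factorial / α n) *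
        ((∏ k, ‖S.riesz s (e (j k))‖ₑ ^ 2) *
          ‖taylorForm hG n (fun k => e (j k))‖ₑ ^ 2) ≤ A := by
  obtain ⟨b, hb0, hbα⟩ := hα.lower
  set x := ENNReal.ofReal (a * Real.exp 1 ^ 2) with hx
  have hxg : x * growthRate α ≠ ∞ := (ENNReal.mul_lt_top ENNReal.ofReal_lt_top hB).ne
  obtain ⟨ε, hε, hε1⟩ : ∃ ε : ℝ≥0∞, 0 < ε ∧ x * ε * growthRate α < 1 := by
    refine ⟨(2 * (x * growthRate α + 1))⁻¹, ?_, ?_⟩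
    · rw [ENNReal.inv_pos]
      exact ENNReal.mul_ne_top (by simp) (ENNReal.add_ne_top.2 ⟨hxg, by simp⟩)
    · rw [mul_right_comm, ← div_eq_mul_inv]
      refine ENNReal.div_lt_of_lt_mul ?_
      rw [one_mul, two_mul]
      calc x * growthRate α < x * growthRate α + 1 := ENNReal.lt_add_right hxg one_ne_zero
        _ ≤ _ := le_self_add
  obtain ⟨s, hs⟩ := hS.exists_sum_enorm_riesz_le hε
  refine ⟨s, ENNReal.ofReal (K ^ 2) + ENNReal.ofReal (K ^ 2 / (2 * Real.pi) * b⁻¹ ^ 2) *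
    ∑' n : ℕ, ENNReal.ofReal (growthCoeff α n) * (x * ε) ^ n, ?_, fun m e he => ?_⟩
  · exact (ENNReal.add_lt_top.2 ⟨ENNReal.ofReal_lt_top, ENNReal.mul_lt_top ENNReal.ofReal_lt_top
      (hα.tsum_growthCoeff_lt_top hε1)⟩).ne
  have hone : ∀ i, ‖S.riesz p (e i)‖ₑ ^ 2 ≤ 1 := by
    intro i
    have h1 : ‖S.riesz p (e i)‖ ≤ 1 :=
      (hS.norm_riesz_le (Nat.zero_le p) (e i)).trans_eq ((orthonormal_riesz he).1 i)
    rw [enorm_sq_eq_ofReal, ENNReal.ofReal_le_one]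
    exact pow_le_one₀ (norm_nonneg _) h1
  rw [tsum_eq_zero_add' ENNReal.summable]
  refine add_le_add ?_ ?_
  · simpa [hα.zero] using hS.enorm_taylorForm_zero_sq_le hα hG hK ha hb _
  · refine le_trans ?_ (mul_le_mul_right (le_add_self.trans_eq (tsum_eq_zero_add'
      (f := fun n => ENNReal.ofReal (growthCoeff α n) * (x * ε) ^ n) ENNReal.summable).symm) _)
    rw [← ENNReal.tsum_mul_left]
    refine ENNReal.tsum_le_tsum fun n => ?_
    have hc := zero_le_one.trans (hα.one_le_growthCoeff (n + 1))
    have hp := hα.pos (n + 1)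
    set D := ENNReal.ofReal (K ^ 2 / (2 * Real.pi) *
      (growthCoeff α (n + 1) / ((n + 1).factorial * α (n + 1))))
    calc _ ≤ ∑ j : Fin (n + 1) → Fin m, ENNReal.ofReal ((n + 1).factorial / α (n + 1)) *
          ((∏ k, ‖S.riesz s (e (j k))‖ₑ ^ 2) * (D * x ^ (n + 1) * 1)) := by
          refine Finset.sum_le_sum fun j _ => ?_
          gcongr
          refine (hS.enorm_taylorForm_sq_le hα hG hK ha hb n.succ_ne_zero _).trans ?_
          gcongr
          exact Finset.prod_le_one' fun k _ => hone _
      _ = ENNReal.ofReal ((n + 1).factorial / α (n + 1)) * D *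
          (x * ∑ i, ‖S.riesz s (e i)‖ₑ ^ 2) ^ (n + 1) := by
          rw [← Finset.mul_sum, ← Finset.sum_mul, sum_prod_enorm_sq (n + 1) fun i =>
            S.riesz s (e i), mul_pow]
          ring
      _ ≤ ENNReal.ofReal ((n + 1).factorial / α (n + 1)) * D * (x * ε) ^ (n + 1) := by
          gcongr
          exact hs m e he
      _ ≤ ENNReal.ofReal (K ^ 2 / (2 * Real.pi) * b⁻¹ ^ 2) *
            ENNReal.ofReal (growthCoeff α (n + 1)) * (x * ε) ^ (n + 1) := by
          refine mul_le_mul_left ?_ _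
          rw [← ENNReal.ofReal_mul (by positivity), ← ENNReal.ofReal_mul (by positivity)]
          refine ENNReal.ofReal_le_ofReal ?_
          have h5 : ((n + 1).factorial / α (n + 1)) * (K ^ 2 / (2 * Real.pi) *
              (growthCoeff α (n + 1) / ((n + 1).factorial * α (n + 1)))) =
              K ^ 2 / (2 * Real.pi) * (α (n + 1))⁻¹ ^ 2 * growthCoeff α (n + 1) := by
            field_simp
          rw [h5]
          have := hbα (n + 1)
          gcongr
      _ = _ := mul_assoc _ _ _

end Growth

end HilbertNorms

/-! ### Inclusion–exclusion and symmetrization -/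

/-- Inclusion–exclusion extracts the surjective index maps from a product of sums. -/
theorem sum_neg_one_pow_mul_prod_sum {m n : ℕ} (B : Fin n → Fin m → ℂ) :
    ∑ U : Finset (Fin n), (-1 : ℂ) ^ U.card * ∏ l, ∑ k ∈ Uᶜ, B k l =
      ∑ τ : Fin m → Fin n with Function.Surjective τ, ∏ l, B (τ l) l := by
  classical
  have h1 : ∀ U : Finset (Fin n), (-1 : ℂ) ^ U.card * ∏ l, ∑ k ∈ Uᶜ, B k l =
      ∑ τ : Fin m → Fin n, if U ⊆ (Finset.univ.image τ)ᶜ then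
        (-1 : ℂ) ^ U.card * ∏ l, B (τ l) l else 0 := by
    intro U
    rw [Finset.prod_univ_sum, Finset.mul_sum, ← Finset.sum_filter]
    refine Finset.sum_congr ?_ fun _ _ => rfl
    ext τ
    simp only [Fintype.mem_piFinset, Finset.mem_compl, Finset.mem_filter, Finset.mem_univ,
      true_and, Finset.subset_iff, Finset.mem_image]
    refine ⟨fun h x hx => ?_, fun h l hl => h hl ⟨l, rfl⟩⟩
    rintro ⟨l, rfl⟩
    exact h l hx
  simp only [h1]
  rw [Finset.sum_comm, Finset.sum_filter]
  refine Finset.sum_congr rfl fun τ _ => ?_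
  have h2 : ∑ U ∈ ((Finset.univ.image τ)ᶜ).powerset, (-1 : ℂ) ^ U.card =
      if (Finset.univ.image τ)ᶜ = ∅ then 1 else 0 := by
    have := Finset.sum_powerset_neg_one_pow_card (x := (Finset.univ.image τ)ᶜ)
    exact_mod_cast congrArg (fun z : ℤ => (z : ℂ)) this
  have h3 : (Finset.univ.image τ)ᶜ = ∅ ↔ Function.Surjective τ := by
    rw [Finset.compl_eq_empty_iff, Finset.eq_univ_iff_forall]
    simp [Function.Surjective]
  rw [← Finset.sum_filter, ← Finset.sum_mul]
  have h4 : Finset.univ.filter (fun U : Finset (Fin n) => U ⊆ (Finset.univ.image τ)ᶜ) =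
      ((Finset.univ.image τ)ᶜ).powerset := by
    ext U
    simp
  rw [h4, h2]
  simp only [h3]
  split_ifs <;> simp

theorem sum_surjective_eq_sum_perm {n : ℕ} (g : (Fin n → Fin n) → ℂ) :
    ∑ τ : Fin n → Fin n with Function.Surjective τ, g τ = ∑ σ : Equiv.Perm (Fin n), g σ := by
  have h : (Finset.univ.filter fun τ : Fin n → Fin n => Function.Surjective τ) =
      Finset.univ.map ⟨fun σ : Equiv.Perm (Fin n) => (σ : Fin n → Fin n),
        DFunLike.coe_injective⟩ := by
    ext τ
    simp only [Finset.mem_filter, Finset.mem_univ, true_and, Finset.mem_map,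
      Function.Embedding.coeFn_mk]
    refine ⟨fun hτ => ⟨Equiv.ofBijective τ ⟨Finite.injective_iff_surjective.2 hτ, hτ⟩, rfl⟩, ?_⟩
    rintro ⟨σ, rfl⟩
    exact σ.surjective
  rw [h, Finset.sum_map]
  rfl

/-- A symmetric multilinear form evaluated at linear combinations of the vectors `ζ i`, written
through symmetrized products of the coefficients. -/
theorem sum_mul_sum_surjective {E : Type*} [AddCommGroup E] [Module ℝ E] {m n : ℕ}
    (f : MultilinearMap ℝ (fun _ : Fin n => E) ℂ)
    (hf : ∀ (η : Fin n → E) (σ : Equiv.Perm (Fin n)), f (η ∘ σ) = f η) (ζ : Fin m → E)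
    (b : Fin m → Fin n → ℝ) :
    ∑ j : Fin n → Fin m, f (fun k => ζ (j k)) * ((n.factorial : ℂ)⁻¹ *
      ∑ τ : Fin n → Fin n with Function.Surjective τ, ∏ l, (b (j (τ l)) l : ℂ)) =
        f (fun l => ∑ i, b i l • ζ i) := by
  have h1 : f (fun l => ∑ i, b i l • ζ i) =
      ∑ j : Fin n → Fin m, f (fun k => ζ (j k)) * ∏ l, (b (j l) l : ℂ) := by
    rw [f.map_sum]
    refine Finset.sum_congr rfl fun j _ => ?_
    rw [f.map_smul_univ, Complex.real_smul, mul_comm, Complex.ofReal_prod]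
  have h2 : ∀ σ : Equiv.Perm (Fin n), ∑ j : Fin n → Fin m,
      f (fun k => ζ (j k)) * ∏ l, (b (j (σ l)) l : ℂ) = f (fun l => ∑ i, b i l • ζ i) := by
    intro σ
    rw [h1]
    refine Fintype.sum_equiv (σ.symm.arrowCongr (Equiv.refl _)) _ _ fun j => ?_
    congr 1
    exact (hf (fun k => ζ (j k)) σ).symm
  have hn : (n.factorial : ℂ) ≠ 0 := by exact_mod_cast n.factorial_ne_zero
  calc _ = (n.factorial : ℂ)⁻¹ * ∑ σ : Equiv.Perm (Fin n), ∑ j : Fin n → Fin m,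
        f (fun k => ζ (j k)) * ∏ l, (b (j (σ l)) l : ℂ) := by
        rw [Finset.sum_comm, Finset.mul_sum]
        refine Finset.sum_congr rfl fun j _ => ?_
        rw [sum_surjective_eq_sum_perm (fun τ => ∏ l, (b (j (τ l)) l : ℂ)), Finset.mul_sum,
          Finset.mul_sum, Finset.mul_sum]
        refine Finset.sum_congr rfl fun σ _ => ?_
        ring
    _ = _ := by
        simp only [h2]
        rw [Finset.sum_const, Finset.card_univ, Fintype.card_perm, Fintype.card_fin,
          nsmul_eq_mul, inv_mul_cancel_left₀ hn]

theorem tsum_eq_sum_range_add (f : ℕ → ℝ≥0∞) (N : ℕ) :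
    ∑' n, f n = ∑ n ∈ Finset.range N, f n + ∑' n, f (n + N) :=
  (ENNReal.summable.sum_add_tsum_nat_add' (f := f) (k := N)).symm

namespace HilbertNorms

open Complexification

variable {E : Type*} [AddCommGroup E] [Module ℝ E] [TopologicalSpace E] {S : HilbertNorms E}
  {μ : Measure (DualSpace E)} [hμ : S.IsStandardGaussian μ]

/-! ### Density of the renormalized exponentials in the test functions -/

variable (S) in
/-- The norm `∑ n! α(n) |f_n|_p²` of a sequence of kernels. -/
def seqNormSq (α : ℕ → ℝ) (p : ℕ) (f : ∀ n : ℕ, (Fin n → E) → ℂ) : ℝ≥0∞ :=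
  ∑' n : ℕ, ENNReal.ofReal (n.factorial * α n) * hsFormSq (S.innerNeg p) (f n)

theorem seqNormSq_add_le (α : ℕ → ℝ) (p : ℕ) (f g : ∀ n : ℕ, (Fin n → E) → ℂ) :
    S.seqNormSq α p (fun n η => f n η + g n η) ≤
      2 * S.seqNormSq α p f + 2 * S.seqNormSq α p g := by
  simp only [seqNormSq]
  rw [← ENNReal.tsum_mul_left, ← ENNReal.tsum_mul_left, ← ENNReal.tsum_add]
  refine ENNReal.tsum_le_tsum fun n => ?_
  refine (mul_le_mul_right (hsFormSq_add_le _ _ _) _).trans (le_of_eq ?_)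
  ring

theorem seqNormSq_sum_le (α : ℕ → ℝ) (p : ℕ) {ι : Type*} (s : Finset ι) (c : ι → ℂ)
    (f : ι → ∀ n : ℕ, (Fin n → E) → ℂ) :
    S.seqNormSq α p (fun n η => ∑ i ∈ s, c i * f i n η) ≤
      s.card * ∑ i ∈ s, ‖c i‖ₑ ^ 2 * S.seqNormSq α p (f i) := by
  simp only [seqNormSq, ← ENNReal.tsum_mul_left]
  rw [← Summable.tsum_finsetSum fun _ _ => ENNReal.summable, ← ENNReal.tsum_mul_left]
  refine ENNReal.tsum_le_tsum fun n => ?_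
  calc _ ≤ ENNReal.ofReal (n.factorial * α n) * (s.card * ∑ i ∈ s,
        ‖c i‖ₑ ^ 2 * hsFormSq (S.innerNeg p) (f i n)) := by
        gcongr
        refine (hsFormSq_sum_le _ s fun i η => c i * f i n η).trans ?_
        gcongr with i _
        exact hsFormSq_smul_le _ _ _
    _ = _ := by
        rw [mul_left_comm, Finset.mul_sum]
        congr 1
        exact Finset.sum_congr rfl fun i _ => by ring

variable (S) in
/-- The sequence of kernels of the Wick monomial `:⟨x, ξ₁⟩⋯⟨x, ξₙ⟩:`, the symmetrization of
`ξ₁ ⊗ ⋯ ⊗ ξₙ` in degree `n` and zero elsewhere. The sum over permutations is written as a sum over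
surjections, as it comes out of inclusion–exclusion; for `m = n` they are the same. -/
def monomialKernel {n : ℕ} (ξ : Fin n → E) (m : ℕ) (η : Fin m → E) : ℂ :=
  if m = n then (m.factorial : ℂ)⁻¹ * ∑ τ : Fin m → Fin n with Function.Surjective τ,
    ∏ l, (S.inner0 (ξ (τ l)) (η l) : ℂ) else 0

theorem inner0_sum_left {ι : Type*} (s : Finset ι) (v : ι → E) (η : E) :
    S.inner0 (∑ i ∈ s, v i) η = ∑ i ∈ s, S.inner0 (v i) η := by
  rw [inner0, map_sum, sum_inner]
  rfl

/-- Wick monomials are limits of iterated difference quotients of renormalized exponentials, namely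
of `t⁻ⁿ ∑_U (-1)^{|U|} :e^{⟨x, t ∑_{k ∉ U} ξₖ⟩}:` as `t → 0`. By inclusion–exclusion the kernels of
degree less than `n` vanish and that of degree `n` is the desired one; those of higher degree carry
a factor `t`. -/
theorem IsNuclear.exists_seqNormSq_sub_monomialKernel_le (hS : S.IsNuclear) {α : ℕ → ℝ}
    (hα : IsWeight α) (r : ℕ) {n : ℕ} (ξ : Fin n → E) {ε : ℝ≥0∞} (hε : 0 < ε) :
    ∃ c : Complexification E →₀ ℂ, S.seqNormSq α r
      (fun m η => S.monomialKernel ξ m η - S.kernel μ (S.wickComb μ c) m η) ≤ ε := by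
  set w : Finset (Fin n) → Complexification E := fun U => ofR (∑ k ∈ Uᶜ, ξ k) with hw
  set X : ℝ≥0∞ := ∑ U, ENNReal.ofReal (normC (S.toEp r) (w U) ^ 2) with hX
  have hXt : X ≠ ∞ := (ENNReal.sum_lt_top.2 fun _ _ => ENNReal.ofReal_lt_top).ne
  set M : ℝ≥0∞ := (((Finset.univ : Finset (Finset (Fin n))).card : ℕ) : ℝ≥0∞)
  set D : ℝ≥0∞ := M * M * ∑' m : ℕ, ENNReal.ofReal (α m / m.factorial) * X ^ m with hD
  have hDt : D ≠ ∞ := (ENNReal.mul_lt_top (ENNReal.mul_lt_top (by simp [M]) (by simp [M]))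
    (hα.tsum_weight_lt_top hXt)).ne
  obtain ⟨t, ht0, ht1, htD⟩ : ∃ t : ℝ, 0 < t ∧ t ≤ 1 ∧ ENNReal.ofReal (t ^ 2) * D ≤ ε := by
    have hc : Tendsto (fun t : ℝ => ENNReal.ofReal (t ^ 2) * D) (𝓝[>] 0) (𝓝 0) := by
      have h1 : Continuous fun t : ℝ => ENNReal.ofReal (t ^ 2) * D :=
        (ENNReal.continuous_mul_const hDt).comp
          (ENNReal.continuous_ofReal.comp (continuous_pow 2))
      have h2 := h1.tendsto 0
      simp only [ne_eq, OfNat.ofNat_ne_zero, not_false_eq_true, zero_pow, ENNReal.ofReal_zero,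
        zero_mul] at h2
      exact h2.mono_left nhdsWithin_le_nhds
    have h3 := (ENNReal.tendsto_nhds_zero.1 hc) ε hε
    have h4 : ∀ᶠ t : ℝ in 𝓝[>] 0, t ∈ Set.Ioc (0 : ℝ) 1 := Ioc_mem_nhdsGT zero_lt_one
    obtain ⟨t, h5, h6⟩ := (h3.and h4).exists
    exact ⟨t, h6.1, h6.2, h5⟩
  have htc : (t : ℂ) ≠ 0 := by exact_mod_cast ht0.ne'
  set c : Complexification E →₀ ℂ := ∑ U : Finset (Fin n),
    Finsupp.single ((t : ℂ) • w U) (((t : ℂ) ^ n)⁻¹ * (-1) ^ U.card)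
  have hker : ∀ (m : ℕ) (η : Fin m → E), S.kernel μ (S.wickComb μ c) m η =
      ∑ U : Finset (Fin n), (((t : ℂ) ^ n)⁻¹ * (t : ℂ) ^ m * (m.factorial : ℂ)⁻¹ *
        (-1) ^ U.card) * ∏ l, S.pairC (w U) (ofR (η l)) := by
    intro m η
    rw [map_sum, S.kernel_sum]
    refine Finset.sum_congr rfl fun U _ => ?_
    rw [wickComb, Finsupp.linearCombination_single, S.kernel_smul, S.kernel_wickLp]
    simp only [pairC_smul_left]
    rw [Finset.prod_mul_distrib, Finset.prod_const, Finset.card_univ, Fintype.card_fin]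
    ring
  have hker2 : ∀ (m : ℕ) (η : Fin m → E), S.kernel μ (S.wickComb μ c) m η =
      ((t : ℂ) ^ n)⁻¹ * (t : ℂ) ^ m * (m.factorial : ℂ)⁻¹ *
        ∑ τ : Fin m → Fin n with Function.Surjective τ,
          ∏ l, (S.inner0 (ξ (τ l)) (η l) : ℂ) := by
    intro m η
    rw [hker, ← sum_neg_one_pow_mul_prod_sum fun k l => (S.inner0 (ξ k) (η l) : ℂ),
      Finset.mul_sum]
    refine Finset.sum_congr rfl fun U _ => ?_
    simp only [hw, pairC_ofR, inner0_sum_left, Complex.ofReal_sum]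
    ring
  have hle : ∀ m ≤ n, ∀ η : Fin m → E,
      S.monomialKernel ξ m η - S.kernel μ (S.wickComb μ c) m η = 0 := by
    intro m hm η
    rw [hker2, monomialKernel]
    split_ifs with h
    · subst h
      rw [inv_mul_cancel₀ (pow_ne_zero _ htc), one_mul, sub_self]
    · rw [Finset.sum_eq_zero, mul_zero, sub_zero]
      intro τ hτ
      have h2 := Fintype.card_le_of_surjective τ (Finset.mem_filter.1 hτ).2
      simp only [Fintype.card_fin] at h2
      omega
  refine ⟨c, le_trans ?_ htD⟩
  rw [hD, ← ENNReal.tsum_mul_left, ← ENNReal.tsum_mul_left, seqNormSq]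
  refine ENNReal.tsum_le_tsum fun m => ?_
  rcases le_or_gt m n with hm | hm
  · rw [show (fun η : Fin m → E => S.monomialKernel ξ m η - S.kernel μ (S.wickComb μ c) m η) =
      fun _ => 0 from funext (hle m hm), hsFormSq_zero, mul_zero]
    exact zero_le
  have hmn : ∀ η : Fin m → E, S.monomialKernel ξ m η - S.kernel μ (S.wickComb μ c) m η =
      ∑ U : Finset (Fin n), (-(((t : ℂ) ^ n)⁻¹ * (t : ℂ) ^ m * (m.factorial : ℂ)⁻¹ *
        (-1) ^ U.card)) * ∏ l, S.pairC (w U) (ofR (η l)) := by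
    intro η
    rw [monomialKernel, if_neg hm.ne', zero_sub, hker, ← Finset.sum_neg_distrib]
    exact Finset.sum_congr rfl fun U _ => by ring
  rw [funext hmn]
  have hcoef : ∀ U : Finset (Fin n), ‖-(((t : ℂ) ^ n)⁻¹ * (t : ℂ) ^ m * (m.factorial : ℂ)⁻¹ *
      (-1) ^ U.card)‖ₑ ^ 2 ≤ ENNReal.ofReal (t ^ 2 * ((m.factorial : ℝ)⁻¹) ^ 2) := by
    intro U
    rw [enorm_sq_eq_ofReal]
    refine ENNReal.ofReal_le_ofReal ?_
    rw [← mul_pow]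
    refine pow_le_pow_left₀ (norm_nonneg _) ?_ 2
    obtain ⟨k, rfl⟩ := Nat.exists_eq_add_of_lt hm
    have hu : ‖(-1 : ℂ) ^ U.card‖ = 1 := by simp
    rw [norm_neg, norm_mul, norm_mul, norm_mul, hu, mul_one,
      norm_inv, norm_inv, norm_pow, norm_pow, Complex.norm_real, Complex.norm_natCast,
      Real.norm_of_nonneg ht0.le]
    have h1 : (t ^ n)⁻¹ * t ^ (n + k + 1) = t * t ^ k := by
      field_simp
      ring
    rw [h1]
    gcongr
    exact mul_le_of_le_one_right ht0.le (pow_le_one₀ ht0.le ht1)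
  have hαm := hα.pos m
  calc _ ≤ ENNReal.ofReal (m.factorial * α m) * (M * ∑ U : Finset (Fin n),
        ENNReal.ofReal (t ^ 2 * ((m.factorial : ℝ)⁻¹) ^ 2) * X ^ m) := by
        gcongr
        refine (hsFormSq_sum_le _ Finset.univ _).trans ?_
        gcongr with U _
        refine (hsFormSq_smul_le _ _ _).trans ?_
        refine mul_le_mul' (hcoef U) ((hS.hsFormSq_prod_pairC_le r (w U) m).trans ?_)
        gcongr
        exact Finset.single_le_sum (f := fun U => ENNReal.ofReal (normC (S.toEp r) (w U) ^ 2))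
          (fun _ _ => zero_le) (Finset.mem_univ U)
    _ = (ENNReal.ofReal (m.factorial * α m) *
          ENNReal.ofReal (t ^ 2 * ((m.factorial : ℝ)⁻¹) ^ 2)) * (M * M * X ^ m) := by
        rw [Finset.sum_const, nsmul_eq_mul]
        ring
    _ = (ENNReal.ofReal (t ^ 2) * ENNReal.ofReal (α m / m.factorial)) * (M * M * X ^ m) := by
        rw [← ENNReal.ofReal_mul (by positivity), ← ENNReal.ofReal_mul (by positivity)]
        congr 2
        field_simp
    _ = _ := by ring

/-- Approximation of a multilinear form by its composition with a finite rank map. -/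
theorem IsNuclear.hsFormSq_sub_comp_le (hS : S.IsNuclear) {r s q : ℕ} (hrs : r ≤ s) (hsq : s ≤ q)
    (hHS : hilbertSchmidtSq (S.incl s r) ≤ 1) {n : ℕ}
    (f : MultilinearMap ℝ (fun _ : Fin n => E) ℂ) (hf : hsFormSq (S.innerNeg q) f ≠ ∞) {δ : ℝ}
    (A : E → E) (hA : ∀ ξ, ‖S.riesz q (ξ - A ξ)‖ ≤ δ * ‖S.riesz s ξ‖) :
    hsFormSq (S.innerNeg r) (fun η => f η - f (fun k => A (η k))) ≤
      ENNReal.ofReal ((hsFormSq (S.innerNeg q) f).toReal * ((1 + δ) ^ n - 1) ^ 2) := by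
  set C := √(hsFormSq (S.innerNeg q) f).toReal with hC
  have hC2 : C ^ 2 = (hsFormSq (S.innerNeg q) f).toReal := Real.sq_sqrt ENNReal.toReal_nonneg
  have hfb : ∀ η, ‖f η‖ ≤ C * ∏ k, ‖S.riesz q (η k)‖ := by
    intro η
    have h1 := hS.enorm_sq_le_hsFormSq q f η
    simp only [enorm_sq_eq_ofReal] at h1
    rw [← ENNReal.ofReal_prod_of_nonneg fun _ _ => by positivity, ← ENNReal.ofReal_toReal hf,
      ← ENNReal.ofReal_mul ENNReal.toReal_nonneg,
      ENNReal.ofReal_le_ofReal_iff (by positivity), ← hC2, Finset.prod_pow, ← mul_pow] at h1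
    exact (sq_le_sq₀ (norm_nonneg _) (by positivity)).1 h1
  have h2 : ∀ η : Fin n → E, ‖f η - f (fun k => A (η k))‖ₑ ^ 2 ≤
      ENNReal.ofReal (C ^ 2 * ((1 + δ) ^ n - 1) ^ 2) * 1 ^ n * ∏ k, ‖S.riesz s (η k)‖ₑ ^ 2 := by
    intro η
    have h1 := enorm_sub_le_of_near f (Real.sqrt_nonneg _) hfb
      (hS.norm_riesz_le hsq) A hA η
    simp only [enorm_sq_eq_ofReal]
    rw [one_pow, mul_one, ← ENNReal.ofReal_prod_of_nonneg fun _ _ => by positivity,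
      ← ENNReal.ofReal_mul (by positivity), Finset.prod_pow, ← mul_pow, ← mul_pow]
    exact ENNReal.ofReal_le_ofReal (pow_le_pow_left₀ (norm_nonneg _) h1 2)
  refine (hS.hsFormSq_le_of_bound hrs _ _ 1 h2).trans ?_
  rw [one_mul, hC2]
  exact mul_le_of_le_one_right' (pow_le_one₀ zero_le hHS)

/-- The kernels of a test function are approximated by those of finite linear combinations of
Wick monomials: cut the series off at some `N`, and compose the remaining kernels with a finite rank
approximation of the identity. -/
theorem IsNuclear.exists_seqNormSq_sub_sum_le (hS : S.IsNuclear) {α : ℕ → ℝ} (hα : IsWeight α)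
    {ψ : Lp ℂ 2 μ} (hψ : ψ ∈ S.testSpace μ α) (r : ℕ) {ε : ℝ} (hε : 0 < ε) :
    ∃ (ι : Type) (_ : Fintype ι) (d : ι → ℕ) (c : ι → ℂ) (ξ : ∀ i, Fin (d i) → E),
      S.seqNormSq α r (fun n η => S.kernel μ ψ n η - ∑ i, c i * S.monomialKernel (ξ i) n η) ≤
        ENNReal.ofReal ε := by
  rw [mem_testSpace] at hψ
  obtain ⟨s, hrs, hs⟩ := hS.nuclear r
  obtain ⟨q, hsq, hq⟩ := hS.nuclear s
  have hfin : ∀ n, hsFormSq (S.innerNeg q) (S.kernel μ ψ n) ≠ ∞ := by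
    intro n h
    have h1 := ENNReal.ne_top_of_tsum_ne_top (hψ q).ne n
    rw [h] at h1
    exact h1 (ENNReal.mul_top (ENNReal.ofReal_pos.2 (hα.factorial_mul_pos n)).ne')
  obtain ⟨N, hN⟩ : ∃ N : ℕ, ∑' n : ℕ, ENNReal.ofReal ((n + N).factorial * α (n + N)) *
      hsFormSq (S.innerNeg r) (S.kernel μ ψ (n + N)) ≤ ENNReal.ofReal (ε / 2) := by
    have h1 := ENNReal.tendsto_sum_nat_add _ (hψ r).ne
    exact ((ENNReal.tendsto_nhds_zero.1 h1) _ (by simpa using hε)).exists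
  set Q : ℝ → ℝ := fun δ => ∑ n ∈ Finset.range N, n.factorial * α n *
    ((hsFormSq (S.innerNeg q) (S.kernel μ ψ n)).toReal * ((1 + δ) ^ n - 1) ^ 2) with hQ
  obtain ⟨δ, hδ0, hδ⟩ : ∃ δ : ℝ, 0 < δ ∧ Q δ ≤ ε / 2 := by
    have hc : Continuous Q := by
      rw [hQ]
      fun_prop
    have h1 := hc.tendsto 0
    have h2 : Q 0 = 0 := by simp [hQ]
    rw [h2] at h1
    have h3 := (h1.mono_left (nhdsWithin_le_nhds (s := Set.Ioi 0))).eventually_lt_const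
      (half_pos hε)
    obtain ⟨δ, h4, h5⟩ := (h3.and self_mem_nhdsWithin).exists
    exact ⟨δ, h5, h4.le⟩
  obtain ⟨m, ξ, ζ, hA⟩ := hS.exists_finite_rank hsq.le (hq.trans ENNReal.one_lt_top) hδ0
  refine ⟨(Σ n : Fin N, Fin n → Fin m), inferInstance, fun i => i.1,
    fun i => S.kernel μ ψ i.1 (fun k => ζ (i.2 k)), fun i k => ξ (i.2 k), ?_⟩
  have hlt : ∀ n < N, ∀ η : Fin n → E, ∑ i : (Σ n : Fin N, Fin n → Fin m),
      S.kernel μ ψ i.1 (fun k => ζ (i.2 k)) * S.monomialKernel (fun k => ξ (i.2 k)) n η =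
        S.kernel μ ψ n (fun k => ∑ i, S.inner0 (ξ i) (η k) • ζ i) := by
    intro n hn η
    rw [Fintype.sum_sigma, Finset.sum_eq_single ⟨n, hn⟩]
    · simp only [monomialKernel, if_true]
      rw [kernel_eq_taylorForm]
      refine sum_mul_sum_surjective (taylorForm _ n) (fun η σ => ?_) ζ
        fun i k => S.inner0 (ξ i) (η k)
      rw [← kernel_eq_taylorForm]
      exact S.kernel_comp_perm μ ψ n η σ
    · intro n' _ hne
      refine Finset.sum_eq_zero fun j _ => ?_
      rw [monomialKernel, if_neg, mul_zero]
      rintro rfl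
      exact hne rfl
    · intro h
      exact absurd (Finset.mem_univ _) h
  have hge : ∀ n, N ≤ n → ∀ η : Fin n → E, ∑ i : (Σ n : Fin N, Fin n → Fin m),
      S.kernel μ ψ i.1 (fun k => ζ (i.2 k)) * S.monomialKernel (fun k => ξ (i.2 k)) n η = 0 := by
    intro n hn η
    refine Finset.sum_eq_zero fun i _ => ?_
    rw [monomialKernel, if_neg, mul_zero]
    have := i.1.2
    omega
  rw [seqNormSq, tsum_eq_sum_range_add _ N, ← add_halves ε,
    ENNReal.ofReal_add (by positivity) (by positivity)]
  refine add_le_add ?_ (le_trans (le_of_eq ?_) hN)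
  · refine le_trans ?_ (ENNReal.ofReal_le_ofReal hδ)
    rw [hQ, ENNReal.ofReal_sum_of_nonneg fun n _ => mul_nonneg (hα.factorial_mul_pos n).le
      (mul_nonneg ENNReal.toReal_nonneg (sq_nonneg _))]
    refine Finset.sum_le_sum fun n hn => ?_
    rw [ENNReal.ofReal_mul (hα.factorial_mul_pos n).le]
    gcongr
    simp only [hlt n (Finset.mem_range.1 hn)]
    have h := hS.hsFormSq_sub_comp_le hrs.le hsq.le hs.le
      (taylorForm (S.gateauxEntire_sTransform μ (Lp.memLp ψ)) n)
      (by rw [← kernel_eq_taylorForm]; exact hfin n)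
      (fun η => ∑ i, S.inner0 (ξ i) η • ζ i) hA
    rw [← kernel_eq_taylorForm] at h
    exact h
  · refine tsum_congr fun n => ?_
    simp only [hge (n + N) (Nat.le_add_left N n), sub_zero]

/-- Linear combinations of renormalized exponentials are dense in the test functions. -/
theorem IsNuclear.exists_normSq_sub_wickComb_le (hS : S.IsNuclear) {α : ℕ → ℝ} (hα : IsWeight α)
    {ψ : Lp ℂ 2 μ} (hψ : ψ ∈ S.testSpace μ α) (r : ℕ) {ε : ℝ≥0∞} (hε : 0 < ε) :
    ∃ c : Complexification E →₀ ℂ, S.normSq μ α r (ψ - S.wickComb μ c) ≤ ε := by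
  classical
  obtain ⟨ε', hε', hle⟩ : ∃ ε' : ℝ, 0 < ε' ∧ ENNReal.ofReal ε' ≤ ε := by
    rcases eq_or_ne ε ∞ with rfl | h
    · exact ⟨1, one_pos, le_top⟩
    · exact ⟨ε.toReal, ENNReal.toReal_pos hε.ne' h, ENNReal.ofReal_toReal_le⟩
  obtain ⟨I, _, n, c, ξ, h1⟩ := hS.exists_seqNormSq_sub_sum_le hα hψ r
    (ε := ε' / 4) (by positivity)
  set M : ℝ≥0∞ := 2 * ((Finset.univ : Finset I).card * ∑ i : I, ‖c i‖ₑ ^ 2) with hM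
  have hMt : M ≠ ∞ := (ENNReal.mul_lt_top (by simp) (ENNReal.mul_lt_top (by simp)
    (ENNReal.sum_lt_top.2 fun i _ => ENNReal.pow_lt_top enorm_lt_top))).ne
  obtain ⟨θ, hθ0, hθ⟩ : ∃ θ : ℝ≥0∞, 0 < θ ∧ M * θ ≤ ENNReal.ofReal (ε' / 2) := by
    refine ⟨ENNReal.ofReal (ε' / 2) / (M + 1), ?_, ?_⟩
    · exact ENNReal.div_pos (by simpa using hε') (ENNReal.add_ne_top.2 ⟨hMt, by simp⟩)
    · calc _ ≤ (M + 1) * (ENNReal.ofReal (ε' / 2) / (M + 1)) := by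
            gcongr
            exact le_self_add
        _ ≤ _ := ENNReal.mul_div_le
  choose d hd using fun i : I =>
    hS.exists_seqNormSq_sub_monomialKernel_le (μ := μ) hα r (ξ i) hθ0
  refine ⟨∑ i, c i • d i, le_trans ?_ hle⟩
  have hk : S.normSq μ α r (ψ - S.wickComb μ (∑ i, c i • d i)) = S.seqNormSq α r
      (fun n η => (S.kernel μ ψ n η - ∑ i, c i * S.monomialKernel (ξ i) n η) +
        ∑ i, c i * (S.monomialKernel (ξ i) n η - S.kernel μ (S.wickComb μ (d i)) n η)) := by
    rw [normSq, seqNormSq]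
    refine tsum_congr fun n => ?_
    congr 2
    funext η
    rw [S.kernel_sub, map_sum, S.kernel_sum]
    simp only [map_smul, S.kernel_smul, mul_sub, Finset.sum_sub_distrib]
    ring
  rw [hk]
  refine (seqNormSq_add_le α r _ _).trans ?_
  have h2 : S.seqNormSq α r (fun n η => ∑ i, c i * (S.monomialKernel (ξ i) n η -
      S.kernel μ (S.wickComb μ (d i)) n η)) ≤
        (Finset.univ : Finset I).card * ((∑ i : I, ‖c i‖ₑ ^ 2) * θ) := by
    refine (seqNormSq_sum_le α r Finset.univ c fun i n η =>
      S.monomialKernel (ξ i) n η - S.kernel μ (S.wickComb μ (d i)) n η).trans ?_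
    rw [Finset.sum_mul]
    gcongr with i _
    exact hd i
  calc _ ≤ 2 * ENNReal.ofReal (ε' / 4) +
        2 * ((Finset.univ : Finset I).card * ((∑ i : I, ‖c i‖ₑ ^ 2) * θ)) := by gcongr
    _ = ENNReal.ofReal (ε' / 2) + M * θ := by
        rw [hM, ← ENNReal.ofReal_ofNat 2, ← ENNReal.ofReal_mul (by positivity)]
        congr 1
        · congr 1
          ring
        · ring
    _ ≤ ENNReal.ofReal (ε' / 2) + ENNReal.ofReal (ε' / 2) := by gcongr
    _ = _ := by
        rw [← ENNReal.ofReal_add (by positivity) (by positivity), add_halves]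

end HilbertNorms

/-! ### Generalized functions -/

/-- Minkowski's inequality for series. -/
theorem rpow_tsum_le_of_rpow_le {a b c : ℕ → ℝ≥0∞}
    (h : ∀ n, c n ^ (1 / 2 : ℝ) ≤ a n ^ (1 / 2 : ℝ) + b n ^ (1 / 2 : ℝ)) :
    (∑' n, c n) ^ (1 / 2 : ℝ) ≤ (∑' n, a n) ^ (1 / 2 : ℝ) + (∑' n, b n) ^ (1 / 2 : ℝ) := by
  have hsq : ∀ x : ℝ≥0∞, (x ^ (1 / 2 : ℝ)) ^ 2 = x := fun x => by
    rw [← ENNReal.rpow_natCast, ← ENNReal.rpow_mul]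
    norm_num
  rw [one_div, ENNReal.rpow_inv_le_iff two_pos, ← one_div]
  rw [ENNReal.tsum_eq_iSup_sum]
  refine iSup_le fun t => ?_
  rw [← ENNReal.rpow_inv_le_iff two_pos, ← one_div]
  have key := ENNReal.Lp_add_le (p := 2) t (fun n => a n ^ (1 / 2 : ℝ))
    (fun n => b n ^ (1 / 2 : ℝ)) (by norm_num)
  simp only [ENNReal.rpow_ofNat, hsq] at key
  calc _ ≤ (∑ n ∈ t, (a n ^ (1 / 2 : ℝ) + b n ^ (1 / 2 : ℝ)) ^ 2) ^ (1 / 2 : ℝ) := by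
        gcongr with n _
        calc c n = (c n ^ (1 / 2 : ℝ)) ^ 2 := (hsq _).symm
          _ ≤ _ := by
            gcongr
            exact h n
    _ ≤ _ := key
    _ ≤ _ := by
        gcongr
        · exact ENNReal.sum_le_tsum t
        · exact ENNReal.sum_le_tsum t

namespace HilbertNorms

open Complexification

variable {E : Type*} [AddCommGroup E] [Module ℝ E] [TopologicalSpace E] (S : HilbertNorms E)
  (μ : Measure (DualSpace E)) [hμ : S.IsStandardGaussian μ]

theorem normSq_add_rpow_le (α : ℕ → ℝ) (p : ℕ) (φ ψ : Lp ℂ 2 μ) :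
    S.normSq μ α p (φ + ψ) ^ (1 / 2 : ℝ) ≤
      S.normSq μ α p φ ^ (1 / 2 : ℝ) + S.normSq μ α p ψ ^ (1 / 2 : ℝ) := by
  refine rpow_tsum_le_of_rpow_le fun n => ?_
  rw [ENNReal.mul_rpow_of_nonneg _ _ (by norm_num), ENNReal.mul_rpow_of_nonneg _ _ (by norm_num),
    ENNReal.mul_rpow_of_nonneg _ _ (by norm_num), ← mul_add,
    show S.kernel μ (φ + ψ) n = fun ξ => S.kernel μ φ n ξ + S.kernel μ ψ n ξ from
      funext fun ξ => S.kernel_add μ φ ψ n ξ]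
  gcongr
  exact hsFormSq_add_rpow_le _ _ _

/-- A copy of the space of test functions, to carry the norm `‖·‖_{p,α}` as a seminorm. -/
def TestCopy (α : ℕ → ℝ) (_p : ℕ) : Type _ := S.testSpace μ α

instance (α : ℕ → ℝ) (p : ℕ) : AddCommGroup (S.TestCopy μ α p) :=
  inferInstanceAs (AddCommGroup (S.testSpace μ α))

instance (α : ℕ → ℝ) (p : ℕ) : Module ℂ (S.TestCopy μ α p) :=
  inferInstanceAs (Module ℂ (S.testSpace μ α))

variable {S μ}

theorem normSq_ne_top {α : ℕ → ℝ} (p : ℕ) (ψ : S.testSpace μ α) :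
    S.normSq μ α p (ψ : Lp ℂ 2 μ) ≠ ∞ :=
  (mem_testSpace.1 ψ.2 p).ne

omit hμ in
theorem normSq_neg (α : ℕ → ℝ) (p : ℕ) (ψ : Lp ℂ 2 μ) :
    S.normSq μ α p (-ψ) = S.normSq μ α p ψ := by
  have h : ∀ φ : Lp ℂ 2 μ, S.normSq μ α p (-φ) ≤ S.normSq μ α p φ := fun φ => by
    have := S.normSq_smul_le μ α p (-1) φ
    simpa using this
  refine le_antisymm (h ψ) ?_
  simpa using h (-ψ)

omit hμ in
theorem normSq_zero (α : ℕ → ℝ) (p : ℕ) : S.normSq μ α p 0 = 0 := by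
  have := S.normSq_smul_le μ α p 0 0
  simpa using this

variable (S μ) in
/-- The norm `‖·‖_{p,α}` on the space of test functions. -/
def testSeminorm (α : ℕ → ℝ) (p : ℕ) : AddGroupSeminorm (S.TestCopy μ α p) where
  toFun ψ := (S.normSq μ α p (show S.testSpace μ α from ψ : Lp ℂ 2 μ) ^ (1 / 2 : ℝ)).toReal
  map_zero' := by
    change (S.normSq μ α p ((0 : S.testSpace μ α) : Lp ℂ 2 μ) ^ (1 / 2 : ℝ)).toReal = 0
    rw [Submodule.coe_zero, normSq_zero]
    simp
  add_le' φ ψ := by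
    have hφ := ENNReal.rpow_ne_top_of_nonneg (by norm_num : (0 : ℝ) ≤ 1 / 2)
      (normSq_ne_top p (show S.testSpace μ α from φ))
    have hψ := ENNReal.rpow_ne_top_of_nonneg (by norm_num : (0 : ℝ) ≤ 1 / 2)
      (normSq_ne_top p (show S.testSpace μ α from ψ))
    rw [← ENNReal.toReal_add hφ hψ]
    exact ENNReal.toReal_mono (ENNReal.add_ne_top.2 ⟨hφ, hψ⟩) (S.normSq_add_rpow_le μ α p _ _)
  neg' ψ := by
    change (S.normSq μ α p (-(show S.testSpace μ α from ψ : Lp ℂ 2 μ)) ^ (1 / 2 : ℝ)).toReal = _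
    rw [normSq_neg]

instance (α : ℕ → ℝ) (p : ℕ) : SeminormedAddCommGroup (S.TestCopy μ α p) :=
  (S.testSeminorm μ α p).toSeminormedAddCommGroup

theorem ofReal_norm_testCopy_sq {α : ℕ → ℝ} {p : ℕ} (ψ : S.TestCopy μ α p) :
    ENNReal.ofReal (‖ψ‖ ^ 2) = S.normSq μ α p (show S.testSpace μ α from ψ : Lp ℂ 2 μ) := by
  change ENNReal.ofReal ((S.normSq μ α p (show S.testSpace μ α from ψ : Lp ℂ 2 μ) ^
    (1 / 2 : ℝ)).toReal ^ 2) = _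
  have h := normSq_ne_top p (show S.testSpace μ α from ψ)
  rw [← ENNReal.toReal_pow, ← ENNReal.rpow_natCast, ← ENNReal.rpow_mul]
  norm_num
  exact h

theorem norm_testCopy_le_iff {α : ℕ → ℝ} {p : ℕ} (ψ : S.TestCopy μ α p) {r : ℝ} (hr : 0 ≤ r) :
    ‖ψ‖ ≤ r ↔ S.normSq μ α p (show S.testSpace μ α from ψ : Lp ℂ 2 μ) ≤ ENNReal.ofReal (r ^ 2) := by
  rw [← ofReal_norm_testCopy_sq, ENNReal.ofReal_le_ofReal_iff (by positivity),
    sq_le_sq₀ (norm_nonneg _) hr]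

instance (α : ℕ → ℝ) (p : ℕ) : IsBoundedSMul ℂ (S.TestCopy μ α p) :=
  IsBoundedSMul.of_norm_smul_le fun c ψ => by
    rw [norm_testCopy_le_iff _ (by positivity), mul_pow, ENNReal.ofReal_mul (by positivity),
      ofReal_norm_testCopy_sq, ← enorm_sq_eq_ofReal]
    exact S.normSq_smul_le μ α p c _

variable (μ) in
/-- Linear combinations of renormalized exponentials, as test functions. -/
def IsNuclear.wickTest (hS : S.IsNuclear) {α : ℕ → ℝ} (hα : IsWeight α) :
    (Complexification E →₀ ℂ) →ₗ[ℂ] S.testSpace μ α :=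
  (S.wickComb μ).codRestrict _ (hS.wickComb_mem μ hα)

theorem IsNuclear.coe_wickTest (hS : S.IsNuclear) {α : ℕ → ℝ} (hα : IsWeight α)
    (c : Complexification E →₀ ℂ) : (hS.wickTest μ hα c : Lp ℂ 2 μ) = S.wickComb μ c := rfl

theorem IsNuclear.denseRange_wickTest (hS : S.IsNuclear) {α : ℕ → ℝ} (hα : IsWeight α) (p : ℕ) :
    DenseRange (fun c => (show S.TestCopy μ α p from hS.wickTest μ hα c)) := by
  rw [Metric.denseRange_iff]
  intro ψ r hr
  obtain ⟨c, hc⟩ := hS.exists_normSq_sub_wickComb_le hα (show S.testSpace μ α from ψ).2 p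
    (ε := ENNReal.ofReal ((r / 2) ^ 2)) (by
      rw [ENNReal.ofReal_pos]
      positivity)
  refine ⟨c, ?_⟩
  rw [dist_eq_norm]
  refine lt_of_le_of_lt ((norm_testCopy_le_iff _ (half_pos hr).le).2 ?_) (half_lt_self hr)
  exact hc

/-- A function `F` for which `∑ c(ξ) :e^{⟨·, ξ⟩}: ↦ ∑ c(ξ) F(ξ)` is bounded in the norm of
`[E_s]_α` is the `S`-transform of a generalized function. -/
theorem IsNuclear.exists_generalizedFunction (hS : S.IsNuclear) {α : ℕ → ℝ} (hα : IsWeight α)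
    {F : Complexification E → ℂ} (s : ℕ) {A : ℝ≥0∞} (hA : A ≠ ∞)
    (hF : ∀ c, ‖Finsupp.linearCombination ℂ F c‖ₑ ^ 2 ≤ A * S.normSq μ α s (S.wickComb μ c)) :
    ∃ Φ : S.GeneralizedFunction μ α, S.IsSTransform μ F Φ := by
  set Λ : (Complexification E →₀ ℂ) →ₗ[ℂ] ℂ := Finsupp.linearCombination ℂ F with hΛ
  set e : (Complexification E →₀ ℂ) →ₗ[ℂ] S.TestCopy μ α s := hS.wickTest μ hα with he
  have hd : DenseRange e := hS.denseRange_wickTest hα s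
  have hb : ∀ c, ‖Λ c‖ ≤ √A.toReal * ‖e c‖ := by
    intro c
    have h := hF c
    have h2 : S.normSq μ α s (S.wickComb μ c) = ENNReal.ofReal (‖e c‖ ^ 2) :=
      (ofReal_norm_testCopy_sq (e c)).symm
    rw [enorm_sq_eq_ofReal, h2, ← ENNReal.ofReal_toReal hA,
      ← ENNReal.ofReal_mul ENNReal.toReal_nonneg,
      ENNReal.ofReal_le_ofReal_iff (by positivity)] at h
    rw [← sq_le_sq₀ (norm_nonneg _) (by positivity), mul_pow, Real.sq_sqrt ENNReal.toReal_nonneg]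
    exact h
  set T : S.TestCopy μ α s →L[ℂ] ℂ := Λ.extendOfNorm e with hT
  have hTb : ∀ ψ : S.TestCopy μ α s, ‖T ψ‖ₑ ^ 2 ≤ A.toNNReal *
      S.normSq μ α s (show S.testSpace μ α from ψ : Lp ℂ 2 μ) := by
    intro ψ
    have h := LinearMap.norm_extendOfNorm_apply_le hd _ hb ψ
    rw [← ofReal_norm_testCopy_sq, enorm_sq_eq_ofReal, ENNReal.coe_toNNReal hA,
      ← ENNReal.ofReal_toReal hA, ← ENNReal.ofReal_mul ENNReal.toReal_nonneg]
    refine ENNReal.ofReal_le_ofReal ?_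
    rw [← Real.sq_sqrt (ENNReal.toReal_nonneg (a := A)), ← mul_pow]
    exact pow_le_pow_left₀ (norm_nonneg _) h 2
  refine ⟨⟨(T : S.TestCopy μ α s →ₗ[ℂ] ℂ), s, A.toNNReal, hTb⟩, fun ξ => ?_⟩
  refine ⟨hS.wickTest μ hα (Finsupp.single ξ 1), ?_, ?_⟩
  · rw [hS.coe_wickTest, wickComb, Finsupp.linearCombination_single, one_smul]
    exact S.coeFn_wickLp μ ξ
  · have h := LinearMap.extendOfNorm_eq hd ⟨_, hb⟩ (Finsupp.single ξ 1)
    rw [hΛ, Finsupp.linearCombination_single, one_smul] at h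
    exact h.symm

/-- On linear combinations of renormalized exponentials, a generalized function is given by its
`S`-transform. -/
theorem IsNuclear.apply_wickTest (hS : S.IsNuclear) {α : ℕ → ℝ} (hα : IsWeight α)
    {F : Complexification E → ℂ} {Φ : S.GeneralizedFunction μ α} (hΦ : S.IsSTransform μ F Φ)
    (c : Complexification E →₀ ℂ) :
    Φ.1 (hS.wickTest μ hα c) = Finsupp.linearCombination ℂ F c := by
  have h1 : ∀ ξ, Φ.1 (hS.wickTest μ hα (Finsupp.single ξ 1)) = F ξ := by
    intro ξ
    obtain ⟨ψ, h1, h2⟩ := hΦ ξ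
    rw [h2]
    congr 1
    refine Subtype.ext (Lp.ext ?_)
    rw [hS.coe_wickTest, wickComb, Finsupp.linearCombination_single, one_smul]
    exact (S.coeFn_wickLp μ ξ).trans h1.symm
  have h2 : Φ.1.comp (hS.wickTest μ hα) = Finsupp.linearCombination ℂ F := by
    refine Finsupp.lhom_ext' fun ξ => LinearMap.ext_ring ?_
    simp only [LinearMap.comp_apply, Finsupp.lsingle_apply, h1,
      Finsupp.linearCombination_single, one_smul]
  exact LinearMap.congr_fun h2 c

/-- A generalized function is determined by its `S`-transform, because linear combinations of
renormalized exponentials are dense in the test functions. Density is used in a norm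
`‖·‖_{r,α}` that controls both functionals. -/
theorem IsNuclear.generalizedFunction_ext (hS : S.IsNuclear) {α : ℕ → ℝ} (hα : IsWeight α)
    {F : Complexification E → ℂ} {Φ Ψ : S.GeneralizedFunction μ α} (hΦ : S.IsSTransform μ F Φ)
    (hΨ : S.IsSTransform μ F Ψ) : Φ = Ψ := by
  refine Subtype.ext (LinearMap.ext fun ψ => ?_)
  obtain ⟨p₁, C₁, h₁⟩ := Φ.2
  obtain ⟨p₂, C₂, h₂⟩ := Ψ.2
  obtain ⟨r, hr, hHS⟩ := hS.nuclear (max p₁ p₂)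
  have hmono : ∀ p ≤ max p₁ p₂, ∀ φ : Lp ℂ 2 μ, S.normSq μ α p φ ≤ S.normSq μ α r φ := by
    intro p hp φ
    refine ENNReal.tsum_le_tsum fun n => mul_le_mul_right ?_ _
    rw [kernel_eq_taylorForm]
    refine hS.hsFormSq_mono_of_nuclear (hp.trans hr.le)
      ((hilbertSchmidtSq_comp_le (S.incl r (max p₁ p₂)) _ fun v => ?_).trans hHS.le) _
    rw [← hS.incl_incl hp hr.le]
    exact hS.norm_incl_apply_le hp _
  have hsmall : ∀ ε : ℝ≥0∞, 0 < ε →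
      ‖Φ.1 ψ - Ψ.1 ψ‖ₑ ^ 2 ≤ (2 * C₁ + 2 * C₂) * ε := by
    intro ε hε
    obtain ⟨c, hc⟩ := hS.exists_normSq_sub_wickComb_le hα ψ.2 r hε
    have heq : Φ.1 ψ - Ψ.1 ψ = Φ.1 (ψ - hS.wickTest μ hα c) +
        -Ψ.1 (ψ - hS.wickTest μ hα c) := by
      rw [map_sub, map_sub, hS.apply_wickTest hα hΦ, hS.apply_wickTest hα hΨ]
      ring
    rw [heq]
    refine (enorm_add_sq_le _ _).trans ?_
    rw [enorm_neg, add_mul, mul_assoc, mul_assoc]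
    gcongr
    · refine (h₁ _).trans ?_
      gcongr
      exact (hmono p₁ (le_max_left _ _) _).trans hc
    · refine (h₂ _).trans ?_
      gcongr
      exact (hmono p₂ (le_max_right _ _) _).trans hc
  have hlim : Tendsto (fun ε : ℝ≥0∞ => (2 * (C₁ : ℝ≥0∞) + 2 * C₂) * ε) (𝓝[>] 0) (𝓝 0) := by
    have h := (ENNReal.continuous_const_mul (a := 2 * (C₁ : ℝ≥0∞) + 2 * C₂)
      (ENNReal.add_ne_top.2 ⟨ENNReal.mul_ne_top (by simp) (by simp),
        ENNReal.mul_ne_top (by simp) (by simp)⟩)).tendsto 0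
    rw [mul_zero] at h
    exact h.mono_left nhdsWithin_le_nhds
  have h0 : ‖Φ.1 ψ - Ψ.1 ψ‖ₑ ^ 2 ≤ 0 := by
    refine ge_of_tendsto hlim ?_
    filter_upwards [self_mem_nhdsWithin] with ε hε
    exact hsmall ε hε
  have h3 : ‖Φ.1 ψ - Ψ.1 ψ‖ₑ = 0 := by simpa using h0
  exact sub_eq_zero.1 (enorm_eq_zero.1 h3)

/-- A square integrable function with the right `S`-transform represents the generalized
function. -/
theorem IsNuclear.isRepresentedBy (hS : S.IsNuclear) {α : ℕ → ℝ} (hα : IsWeight α)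
    {Φ : S.GeneralizedFunction μ α} {φ : Lp ℂ 2 μ} (hΦ : S.IsSTransform μ (S.sTransform μ φ) Φ) :
    S.IsRepresentedBy μ Φ φ := by
  obtain ⟨C, hC⟩ := hS.exists_enorm_sq_le_normSq (μ := μ) hα
  set L : S.testSpace μ α →ₗ[ℂ] ℂ :=
    (innerSL ℂ (star φ) : Lp ℂ 2 μ →ₗ[ℂ] ℂ).comp (S.testSpace μ α).subtype
  have hL : ∀ ψ, L ψ = inner ℂ (star φ) (ψ : Lp ℂ 2 μ) := fun ψ => rfl
  set Ψ : S.GeneralizedFunction μ α := ⟨L, 0, ‖φ‖₊ ^ 2 * C, fun ψ => by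
    have h1 : ‖L ψ‖ₑ ^ 2 ≤ ‖φ‖ₑ ^ 2 * ‖(ψ : Lp ℂ 2 μ)‖ₑ ^ 2 := by
      simp only [enorm_sq_eq_ofReal]
      rw [← ENNReal.ofReal_mul (by positivity), ← mul_pow]
      refine ENNReal.ofReal_le_ofReal (pow_le_pow_left₀ (norm_nonneg _) ?_ 2)
      rw [hL, ← norm_star_Lp]
      exact norm_inner_le_norm _ _
    refine h1.trans ?_
    rw [ENNReal.coe_mul, ENNReal.coe_pow, mul_assoc]
    exact mul_le_mul_right (hC _) _⟩
  have hΨ : S.IsSTransform μ (S.sTransform μ φ) Ψ := by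
    intro ξ
    refine ⟨⟨S.wickLp μ ξ, hS.wickLp_mem μ hα ξ⟩, S.coeFn_wickLp μ ξ, ?_⟩
    change _ = inner ℂ (star φ) (S.wickLp μ ξ)
    rw [← integral_mul_eq_inner]
    refine integral_congr_ae ?_
    filter_upwards [S.coeFn_wickLp μ ξ] with x hx
    rw [hx]
  rw [hS.generalizedFunction_ext hα hΦ hΨ]
  intro ψ
  rw [integral_mul_eq_inner]
  exact hL ψ

end HilbertNorms

end WhiteNoise

end

theorem lemma1 {E : Type*} [AddCommGroup E] [Module ℝ E] [UniformSpace E] [IsUniformAddGroup E]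
    [CompleteSpace E] (S : HilbertNorms E) (hS : S.IsNuclear)
    (μ : Measure (DualSpace E)) [S.IsStandardGaussian μ]
    (α : ℕ → ℝ) (hα : IsWeight α) (hB : growthRate α < ∞)
    (F : Complexification E → ℂ)
    (hF : ∀ ξ η : Complexification E, Differentiable ℂ (fun z : ℂ => F (z • ξ + η)))
    (K a : ℝ) (p : ℕ) (hK : 0 ≤ K) (ha : 0 ≤ a)
    (hbound : ∀ ξ : Complexification E,
      ‖F ξ‖ ≤ K * genInv α (a * S.normNegSqC p ξ) ^ (1 / 2 : ℝ)) :
    (∃! Φ : S.GeneralizedFunction μ α, S.IsSTransform μ F Φ) ∧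
    ∀ Φ : S.GeneralizedFunction μ α, S.IsSTransform μ F Φ →
      ∀ q : ℕ, q ≤ p →
        ENNReal.ofReal (a * Real.exp 1 ^ 2) * hilbertSchmidtSq (S.incl p q) * growthRate α < 1 →
        ∃ φ : Lp ℂ 2 μ, S.IsRepresentedBy μ Φ φ ∧ φ ∈ S.chaosSpace μ α q ∧
          ∑' n : ℕ, ENNReal.ofReal (growthCoeff α (n + 1)) *
            (ENNReal.ofReal (a * Real.exp 1 ^ 2) * hilbertSchmidtSq (S.incl p q)) ^ (n + 1) < ∞ ∧
          S.normSq μ α q φ ≤ ENNReal.ofReal (K ^ 2) + ENNReal.ofReal (K ^ 2 / (2 * Real.pi)) *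
            ∑' n : ℕ, ENNReal.ofReal (growthCoeff α (n + 1)) *
              (ENNReal.ofReal (a * Real.exp 1 ^ 2) * hilbertSchmidtSq (S.incl p q)) ^ (n + 1) := by
  have hb : ∀ ξ, ‖F ξ‖ ≤
      K * genInv α (a * Complexification.normC (S.riesz p) ξ ^ 2) ^ (1 / 2 : ℝ) := by
    intro ξ
    rw [Complexification.normC_sq, ← S.normNeg_eq, ← S.normNeg_eq]
    exact hbound ξ
  have hG : GateauxEntire F := hα.gateauxEntire hF hK ha (S.riesz p) hb
  -- Existence holds at a level `s` far out in the scale. Under the smallness condition at `q ≤ p`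
  -- the Taylor coefficients are already those of an `L²` function, which represents `Φ` by
  -- uniqueness.
  refine ⟨?_, fun Φ hΦ q hqp hq => ?_⟩
  · obtain ⟨s, A, hAt, hA⟩ := hS.exists_tsum_weighted_taylorForm_le hα hG hK ha hb hB
    obtain ⟨Φ, hΦ⟩ := hS.exists_generalizedFunction (μ := μ) hα s hAt
      (hS.enorm_linearCombination_sq_le_normSq hα hG s hA)
    exact ⟨Φ, hΦ, fun Ψ hΨ => hS.generalizedFunction_ext hα hΨ hΦ⟩
  -- the condition at `q` implies the one at `0`, where `[E_0]_α` lies in `L²`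
  · have hHS : hilbertSchmidtSq (S.incl p 0) ≤ hilbertSchmidtSq (S.incl p q) := by
      refine hilbertSchmidtSq_comp_le _ _ fun v => ?_
      rw [← hS.incl_incl (Nat.zero_le q) hqp]
      exact hS.norm_incl_apply_le (Nat.zero_le q) _
    have h0 : ENNReal.ofReal (a * Real.exp 1 ^ 2) * hilbertSchmidtSq (S.incl p 0) *
        growthRate α < 1 := lt_of_le_of_lt (by gcongr) hq
    obtain ⟨A, hAt, hA⟩ := hS.exists_tsum_taylorForm_le hα hG hK ha hb h0
    obtain ⟨φ, hφ⟩ := hS.exists_sTransform_eq (μ := μ) hG hAt hA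
    have hker : ∀ n, S.kernel μ φ n = HilbertNorms.taylorForm hG n := fun n => by
      rw [HilbertNorms.kernel_eq_taylorForm]
      congr
    have hsum : ∑' n : ℕ, ENNReal.ofReal (growthCoeff α (n + 1)) *
        (ENNReal.ofReal (a * Real.exp 1 ^ 2) * hilbertSchmidtSq (S.incl p q)) ^ (n + 1) < ∞ := by
      refine lt_of_le_of_lt ?_ (hα.tsum_growthCoeff_lt_top hq)
      rw [tsum_eq_sum_range_add (fun n => ENNReal.ofReal (growthCoeff α n) * _) 1]
      exact le_add_self
    have hnorm : S.normSq μ α q φ ≤ ENNReal.ofReal (K ^ 2) +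
        ENNReal.ofReal (K ^ 2 / (2 * Real.pi)) *
          ∑' n : ℕ, ENNReal.ofReal (growthCoeff α (n + 1)) *
            (ENNReal.ofReal (a * Real.exp 1 ^ 2) * hilbertSchmidtSq (S.incl p q)) ^ (n + 1) := by
      simp only [HilbertNorms.normSq, hker]
      exact hS.tsum_hsFormSq_taylorForm_le hα hG hK ha hb hqp
    refine ⟨φ, hS.isRepresentedBy hα (by rwa [hφ]), ?_, hsum, hnorm⟩
    exact hnorm.trans_lt (ENNReal.add_lt_top.2 ⟨ENNReal.ofReal_lt_top,
      ENNReal.mul_lt_top ENNReal.ofReal_lt_top hsum⟩)
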